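/- **Theorem 7.5.** The protocol SFVP2 described below is $\varepsilon$-sound against malicious clients. *Conventions.* "Efficient" means non-uniform polynomial size: classical functions are given by polynomial-size Boolean circuits, quantum operations by polynomial-size quantum circuits, possibly with polynomial-size quantum advice; circuits may be chosen for each value of the public parameters $\kappa, n, m, \varepsilon, f$. A function of the security parameter $\kappa$ is negligible if it tends to $0$ faster than every inverse polynomial. For families of states, $\rho\approx^{\mathrm{ind}}_{\varepsilon}\sigma$ means: for every efficient quantum distinguisher $D$ there is a negligible function $\mathsf{negl}$ with $|\Pr[D(\rho)\to 0]-\Pr[D(\sigma)\to 0]|\le \varepsilon+\mathsf{negl}(\kappa)$. *Set-up.* Public parameters are $1^n,1^m,1^\kappa,1^{1/\varepsilon}$ (so $1/\varepsilon$ is a positive integer) and $f:\{0,1\}^n\to\{0,1\}^m$, given by a circuit. The client has inputs $x\in\{0,1\}^n$ and $r\in\{0,1\}^{n\kappa}$; public are $pp\in\{0,1\}^{3n\kappa}$ and $com=\mathsf{Commit}(x,r,pp)$; here $x$ is arbitrary and $r,pp$ are uniformly random. The server outputs a flag in $\{\mathsf{pass},\mathsf{fail}\}$ and a string in a register $\boldsymbol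 Q$ of $m$ bits. *Ingredients.* (1) $\mathsf{Commit}$ is an efficient, statistically binding function family: for $n=\mathrm{poly}(\kappa)$, the probability over $pp$ that there are $x_0\ne x_1$ and $r_0,r_1$ with $\mathsf{Commit}(x_0,r_0,pp)=\mathsf{Commit}(x_1,r_1,pp)$ is negligible. (2) $\mathsf{Hash}$ is an efficient family of collapsing hash functions: $\mathsf{Hash}(1^m,1^\kappa)$ samples functions $h:\{0,1\}^m\to\{0,1\}^\kappa$ with descriptions of length $\mathrm{poly}(\kappa)$, and no efficient quantum adversary that, given $h$, prepares a state on an $m$-qubit register $X$ and a private register can distinguish, with non-negligible advantage, a measurement of $h(X)$ from a standard basis measurement of $X$. (3) $\mathsf{AoK}$ is an argument of knowledge for relations given by circuits, with efficient verifier, that is $(\delta,C\delta)$-sound for every $\delta>0$ (a function of $\kappa$ with $1/\delta$ polynomially bounded), where $C>0$ is a constant. Here $(\delta,\eta)$-sound means: for every efficient quantum prover there is an efficient quantum extractor such that for all polynomial-size statements and initial states of the prover, if the verifier accepts with probability at least $1-\delta$, then the extractor, applied to the prover's initial state, outputs a witness with probability at least $1-\eta-\mathsf{negl}(\kappa)$.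 (A succinct zero-knowledge argument of knowledge with $\mathsf{poly}_{\mathrm{AoK}}(\delta)=C\delta$ is a special case.) (4) SFVP is a two-party protocol (with quantum messages) for $f$, the client's input $x$ and error tolerance $\varepsilon$, with efficient honest server, whose server-side outcome is a string in $\{0,1\}^m$. Nothing else about SFVP is needed here. *Protocol SFVP2.* 1. Both parties execute SFVP. Let $y$ be the server's outcome. 2. The server samples $h\leftarrow\mathsf{Hash}(1^m,1^\kappa)$, computes $c=h(y)$ and sends $(h,c)$ to the client. 3. For $L=\lceil 16/(\varepsilon^2\cdot\tfrac{\varepsilon}{4C})\rceil$ rounds, the client proves to the server with $\mathsf{AoK}$ the statement $\exists(x,r):\ h(f(x))=c\ \wedge\ \mathsf{Commit}(x,r,pp)=com$. If all rounds pass, the server sets its flag to $\mathsf{pass}$ and stores $y$ in $\boldsymbol Q$; otherwise it sets its flag to $\mathsf{fail}$. *Claim.* For every efficient quantum adversary $\mathsf{Adv}$ in the role of the client there are efficient quantum operations $\mathsf{Sim}_0,\mathsf{Sim}_1$ on the client's side such that, for all polynomial-size $1^n,1^m,1^{1/\varepsilon},f,x$ and every initial state $\rho_0$ on the client's private register and an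 environment, $$\mathsf{SFVP2}^{\mathsf{Adv}}(\rho_0)\ \approx^{\mathrm{ind}}_{\varepsilon}\ \mathsf{Sim}_1(\mathsf{Ideal}(\mathsf{Sim}_0(\rho_0))).$$ Here $r,pp$ are uniform and the client's side is given $x,r,pp,com$ ($\rho_0$ may depend on them). $\mathsf{Sim}_0$ outputs a bit $b$; $\mathsf{Ideal}$ sets the server's flag to $\mathsf{pass}$ and stores $f(x)$ in $\boldsymbol Q$ if $b=0$, and sets the flag to $\mathsf{fail}$ if $b=1$. The states that are compared consist of the client's registers, the environment, the server's flag and $\boldsymbol Q$. -/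

import Mathlib

open scoped BigOperators ComplexOrder

noncomputable section

/-! ## Boolean circuits

Circuits with fan-in two gates; `B : BCirc α β` has input wires `α` and output wires `β`. -/

inductive BCirc : Type → Type → Type 1
  /-- copying, permuting and dropping wires: output `b` is a copy of input `σ b` -/
  | wire {α β : Type} [Fintype β] (σ : β → α) : BCirc α β
  | const {α : Type} (v : Bool) : BCirc α Unit
  | gate (g : Bool → Bool → Bool) : BCirc (Unit ⊕ Unit) Unit
  | comp {α β γ : Type} (B : BCirc α β) (C : BCirc β γ) : BCirc α γ
  | par {α β γ δ : Type} (B : BCirc α β) (C : BCirc γ δ) : BCirc (α ⊕ γ) (β ⊕ δ)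

namespace BCirc

/-- The function computed by a Boolean circuit. -/
def eval : {α β : Type} → BCirc α β → (α → Bool) → (β → Bool)
  | _, _, wire σ, x => fun b => x (σ b)
  | _, _, const v, _ => fun _ => v
  | _, _, gate g, x => fun _ => g (x (Sum.inl ())) (x (Sum.inr ()))
  | _, _, comp B C, x => C.eval (B.eval x)
  | _, _, par B C, x =>
      Sum.elim (B.eval fun i => x (Sum.inl i)) (C.eval fun i => x (Sum.inr i))

/-- The size: number of gates; copied wires are charged as well. -/
def size : {α β : Type} → BCirc α β → ℕ
  | _, _, @wire _ β _ _ => Fintype.card β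
  | _, _, const _ => 1
  | _, _, gate _ => 1
  | _, _, comp B C => B.size + C.size
  | _, _, par B C => B.size + C.size

/-- Equality test of two `k`-bit strings. -/
def eqTest : (k : ℕ) → BCirc (Fin k ⊕ Fin k) Unit
  | 0 => const true
  | k + 1 =>
      comp
        (comp
          (wire (β := (Unit ⊕ Unit) ⊕ (Fin k ⊕ Fin k))
            (Sum.elim (Sum.elim (fun _ => Sum.inl 0) (fun _ => Sum.inr 0))
              (Sum.elim (fun i : Fin k => Sum.inl i.succ) (fun i : Fin k => Sum.inr i.succ))))
          (par (gate fun a b => a == b) (eqTest k)))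
        (gate fun a b => a && b)

theorem eqTest_eval (k : ℕ) (x : Fin k ⊕ Fin k → Bool) :
    (eqTest k).eval x () = true ↔
      (fun i => x (Sum.inl i)) = (fun i => x (Sum.inr i)) := by
  induction k with
  | zero => simp [eqTest, eval, funext_iff]
  | succ k ih =>
    have h := ih (Sum.elim (fun i : Fin k => x (Sum.inl i.succ)) (fun i : Fin k => x (Sum.inr i.succ)))
    have e : (Sum.elim (fun i : Fin k => x (Sum.inl i.succ)) (fun i => x (Sum.inr i.succ)))
        = fun i => x (Sum.elim (fun i : Fin k => Sum.inl i.succ) (fun i : Fin k => Sum.inr i.succ) i) := by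
      funext i; cases i <;> rfl
    rw [e] at h
    simp only [eqTest, eval, Sum.elim_inl, Sum.elim_inr, Bool.and_eq_true, beq_iff_eq]
    rw [h]
    simp only [funext_iff, Sum.elim_inl, Sum.elim_inr, Fin.forall_fin_succ]

end BCirc

/-! ## Quantum circuits on labelled qubits -/

/-- Operators on the Hilbert space of the qubits labelled by `W`, in the standard basis. -/
abbrev DM (W : Type) : Type := Matrix (W → Bool) (W → Bool) ℂ

/-- Elementary operations. `classical B e` is the reversible evaluation
`|x, z⟩ ↦ |x, z ⊕ B(x)⟩` of a Boolean circuit `B` (so NOT, CNOT and Toffoli are instances); it is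
charged by the size of `B`, which is the cost of its implementation by Toffoli gates up to a
constant factor. -/
inductive Gate (W : Type) : Type 1
  | had (w : W) : Gate W
  | phaseT (w : W) : Gate W
  | classical {α β : Type} (B : BCirc α β) (e : α ⊕ β ↪ W) : Gate W
  /-- measure a qubit in the standard basis and keep the outcome in it -/
  | measure (w : W) : Gate W
  /-- discard a qubit and replace it by `|0⟩` -/
  | reset (w : W) : Gate W

/-- Matrix entries of the Hadamard gate. -/
def hadEntry (s t : Bool) : ℂ := (if s && t then -1 else 1) / (Real.sqrt 2 : ℂ)

/-- Diagonal entries of the `T` gate. -/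
def tEntry (s : Bool) : ℂ := if s then Complex.exp (Real.pi / 4 * Complex.I) else 1

/-- `|x, z⟩ ↦ |x, z ⊕ B(x)⟩` on basis states. -/
def xorEval {W α β : Type} (B : BCirc α β) (e : α ⊕ β ↪ W) (x : W → Bool) : W → Bool :=
  fun w => xor (x w)
    (Function.extend (fun b => e (Sum.inr b)) (B.eval fun i => x (e (Sum.inl i)))
      (fun _ => false) w)

/-- The measurement of a classical function `g` of the basis state, outcome forgotten. -/
def dephase {W γ : Type} (g : (W → Bool) → γ) (ρ : DM W) : DM W :=
  open Classical in Matrix.of fun a b => if g a = g b then ρ a b else 0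

namespace Gate

/-- The action of a gate on density operators. -/
def apply {W : Type} : Gate W → DM W → DM W
  | had w, ρ => open Classical in Matrix.of fun a b =>
      ∑ s : Bool, ∑ t : Bool, hadEntry (a w) s * hadEntry (b w) t *
        ρ (Function.update a w s) (Function.update b w t)
  | phaseT w, ρ => Matrix.of fun a b => tEntry (a w) * star (tEntry (b w)) * ρ a b
  | classical B e, ρ => Matrix.of fun a b => ρ (xorEval B e a) (xorEval B e b)
  | measure w, ρ => dephase (fun a => a w) ρ
  | reset w, ρ => open Classical in Matrix.of fun a b =>
      if a w = false ∧ b w = false then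
        ∑ s : Bool, ρ (Function.update a w s) (Function.update b w s) else 0

def cost {W : Type} : Gate W → ℕ
  | classical B _ => B.size + 1
  | _ => 1

def map {V W : Type} (f : V ↪ W) : Gate V → Gate W
  | had w => had (f w)
  | phaseT w => phaseT (f w)
  | classical B e => classical B (e.trans f)
  | measure w => measure (f w)
  | reset w => reset (f w)

end Gate

/-- A quantum circuit: a sequence of gates. -/
abbrev Circuit (W : Type) : Type 1 := List (Gate W)

namespace Circuit

def run {W : Type} (C : Circuit W) (ρ : DM W) : DM W := C.foldl (fun σ g => g.apply σ) ρ

def size {W : Type} (C : Circuit W) : ℕ := (C.map Gate.cost).sum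

/-- The same circuit acting on some of the qubits of a larger system. -/
def on {V W : Type} (f : V ↪ W) (C : Circuit V) : Circuit W := C.map (Gate.map f)

end Circuit

/-- Density operators. -/
def IsDensity {W : Type} [Fintype W] (ρ : DM W) : Prop :=
  open Classical in ρ.PosSemidef ∧ ρ.trace = 1

/-- The state that is `ρ` on the qubits in the range of `f` and the basis state `z` elsewhere. -/
def place {V W : Type} (f : V ↪ W) (ρ : DM V) (z : W → Bool) : DM W :=
  open Classical in Matrix.of fun a b =>
    if ∀ w, w ∉ Set.range f → a w = z w ∧ b w = z w then
      ρ (fun v => a (f v)) (fun v => b (f v)) else 0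

/-- The reduced state on the qubits in the range of `f` (all others are traced out). -/
def reduce {V W : Type} [Fintype W] (f : V ↪ W) (ρ : DM W) : DM V :=
  open Classical in Matrix.of fun a b =>
    ∑ a' : W → Bool, ∑ b' : W → Bool,
      if (fun v => a' (f v)) = a ∧ (fun v => b' (f v)) = b ∧
          (∀ w, w ∉ Set.range f → a' w = b' w) then ρ a' b' else 0

/-- The probability that a standard basis measurement gives an outcome satisfying `P`. -/
def prob {W : Type} [Fintype W] (P : (W → Bool) → Prop) (ρ : DM W) : ℝ :=
  open Classical in ∑ a : W → Bool, if P a then (ρ a a).re else 0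

/-! ## Asymptotics -/

def PolyBounded (s : ℕ → ℕ) : Prop := ∃ q : Polynomial ℕ, ∀ κ, s κ ≤ q.eval κ

/-- Negligible: `κ ^ c * ν κ → 0` for every `c`. -/
def Negligible (ν : ℕ → ℝ) : Prop :=
  Asymptotics.SuperpolynomialDecay Filter.atTop (fun κ : ℕ => (κ : ℝ)) ν

/-- `ε`-indistinguishability of two families of states on registers `Out κ` against every efficient
quantum distinguisher: a polynomial-size circuit family with a polynomial-size advice state. -/
def Indist {Out : ℕ → Type} [∀ κ, Fintype (Out κ)] (ε : ℕ → ℝ)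
    (ρ σ : ∀ κ, DM (Out κ)) : Prop :=
  ∀ (k : ℕ → ℕ) (D : ∀ κ, Circuit (Out κ ⊕ Fin (k κ + 1))) (adv : ∀ κ, DM (Fin (k κ + 1))),
    PolyBounded k → PolyBounded (fun κ => (D κ).size) → (∀ κ, IsDensity (adv κ)) →
    ∃ ν : ℕ → ℝ, Negligible ν ∧ ∀ κ,
      let p (τ : DM (Out κ)) : ℝ :=
        prob (fun a => a (Sum.inr 0) = false)
          ((D κ).run (Matrix.of fun a b =>
            τ (fun i => a (Sum.inl i)) (fun i => b (Sum.inl i)) *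
              adv κ (fun i => a (Sum.inr i)) (fun i => b (Sum.inr i))))
      |p (ρ κ) - p (σ κ)| ≤ ε κ + ν κ

/-! ## Collapsing hash functions -/

/-- `gen n κ` turns uniform coins into the description of a function, and `ev n κ` evaluates
the described function `{0,1}ⁿ → {0,1}^κ`. -/
structure HashFamily : Type 1 where
  coins : ℕ → ℕ → ℕ
  desc : ℕ → ℕ → ℕ
  gen : ∀ n κ, BCirc (Fin (coins n κ)) (Fin (desc n κ))
  ev : ∀ n κ, BCirc (Fin (desc n κ) ⊕ Fin n) (Fin κ)

namespace HashFamily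

/-- Polynomial-size sampling and evaluation; descriptions of length `poly(κ)`. -/
def Efficient (H : HashFamily) : Prop :=
  (∃ q : Polynomial ℕ, ∀ n κ,
    H.coins n κ + (H.gen n κ).size + (H.ev n κ).size ≤ q.eval (n + κ)) ∧
  (∃ q : Polynomial ℕ, ∀ n κ, H.desc n κ ≤ q.eval κ)

/-- The collapsing game: the adversary gets `h` and advice, prepares a state on the registers
`X` and `S`; then the classical function `M h` of `X` is measured; then the adversary gets `X`, `S`
and (again) `h` and outputs a bit. The value is the probability of the output `0`. -/
def game (H : HashFamily) (n κ s : ℕ) {γ : Type}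
    (A₁ A₂ : Circuit (Fin (H.desc n κ) ⊕ (Fin n ⊕ Fin (s + 1)))) (adv : DM (Fin (s + 1)))
    (M : (Fin (H.desc n κ) → Bool) → (Fin n → Bool) → γ) : ℝ :=
  (∑ u : Fin (H.coins n κ) → Bool,
    let h := (H.gen n κ).eval u
    let ρ₀ := place (Function.Embedding.inr.trans Function.Embedding.inr) adv
      (Sum.elim h fun _ => false)
    let ρ₁ := dephase (fun a => M h fun i => a (Sum.inr (Sum.inl i))) (Circuit.run A₁ ρ₀)
    let ρ₂ := place Function.Embedding.inr (reduce Function.Embedding.inr ρ₁)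
      (Sum.elim h fun _ => false)
    prob (fun a => a (Sum.inr (Sum.inr 0)) = false) (Circuit.run A₂ ρ₂)) / 2 ^ H.coins n κ

/-- No efficient adversary notices whether `h(X)` or all of `X` is measured. -/
def Collapsing (H : HashFamily) : Prop :=
  H.Efficient ∧
  ∀ (n s : ℕ → ℕ)
    (A₁ A₂ : ∀ κ, Circuit (Fin (H.desc (n κ) κ) ⊕ (Fin (n κ) ⊕ Fin (s κ + 1))))
    (adv : ∀ κ, DM (Fin (s κ + 1))),
    PolyBounded n → PolyBounded s → PolyBounded (fun κ => (A₁ κ).size + (A₂ κ).size) →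
    (∀ κ, IsDensity (adv κ)) →
    ∃ ν : ℕ → ℝ, Negligible ν ∧ ∀ κ,
      |H.game (n κ) κ (s κ) (A₁ κ) (A₂ κ) (adv κ)
          (fun h x => (H.ev (n κ) κ).eval (Sum.elim h x)) -
        H.game (n κ) κ (s κ) (A₁ κ) (A₂ κ) (adv κ) (fun _ x => x)| ≤ ν κ

end HashFamily

/-! ## Statistically binding commitments -/

/-- `Commit(x, r, pp)` for `x ∈ {0,1}ⁿ`, `r ∈ {0,1}^{nκ}`, `pp ∈ {0,1}^{3nκ}`. -/
structure CommitFamily : Type 1 where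
  len : ℕ → ℕ → ℕ
  circ : ∀ n κ, BCirc (Fin n ⊕ (Fin (n * κ) ⊕ Fin (3 * n * κ))) (Fin (len n κ))

namespace CommitFamily

def commit (Com : CommitFamily) (n κ : ℕ) (x : Fin n → Bool) (r : Fin (n * κ) → Bool)
    (pp : Fin (3 * n * κ) → Bool) : Fin (Com.len n κ) → Bool :=
  (Com.circ n κ).eval (Sum.elim x (Sum.elim r pp))

def Efficient (Com : CommitFamily) : Prop :=
  ∃ q : Polynomial ℕ, ∀ n κ, Com.len n κ + (Com.circ n κ).size ≤ q.eval (n + κ)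

def StatisticallyBinding (Com : CommitFamily) : Prop :=
  ∀ n : ℕ → ℕ, PolyBounded n → ∃ ν : ℕ → ℝ, Negligible ν ∧ ∀ κ,
    (Nat.card {pp : Fin (3 * n κ * κ) → Bool // ∃ x₀ r₀ x₁ r₁,
      Com.commit (n κ) κ x₀ r₀ pp = Com.commit (n κ) κ x₁ r₁ pp ∧ x₀ ≠ x₁} : ℝ) /
      2 ^ (3 * n κ * κ) ≤ ν κ

end CommitFamily

/-! ## Interactive protocols -/

/-- The honest side of an interactive protocol, with input register `I` and output register `O`.
`Msg` is the message register, which travels between the parties. In each cycle the other party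
acts and sends `Msg`; then the honest party applies its next step and sends `Msg` back. -/
structure Machine (I O : Type) : Type 1 where
  Msg : Type
  Work : Type
  [msgFin : Fintype Msg]
  [workFin : Fintype Work]
  steps : List (Circuit (Msg ⊕ (I ⊕ (O ⊕ Work))))

attribute [instance] Machine.msgFin Machine.workFin

namespace Machine

variable {I O : Type}

def size (V : Machine I O) : ℕ :=
  Fintype.card V.Msg + Fintype.card V.Work + V.steps.length + (V.steps.map Circuit.size).sum

/-- The qubits during an interaction: those of the other party (`K` and the message register),
and those of the honest party. -/
abbrev Joint (V : Machine I O) (K : Type) : Type := (K ⊕ V.Msg) ⊕ (I ⊕ (O ⊕ V.Work))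

/-- The interaction of the honest party with a party whose `i`-th operation is `A i`. -/
def interact (V : Machine I O) {K : Type} (A : ℕ → Circuit (K ⊕ V.Msg)) :
    Circuit (V.Joint K) :=
  V.steps.zipIdx.flatMap fun s =>
    (A s.2).on Function.Embedding.inl ++
      s.1.on (Function.Embedding.sumMap Function.Embedding.inr (Function.Embedding.refl _))

/-- The total size of the operations `A i` that are used in the interaction. -/
def advSize (V : Machine I O) {K : Type} (A : ℕ → Circuit (K ⊕ V.Msg)) : ℕ :=
  ∑ i ∈ Finset.range V.steps.length, (A i).size

end Machine

/-! ## Arguments of knowledge -/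

/-- The honest verifiers of an argument system: for problem sizes `a`, `b`, a relation
`R ⊆ {0,1}ᵃ × {0,1}ᵇ` given by a circuit, a verifier whose input register holds the statement and
whose output register is the flag (`true` for pass). -/
abbrev ArgSystem : Type 1 :=
  ∀ (_κ a b : ℕ), BCirc (Fin a ⊕ Fin b) Unit → Machine (Fin a) Unit

namespace ArgSystem

def Efficient (V : ArgSystem) : Prop :=
  ∃ q : Polynomial ℕ, ∀ κ a b R, (V κ a b R).size ≤ q.eval (κ + a + b + R.size)

/-- The probability that the verifier accepts the statement `x` when it interacts with the prover
`A` with initial state `ρ₀`. -/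
def acceptProb (V : ArgSystem) (κ a b : ℕ) (R : BCirc (Fin a ⊕ Fin b) Unit) {k : ℕ}
    (A : ℕ → Circuit (Fin k ⊕ (V κ a b R).Msg)) (ρ₀ : DM (Fin k ⊕ (V κ a b R).Msg))
    (x : Fin a → Bool) : ℝ :=
  prob (fun c => c (Sum.inr (Sum.inr (Sum.inl ()))) = true)
    (((V κ a b R).interact A).run
      (place Function.Embedding.inl ρ₀ (Sum.elim (fun _ => false) (Sum.elim x fun _ => false))))

/-- The probability that the extractor, applied to the prover's initial state, the statement and
its advice, outputs a witness. -/
def extractProb {P : Type} [Fintype P] {a b e : ℕ} (R : BCirc (Fin a ⊕ Fin b) Unit)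
    (E : Circuit ((P ⊕ Fin e) ⊕ (Fin a ⊕ Fin b))) (adv : DM (Fin e)) (ρ₀ : DM P)
    (x : Fin a → Bool) : ℝ :=
  prob (fun c => R.eval (Sum.elim x fun i => c (Sum.inr (Sum.inr i))) () = true)
    (E.run (place Function.Embedding.inl
      (Matrix.of fun c d =>
        ρ₀ (fun i => c (Sum.inl i)) (fun i => d (Sum.inl i)) *
          adv (fun i => c (Sum.inr i)) (fun i => d (Sum.inr i)))
      (Sum.elim (fun _ => false) (Sum.elim x fun _ => false))))

/-- `(δ, ε)`-soundness of an argument of knowledge: if the verifier accepts with probability at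
least `1 - δ`, then the extractor finds a witness with probability at least
`1 - ε - negl(κ)`. (Advice of the prover can be a part of the initial state.) -/
def KnowledgeSound (V : ArgSystem) (δ ε : ℕ → ℝ) : Prop :=
  ∀ (a b : ℕ → ℕ) (R : ∀ κ, BCirc (Fin (a κ) ⊕ Fin (b κ)) Unit),
    PolyBounded a → PolyBounded b → PolyBounded (fun κ => (R κ).size) →
  ∀ (k : ℕ → ℕ) (A : ∀ κ, ℕ → Circuit (Fin (k κ) ⊕ (V κ (a κ) (b κ) (R κ)).Msg)),
    PolyBounded k → PolyBounded (fun κ => (V κ (a κ) (b κ) (R κ)).advSize (A κ)) →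
  ∃ (e : ℕ → ℕ)
    (E : ∀ κ, Circuit (((Fin (k κ) ⊕ (V κ (a κ) (b κ) (R κ)).Msg) ⊕ Fin (e κ)) ⊕
      (Fin (a κ) ⊕ Fin (b κ))))
    (adv : ∀ κ, DM (Fin (e κ))),
    PolyBounded e ∧ PolyBounded (fun κ => (E κ).size) ∧ (∀ κ, IsDensity (adv κ)) ∧
  ∀ (x : ∀ κ, Fin (a κ) → Bool) (ρ₀ : ∀ κ, DM (Fin (k κ) ⊕ (V κ (a κ) (b κ) (R κ)).Msg)),
    (∀ κ, IsDensity (ρ₀ κ)) →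
  ∃ ν : ℕ → ℝ, Negligible ν ∧ ∀ κ,
    1 - δ κ ≤ V.acceptProb κ (a κ) (b κ) (R κ) (A κ) (ρ₀ κ) (x κ) →
      1 - ε κ - ν κ ≤ extractProb (R κ) (E κ) (adv κ) (ρ₀ κ) (x κ)

/-- `(δ, O(δ))`-soundness, with constant `c`, for all `δ > 0` (which may depend on the security
parameter, with `1 / δ` polynomially bounded). -/
def LinearlyKnowledgeSound (V : ArgSystem) (c : ℝ) : Prop :=
  ∀ δ : ℕ → ℝ, (∀ κ, 0 < δ κ) → (∃ q : Polynomial ℕ, ∀ κ, 1 / δ κ ≤ (q.eval κ : ℕ)) →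
    V.KnowledgeSound δ fun κ => c * δ κ

end ArgSystem

/-! ## Function value preparation with a committed input -/

/-- The public parameters, except for the security parameter: the sizes `1ⁿ`, `1ᵐ`, the error
tolerance `1^{1/ε}` and the function `f`. -/
structure Params : Type 1 where
  n : ℕ
  m : ℕ
  invε : ℕ
  invε_pos : 0 < invε
  f : BCirc (Fin n) (Fin m)

namespace Params

def size (p : Params) : ℕ := p.n + p.m + p.invε + p.f.size

def ε (p : Params) : ℝ := 1 / (p.invε : ℝ)

end Params

/-- The public inputs `pp`, `com`. -/
abbrev PubReg (Com : CommitFamily) (κ : ℕ) (p : Params) : Type :=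
  Fin (3 * p.n * κ) ⊕ Fin (Com.len p.n κ)

/-- The client's inputs `x`, `r`, `pp`, `com`. -/
abbrev ClientReg (Com : CommitFamily) (κ : ℕ) (p : Params) : Type :=
  (Fin p.n ⊕ Fin (p.n * κ)) ⊕ PubReg Com κ p

/-- The server's outputs: the flag (`true` for pass) and the register for `f(x)`. -/
abbrev ServerOut (p : Params) : Type := Unit ⊕ Fin p.m

/-- The honest server's side of a protocol for function value preparation with a committed
input. (Against a malicious client nothing else of the protocol is executed.) -/
abbrev ServerProtocol (Com : CommitFamily) : Type 1 :=
  ∀ (κ : ℕ) (p : Params), Machine (PubReg Com κ p) (ServerOut p)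

section Soundness

variable {Com : CommitFamily}

/-- A malicious client: `c` private qubits besides its input register, and its operations. -/
structure MaliciousClient (π : ServerProtocol Com) : Type 1 where
  c : ℕ → Params → ℕ
  act : ∀ κ p, ℕ → Circuit ((ClientReg Com κ p ⊕ Fin (c κ p)) ⊕ (π κ p).Msg)

def MaliciousClient.Efficient {π : ServerProtocol Com} (A : MaliciousClient π) : Prop :=
  ∃ q : Polynomial ℕ, ∀ κ p,
    A.c κ p + (π κ p).advSize (A.act κ p) ≤ q.eval (κ + p.size)

/-- All qubits outside the server: the client's (inputs, private qubits), the environment's (`e`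
qubits) and the message register. -/
abbrev OutsideReg {π : ServerProtocol Com} (A : MaliciousClient π) (κ : ℕ) (p : Params) (e : ℕ) :
    Type :=
  ((ClientReg Com κ p ⊕ Fin (A.c κ p)) ⊕ Fin e) ⊕ (π κ p).Msg

/-- The qubits of the final state: all those outside the server, and the server's outputs. -/
abbrev FinalReg {π : ServerProtocol Com} (A : MaliciousClient π) (κ : ℕ) (p : Params) (e : ℕ) :
    Type :=
  OutsideReg A κ p e ⊕ ServerOut p

/-- Operations on the client's side do not touch the environment. -/
def clientPart {π : ServerProtocol Com} (A : MaliciousClient π) (κ : ℕ) (p : Params) (e : ℕ) :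
    ((ClientReg Com κ p ⊕ Fin (A.c κ p)) ⊕ (π κ p).Msg) ↪ OutsideReg A κ p e :=
  Function.Embedding.sumMap Function.Embedding.inl (Function.Embedding.refl _)

/-- The register (client's private qubits and environment) that holds the initial state. -/
def initPart {π : ServerProtocol Com} (A : MaliciousClient π) (κ : ℕ) (p : Params) (e : ℕ) :
    (Fin (A.c κ p) ⊕ Fin e) ↪ OutsideReg A κ p e :=
  (Function.Embedding.sumMap Function.Embedding.inr (Function.Embedding.refl _)).trans
    Function.Embedding.inl

/-- The public inputs when the set-up is done honestly. -/
def pubInput (Com : CommitFamily) (κ : ℕ) (p : Params) (x : Fin p.n → Bool)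
    (r : Fin (p.n * κ) → Bool) (pp : Fin (3 * p.n * κ) → Bool) : PubReg Com κ p → Bool :=
  Sum.elim pp (Com.commit p.n κ x r pp)

/-- The classical values outside the server at the beginning. -/
def outsideInput {π : ServerProtocol Com} (A : MaliciousClient π) (κ : ℕ) (p : Params) (e : ℕ)
    (x : Fin p.n → Bool) (r : Fin (p.n * κ) → Bool) (pp : Fin (3 * p.n * κ) → Bool) :
    OutsideReg A κ p e → Bool :=
  Sum.elim
    (Sum.elim (Sum.elim (Sum.elim (Sum.elim x r) (pubInput Com κ p x r pp)) fun _ => false)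
      fun _ => false)
    fun _ => false

/-- The final state of the real execution `π^A(ρ₀)` for given `x`, `r`, `pp` and
`com = Commit(x, r, pp)`. -/
def realState (π : ServerProtocol Com) (A : MaliciousClient π) (κ : ℕ) (p : Params) (e : ℕ)
    (x : Fin p.n → Bool) (r : Fin (p.n * κ) → Bool) (pp : Fin (3 * p.n * κ) → Bool)
    (ρ₀ : DM (Fin (A.c κ p) ⊕ Fin e)) : DM (FinalReg A κ p e) :=
  reduce
    (Function.Embedding.sumMap (Function.Embedding.refl (OutsideReg A κ p e))
      (Function.Embedding.inl.trans Function.Embedding.inr))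
    (((π κ p).interact fun i => (A.act κ p i).on (clientPart A κ p e)).run
      (place ((initPart A κ p e).trans Function.Embedding.inl) ρ₀
        (Sum.elim (outsideInput A κ p e x r pp)
          (Sum.elim (pubInput Com κ p x r pp) fun _ => false))))

/-- A simulator `(Sim₀, Sim₁)`: both circuits act on the client's side (with `k + 1` further
qubits); the bit `b` is taken from the further qubit `0` after `Sim₀`. -/
structure ClientSimulator {π : ServerProtocol Com} (A : MaliciousClient π) : Type 1 where
  k : ℕ → Params → ℕ
  sim₀ : ∀ κ p, Circuit
    (((ClientReg Com κ p ⊕ Fin (A.c κ p)) ⊕ (π κ p).Msg) ⊕ Fin (k κ p + 1))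
  sim₁ : ∀ κ p, Circuit
    (((ClientReg Com κ p ⊕ Fin (A.c κ p)) ⊕ (π κ p).Msg) ⊕ Fin (k κ p + 1))

def ClientSimulator.Efficient {π : ServerProtocol Com} {A : MaliciousClient π}
    (S : ClientSimulator A) : Prop :=
  ∃ q : Polynomial ℕ, ∀ κ p,
    S.k κ p + (S.sim₀ κ p).size + (S.sim₁ κ p).size ≤ q.eval (κ + p.size)

/-- The ideal functionality with output value `y`: it measures the bit `b`; if `b = 0` it sets the
flag to pass and stores `y` in the output register; if `b = 1` it sets the flag to fail. (The
flag and the output register hold zeros before.) -/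
def idealFunctionality {K : Type} {m : ℕ} (b : K) (y : Fin m → Bool)
    (ρ : DM (K ⊕ (Unit ⊕ Fin m))) : DM (K ⊕ (Unit ⊕ Fin m)) :=
  let u : (K ⊕ (Unit ⊕ Fin m) → Bool) → (K ⊕ (Unit ⊕ Fin m) → Bool) := fun a =>
    Sum.elim (fun i => a (Sum.inl i))
      (Sum.elim (fun _ => xor (a (Sum.inr (Sum.inl ()))) (!a (Sum.inl b)))
        (fun j => xor (a (Sum.inr (Sum.inr j))) (!a (Sum.inl b) && y j)))
  Matrix.of fun a a' => dephase (fun c => c (Sum.inl b)) ρ (u a) (u a')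

/-- The final state `Sim₁(Ideal(Sim₀(ρ₀)))` of the ideal world. -/
def idealState {π : ServerProtocol Com} {A : MaliciousClient π} (S : ClientSimulator A)
    (κ : ℕ) (p : Params) (e : ℕ)
    (x : Fin p.n → Bool) (r : Fin (p.n * κ) → Bool) (pp : Fin (3 * p.n * κ) → Bool)
    (ρ₀ : DM (Fin (A.c κ p) ⊕ Fin e)) : DM (FinalReg A κ p e) :=
  let side : (((ClientReg Com κ p ⊕ Fin (A.c κ p)) ⊕ (π κ p).Msg) ⊕ Fin (S.k κ p + 1)) ↪
      (OutsideReg A κ p e ⊕ Fin (S.k κ p + 1)) ⊕ ServerOut p :=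
    (Function.Embedding.sumMap (clientPart A κ p e) (Function.Embedding.refl _)).trans
      Function.Embedding.inl
  let ρ₁ := place ((initPart A κ p e).trans
      (Function.Embedding.inl.trans Function.Embedding.inl)) ρ₀
    (Sum.elim (Sum.elim (outsideInput A κ p e x r pp) fun _ => false) fun _ => false)
  let ρ₂ := ((S.sim₀ κ p).on side).run ρ₁
  let ρ₃ := idealFunctionality (Sum.inr 0) (p.f.eval x) ρ₂
  reduce (Function.Embedding.sumMap Function.Embedding.inl (Function.Embedding.refl _))
    (((S.sim₁ κ p).on side).run ρ₃)

/-- The expectation of a state over uniform `r` and `pp`. -/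
def averageState {W : Type} {a b : ℕ} (ρ : (Fin a → Bool) → (Fin b → Bool) → DM W) : DM W :=
  ((2 : ℂ) ^ (a + b))⁻¹ • ∑ r : Fin a → Bool, ∑ pp : Fin b → Bool, ρ r pp

/-- `ε`-soundness against malicious clients. The initial state on the client's private qubits and
the environment is arbitrary and may even depend on `x`, `r` and `pp`; so the environment, which the
distinguisher sees, may hold all inputs, and quantum advice for the client and the distinguisher is
covered. -/
def SoundAgainstClients (π : ServerProtocol Com) : Prop :=
  ∀ A : MaliciousClient π, A.Efficient →
  ∃ S : ClientSimulator A, S.Efficient ∧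
  ∀ (p : ℕ → Params) (x : ∀ κ, Fin (p κ).n → Bool) (e : ℕ → ℕ)
    (ρ₀ : ∀ κ, (Fin ((p κ).n * κ) → Bool) → (Fin (3 * (p κ).n * κ) → Bool) →
      DM (Fin (A.c κ (p κ)) ⊕ Fin (e κ))),
    PolyBounded (fun κ => (p κ).size) → (∀ κ r pp, IsDensity (ρ₀ κ r pp)) →
    Indist (fun κ => (p κ).ε)
      (fun κ => averageState fun r pp =>
        realState π A κ (p κ) (e κ) (x κ) r pp (ρ₀ κ r pp))
      (fun κ => averageState fun r pp =>
        idealState S κ (p κ) (e κ) (x κ) r pp (ρ₀ κ r pp))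

end Soundness

/-! ## The protocol -/

/-- The honest server's part of the subprotocol SFVP that delivers `f(x)`, in the form of an
arbitrary protocol with quantum messages, chosen for each `κ`, `n`, `m`, `ε` and `f`; its output is
the register `y`. -/
abbrev SFVPServer : Type 1 := ∀ (_κ : ℕ) (p : Params), Machine Empty (Fin p.m)

def SFVPServer.Efficient (F : SFVPServer) : Prop :=
  ∃ q : Polynomial ℕ, ∀ κ p, (F κ p).size ≤ q.eval (κ + p.size)

/-- What the protocol is made of; `c` is the constant in `poly_AoK(δ) = c * δ`. -/
structure Ingredients : Type 1 where
  Com : CommitFamily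
  Hash : HashFamily
  AoK : ArgSystem
  c : ℝ
  SFVP : SFVPServer

namespace Ingredients

variable (G : Ingredients) (κ : ℕ) (p : Params)

/-- The number of rounds `16 / (ε² · poly_AoK⁻¹(ε / 4))`, rounded up. -/
def rounds : ℕ := ⌈16 / (p.ε ^ 2 * (p.ε / 4 / G.c))⌉₊

/-- The parts `h`, `c`, `pp`, `com` of the statement. -/
abbrev StmtReg : Type := (Fin (G.Hash.desc p.m κ) ⊕ Fin κ) ⊕ PubReg G.Com κ p

/-- The parts `x`, `r` of the witness. -/
abbrev WitReg : Type := Fin p.n ⊕ Fin (p.n * κ)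

abbrev stmtLen : ℕ := (G.Hash.desc p.m κ + κ) + (3 * p.n * κ + G.Com.len p.n κ)

abbrev witLen : ℕ := p.n + p.n * κ

/-- Statements as bit strings: concatenation. -/
def stmtEquiv : StmtReg G κ p ≃ Fin (stmtLen G κ p) :=
  (Equiv.sumCongr finSumFinEquiv finSumFinEquiv).trans finSumFinEquiv

def witEquiv : WitReg κ p ≃ Fin (witLen κ p) := finSumFinEquiv

/-- A circuit for the relation `h(f(x)) = c ∧ Commit(x, r, pp) = com` between `(h, c, pp, com)` and
`(x, r)`. -/
def relation : BCirc (Fin (stmtLen G κ p) ⊕ Fin (witLen κ p)) Unit :=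
  let hashPart : BCirc ((Fin (G.Hash.desc p.m κ) ⊕ Fin p.n) ⊕ Fin κ) Unit :=
    ((((BCirc.wire id).par p.f).comp (G.Hash.ev p.m κ)).par (BCirc.wire id)).comp (BCirc.eqTest κ)
  let comPart : BCirc ((Fin p.n ⊕ (Fin (p.n * κ) ⊕ Fin (3 * p.n * κ))) ⊕
      Fin (G.Com.len p.n κ)) Unit :=
    ((G.Com.circ p.n κ).par (BCirc.wire id)).comp (BCirc.eqTest _)
  let stmt (i : StmtReg G κ p) : Fin (stmtLen G κ p) ⊕ Fin (witLen κ p) :=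
    Sum.inl (stmtEquiv G κ p i)
  let wit (i : WitReg κ p) : Fin (stmtLen G κ p) ⊕ Fin (witLen κ p) :=
    Sum.inr (witEquiv κ p i)
  ((BCirc.wire (Sum.elim
      (Sum.elim
        (Sum.elim (fun i => stmt (Sum.inl (Sum.inl i))) (fun i => wit (Sum.inl i)))
        (fun i => stmt (Sum.inl (Sum.inr i))))
      (Sum.elim
        (Sum.elim (fun i => wit (Sum.inl i))
          (Sum.elim (fun i => wit (Sum.inr i)) (fun i => stmt (Sum.inr (Sum.inl i)))))
        (fun i => stmt (Sum.inr (Sum.inr i)))))).comp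
    (hashPart.par comPart)).comp (BCirc.gate fun a b => a && b)

/-- The argument of knowledge for the relation. -/
abbrev verifier : Machine (Fin (stmtLen G κ p)) Unit :=
  G.AoK κ (stmtLen G κ p) (witLen κ p) (relation G κ p)

/-- The message register: that of the SFVP subprotocol, `(h, c)`, and that of the argument of
knowledge. -/
abbrev MsgReg : Type :=
  (G.SFVP κ p).Msg ⊕ ((Fin (G.Hash.desc p.m κ) ⊕ Fin κ) ⊕ (verifier G κ p).Msg)

/-- The server's private register: the work register of the SFVP subprotocol, the outcome `y`,
the coins for the hash function, `(h, c)`, the verifier's copy of the statement with its flag and its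
work register, and bits recording whether all rounds so far have passed. -/
abbrev WorkReg : Type :=
  ((G.SFVP κ p).Work ⊕ Fin p.m) ⊕
    ((Fin (G.Hash.coins p.m κ) ⊕ (Fin (G.Hash.desc p.m κ) ⊕ Fin κ)) ⊕
      ((Fin (stmtLen G κ p) ⊕ (Unit ⊕ (verifier G κ p).Work)) ⊕ Fin (rounds G p + 1)))

abbrev AllReg : Type := MsgReg G κ p ⊕ (PubReg G.Com κ p ⊕ (ServerOut p ⊕ WorkReg G κ p))

/- Names for the qubits. -/

def qMsgHash (i : Fin (G.Hash.desc p.m κ) ⊕ Fin κ) : AllReg G κ p := .inl (.inr (.inl i))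
def qPub (i : PubReg G.Com κ p) : AllReg G κ p := .inr (.inl i)
def qFlag : AllReg G κ p := .inr (.inr (.inl (.inl ())))
def qOut (i : Fin p.m) : AllReg G κ p := .inr (.inr (.inl (.inr i)))
def qY (i : Fin p.m) : AllReg G κ p := .inr (.inr (.inr (.inl (.inr i))))
def qCoin (i : Fin (G.Hash.coins p.m κ)) : AllReg G κ p :=
  .inr (.inr (.inr (.inr (.inl (.inl i)))))
def qHash (i : Fin (G.Hash.desc p.m κ) ⊕ Fin κ) : AllReg G κ p :=
  .inr (.inr (.inr (.inr (.inl (.inr i)))))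
def qStmt (i : Fin (stmtLen G κ p)) : AllReg G κ p :=
  .inr (.inr (.inr (.inr (.inr (.inl (.inl i))))))
def qVer (i : Unit ⊕ (verifier G κ p).Work) : AllReg G κ p :=
  .inr (.inr (.inr (.inr (.inr (.inl (.inr i))))))
def qAcc (i : Fin (rounds G p + 1)) : AllReg G κ p :=
  .inr (.inr (.inr (.inr (.inr (.inr i)))))

/-- The qubits on which the SFVP subprotocol acts. -/
def sfvpPart :
    ((G.SFVP κ p).Msg ⊕ (Empty ⊕ (Fin p.m ⊕ (G.SFVP κ p).Work))) ↪ AllReg G κ p where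
  toFun := Sum.elim (fun i => .inl (.inl i))
    (Sum.elim Empty.elim (Sum.elim (qY G κ p) fun i => .inr (.inr (.inr (.inl (.inl i))))))
  inj' := by
    rintro (i | i | i | i) (j | j | j | j) h <;>
      first | exact Empty.elim ‹Empty› | simp_all [qY]

/-- The qubits on which the verifier of the argument of knowledge acts. -/
def verifierPart :
    ((verifier G κ p).Msg ⊕ (Fin (stmtLen G κ p) ⊕ (Unit ⊕ (verifier G κ p).Work))) ↪
      AllReg G κ p where
  toFun := Sum.elim (fun i => .inl (.inr (.inr i))) (Sum.elim (qStmt G κ p) (qVer G κ p))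
  inj' := by
    rintro (i | i | i) (j | j | j) h <;> simp_all [qStmt, qVer]

/-- Measure, or reset, a whole register. -/
def measureAll {ι W : Type} [Fintype ι] (q : ι → W) : Circuit W :=
  (Finset.univ : Finset ι).toList.map fun i => Gate.measure (q i)

def resetAll {ι W : Type} [Fintype ι] (q : ι → W) : Circuit W :=
  (Finset.univ : Finset ι).toList.map fun i => Gate.reset (q i)

/-- Prepare uniform classical coins in a register that holds zeros. -/
def flipAll {ι W : Type} [Fintype ι] (q : ι → W) : Circuit W :=
  (Finset.univ : Finset ι).toList.flatMap fun i => [Gate.had (q i), Gate.measure (q i)]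

/-- The second step: fix the outcome `y`, sample `h`, compute `c = h(y)`, send `(h, c)`. The first
of the bits that record success is set to `true`. -/
def hashStep : Circuit (AllReg G κ p) :=
  measureAll (qY G κ p) ++ flipAll (qCoin G κ p) ++
  [Gate.classical (G.Hash.gen p.m κ)
      ⟨Sum.elim (qCoin G κ p) (fun i => qHash G κ p (.inl i)), by
        rintro (i | i) (j | j) h <;> simp_all [qCoin, qHash]⟩,
    Gate.classical (G.Hash.ev p.m κ)
      ⟨Sum.elim (Sum.elim (fun i => qHash G κ p (.inl i)) (qY G κ p))
          (fun i => qHash G κ p (.inr i)), by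
        rintro ((i | i) | i) ((j | j) | j) h <;> simp_all [qY, qHash]⟩] ++
  resetAll (qMsgHash G κ p) ++
  [Gate.classical (BCirc.wire id)
      ⟨Sum.elim (qHash G κ p) (qMsgHash G κ p), by
        rintro (i | i) (j | j) h <;> simp_all [qHash, qMsgHash]⟩,
    Gate.classical (BCirc.const (α := Empty) true)
      ⟨Sum.elim Empty.elim (fun _ => qAcc G κ p 0), by
        rintro (i | i) (j | j) h <;> first | exact i.elim | exact j.elim | rfl⟩]

/-- Before each argument of knowledge: a fresh verifier with a copy of the statement. -/
def setupStep : Circuit (AllReg G κ p) :=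
  resetAll (qStmt G κ p) ++ resetAll (qVer G κ p) ++
  [Gate.classical (BCirc.wire (stmtEquiv G κ p).symm)
      ⟨Sum.elim (Sum.elim (qHash G κ p) (qPub G κ p)) (qStmt G κ p), by
        rintro ((i | i) | i) ((j | j) | j) h <;> simp_all [qStmt, qHash, qPub]⟩]

/-- After the `i`-th argument of knowledge: record whether all rounds so far have passed. -/
def recordStep (i : Fin (rounds G p)) : Circuit (AllReg G κ p) :=
  [Gate.measure (qVer G κ p (.inl ())),
    Gate.classical (BCirc.gate fun a b => a && b)
      ⟨Sum.elim (Sum.elim (fun _ => qAcc G κ p i.castSucc) (fun _ => qVer G κ p (.inl ())))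
          (fun _ => qAcc G κ p i.succ), by
        rintro ((j | j) | j) ((k | k) | k) h <;>
          simp_all [qAcc, qVer, Fin.ext_iff]⟩]

/-- In the end: set the flag, and output `y` if all rounds have passed. -/
def outputStep : Circuit (AllReg G κ p) :=
  Gate.classical (BCirc.wire id)
    ⟨Sum.elim (fun _ : Unit => qAcc G κ p (Fin.last _)) (fun _ : Unit => qFlag G κ p), by
      rintro (i | i) (j | j) h <;> simp_all [qAcc, qFlag]⟩ ::
  (List.finRange p.m).map fun i =>
    Gate.classical (BCirc.gate fun a b => a && b)
      ⟨Sum.elim (Sum.elim (fun _ => qAcc G κ p (Fin.last _)) (fun _ => qY G κ p i))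
          (fun _ => qOut G κ p i), by
        rintro ((j | j) | j) ((k | k) | k) h <;> simp_all [qAcc, qY, qOut]⟩

end Ingredients

/-- The server of the protocol: the SFVP subprotocol with outcome `y`, then the hash value of `y`,
then the rounds of arguments of knowledge, then the output. -/
def SFVP2 (G : Ingredients) : ServerProtocol G.Com := fun κ p =>
  { Msg := G.MsgReg κ p
    Work := G.WorkReg κ p
    steps :=
      (G.SFVP κ p).steps.map (Circuit.on (G.sfvpPart κ p)) ++
      [G.hashStep κ p] ++
      (List.finRange (G.rounds p)).flatMap (fun i =>
        [G.setupStep κ p] ++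
        (G.verifier κ p).steps.map (Circuit.on (G.verifierPart κ p)) ++
        [G.recordStep κ p i]) ++
      [G.outputStep κ p] }

theorem Ingredients.relation_iff (G : Ingredients) (κ : ℕ) (p : Params)
    (h : Fin (G.Hash.desc p.m κ) → Bool) (c : Fin κ → Bool) (pp : Fin (3 * p.n * κ) → Bool)
    (com : Fin (G.Com.len p.n κ) → Bool) (x : Fin p.n → Bool) (r : Fin (p.n * κ) → Bool) :
    (G.relation κ p).eval
        (Sum.elim
          (fun i => Sum.elim (Sum.elim h c) (Sum.elim pp com) ((G.stmtEquiv κ p).symm i))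
          (fun i => Sum.elim x r ((Ingredients.witEquiv κ p).symm i))) () = true ↔
      (G.Hash.ev p.m κ).eval (Sum.elim h (p.f.eval x)) = c ∧
        G.Com.commit p.n κ x r pp = com := by
  simp only [relation, BCirc.eval, Sum.elim_inl, Sum.elim_inr, Bool.and_eq_true,
    BCirc.eqTest_eval, Equiv.symm_apply_apply, id, CommitFamily.commit]
  have e₁ : ∀ F G' : Fin (G.Hash.desc p.m κ) ⊕ Fin p.m → Bool, F = G' →
      ((G.Hash.ev p.m κ).eval F = c ↔ (G.Hash.ev p.m κ).eval G' = c) := by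
    rintro F _ rfl; rfl
  have e₂ : ∀ F G' : Fin p.n ⊕ (Fin (p.n * κ) ⊕ Fin (3 * p.n * κ)) → Bool, F = G' →
      ((G.Com.circ p.n κ).eval F = com ↔ (G.Com.circ p.n κ).eval G' = com) := by
    rintro F _ rfl; rfl
  refine and_congr (e₁ _ _ ?_) (e₂ _ _ ?_)
  · rfl
  · funext i; rcases i with i | i | i <;> simp

end

open Filter
open scoped Classical

/-!
The simulator copies the public inputs, runs the protocol between the malicious client and an
honest server of its own, and tells the ideal functionality whether that server accepts. The real
and the ideal result are then two classical functions (`label`) of one and the same state, the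
final state of all qubits in an execution: in the real world the output is `y` if all rounds have
passed (`realState_eq_label`), in the ideal world it is `f(x)` in that case
(`idealState_simulator`). So no distinguisher has a larger advantage than the probability that all
rounds pass although `y ≠ f(x)` (`abs_outputProb_sub_le`).

That event has two causes (`prob_passed_and_ne_le`), which depend on whether the stored hash value
is also that of `f(x)`.

* If it is, then `y` and `f(x)` collide. Here `y` is fixed before the hash function is sampled,
  and `f(x)` does not depend on it either, so it suffices that a collapsing hash function has no
  fixed collisions (`Collapsing.exists_collisionProb_le`). Indeed, on the superposition of two
  strings with the same hash value, measuring the hash value does nothing, while measuring the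
  string can be noticed.
* If it is not, then the statement of the arguments of knowledge has no witness, unless the
  commitment can be opened to another input (`relation_ne_true`), which happens for a negligible
  fraction of the public parameters. Since extraction cannot succeed, soundness with
  `δ = 1 / (2 * c)`, for `c` the constant of the argument of knowledge, shows that a prover
  passes a round with probability less than `1 - 1 / (2 * c)` from some `κ` on
  (`LinearlyKnowledgeSound.eventually_acceptProb_lt`). The bound holds for every initial state, in
  particular for the state conditioned on having passed the earlier rounds, so the probabilities
  multiply (`prob_round_le`, `prob_rounds_le`), and the number of rounds makes the product at most
  `ε` (`exp_pow_rounds_le`).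

All bounds hold uniformly in the initial state and in the coins, so that the initial state may
depend on these. The environment need not be of polynomial size: a circuit that does not act on it
acts on each of its blocks separately (`slice_run_on`), so it can be traced out before a round is
regarded as an attack on the argument of knowledge (`reduce_run_on`). What the server's registers
contain at each stage is tracked by the set of basis states on which a state lives (`Supported`),
together with the set of qubits that a circuit may change (`Circuit.writes`, `Unaffected`).
-/

/-! ### Gates and circuits as operations on states -/

/-- Conjugation by the matrix `K` with `K a y = ∑ s, k a s` over those `s` with `σ a s = y`. This is
the form in which the gates, which have few non-zero entries in each row, are given. -/
theorem Matrix.PosSemidef.kraus {X Y S : Type*} [Fintype X] [Fintype Y] [Fintype S]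
    {ρ : Matrix Y Y ℂ} (hρ : ρ.PosSemidef) (σ : X → S → Y) (k : X → S → ℂ) :
    (Matrix.of fun a b : X => ∑ s, ∑ t, k a s * star (k b t) * ρ (σ a s) (σ b t)).PosSemidef := by
  convert hρ.mul_mul_conjTranspose_same
    (Matrix.of fun a y => ∑ s, if σ a s = y then k a s else 0) using 1
  ext a b
  simp only [Matrix.mul_apply, Matrix.of_apply, Matrix.conjTranspose_apply, Finset.sum_mul,
    star_sum, Finset.mul_sum, apply_ite star, star_zero, ite_mul, zero_mul, mul_ite, mul_zero]
  have : ∀ s t, k a s * star (k b t) * ρ (σ a s) (σ b t) =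
      ∑ y', if σ b t = y' then ∑ y, if σ a s = y then k a s * ρ y y' * star (k b t) else 0 else 0 := by
    intro s t
    simp only [Finset.sum_ite_eq, Finset.mem_univ, if_true]
    ring
  simp only [this]
  rw [Finset.sum_comm]
  conv_rhs => rw [Finset.sum_comm]
  refine Finset.sum_congr rfl fun t _ => ?_
  rw [Finset.sum_comm]
  refine Finset.sum_congr rfl fun y' _ => ?_
  split_ifs with h
  · rw [Finset.sum_comm]
  · simp

theorem Matrix.PosSemidef.kraus_one {X Y : Type*} [Fintype X] [Fintype Y]
    {ρ : Matrix Y Y ℂ} (hρ : ρ.PosSemidef) (σ : X → Y) (k : X → ℂ) :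
    (Matrix.of fun a b : X => k a * star (k b) * ρ (σ a) (σ b)).PosSemidef := by
  simpa using hρ.kraus (S := Unit) (fun a _ => σ a) (fun a _ => k a)

/-- Summing over all basis states is averaging over the two values of one qubit. -/
theorem sum_eq_half_sum_update {W M : Type*} [Fintype W] [AddCommMonoid M] [Module ℂ M]
    (w : W) (φ : (W → Bool) → M) :
    ∑ a, φ a = (1 / 2 : ℂ) • ∑ a, ∑ s, φ (Function.update a w s) := by
  have h : ∀ s, ∑ a : W → Bool, φ (Function.update a w s) =
      (2 : ℂ) • ∑ a : W → Bool, if a w = s then φ a else 0 := by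
    intro s
    have hinv : Function.Involutive fun a : W → Bool => Function.update a w (!a w) := by
      intro a; simp
    have e : ∑ a : W → Bool, (if a w = s then 0 else φ (Function.update a w s)) =
        ∑ a : W → Bool, if a w = s then φ a else 0 := by
      rw [← Equiv.sum_comp hinv.toPerm]
      refine Finset.sum_congr rfl fun a _ => ?_
      simp only [Function.Involutive.coe_toPerm, Function.update_self, Function.update_idem]
      by_cases hs : a w = s
      · subst hs; simp
      · have : (!a w) = s := by revert hs; cases a w <;> cases s <;> simp
        simp [hs, this]
    have e' : ∑ a : W → Bool, (if a w = s then φ (Function.update a w s) else 0) =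
        ∑ a : W → Bool, if a w = s then φ a else 0 := by
      refine Finset.sum_congr rfl fun a _ => ?_
      split_ifs with hs
      · subst hs; simp
      · rfl
    rw [two_smul]
    nth_rewrite 1 [← e]
    rw [← e', ← Finset.sum_add_distrib]
    refine Finset.sum_congr rfl fun a _ => ?_
    split_ifs <;> simp
  rw [Finset.sum_comm]
  simp only [h, ← Finset.smul_sum, smul_smul]
  norm_num
  rw [← Finset.sum_add_distrib]
  refine Finset.sum_congr rfl fun a _ => ?_
  cases a w <;> simp

theorem sum_hadEntry (s t : Bool) :
    ∑ u, hadEntry u s * hadEntry u t = if s = t then 1 else 0 := by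
  have h : (Real.sqrt 2 : ℂ) * (Real.sqrt 2 : ℂ) = 2 := by
    rw [← Complex.ofReal_mul]; norm_num
  cases s <;> cases t <;> simp [hadEntry] <;> ring_nf <;>
    simp [pow_two, ← mul_inv, h]

theorem star_hadEntry (s t : Bool) : star (hadEntry s t) = hadEntry s t := by
  cases s <;> cases t <;> simp [hadEntry]

theorem hadEntry_false_mul_self (s : Bool) : hadEntry s false * hadEntry s false = 1 / 2 := by
  have h : (Real.sqrt 2 : ℂ) * (Real.sqrt 2 : ℂ) = 2 := by
    rw [← Complex.ofReal_mul]; norm_num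
  cases s <;> simp [hadEntry, ← mul_inv, h]

theorem tEntry_mul_star (s : Bool) : tEntry s * star (tEntry s) = 1 := by
  cases s
  · simp [tEntry]
  · have h : star (Real.pi / 4 * Complex.I : ℂ) = -(Real.pi / 4 * Complex.I) := by
      simp
    simp only [tEntry, if_true, Complex.star_def, ← Complex.exp_conj, ← Complex.exp_add] at h ⊢
    rw [h]
    simp

theorem xorEval_inl {W α β : Type} (B : BCirc α β) (e : α ⊕ β ↪ W) (x : W → Bool) (i : α) :
    xorEval B e x (e (Sum.inl i)) = x (e (Sum.inl i)) := by
  unfold xorEval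
  rw [Function.extend_apply']
  · simp
  · rintro ⟨b, hb⟩
    simpa using e.injective hb

theorem xorEval_inr {W α β : Type} (B : BCirc α β) (e : α ⊕ β ↪ W) (x : W → Bool) (i : β) :
    xorEval B e x (e (Sum.inr i)) =
      xor (x (e (Sum.inr i))) (B.eval (fun i => x (e (Sum.inl i))) i) := by
  unfold xorEval
  rw [Function.Injective.extend_apply (f := fun b => e (Sum.inr b))
    (e.injective.comp Sum.inr_injective)]

theorem xorEval_of_notMem {W α β : Type} (B : BCirc α β) (e : α ⊕ β ↪ W) (x : W → Bool) (w : W)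
    (hw : ∀ i, e (Sum.inr i) ≠ w) : xorEval B e x w = x w := by
  unfold xorEval
  rw [Function.extend_apply']
  · simp
  · rintro ⟨b, hb⟩
    exact hw b hb

theorem xorEval_involutive {W α β : Type} (B : BCirc α β) (e : α ⊕ β ↪ W) :
    Function.Involutive (xorEval B e) := by
  intro x
  funext w
  by_cases h : ∃ i, e (Sum.inr i) = w
  · obtain ⟨i, rfl⟩ := h
    simp only [xorEval_inr, xorEval_inl, Bool.xor_assoc, Bool.xor_self, Bool.xor_false]
  · push Not at h
    rw [xorEval_of_notMem _ _ _ _ h, xorEval_of_notMem _ _ _ _ h]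

namespace Gate

variable {W : Type}

theorem apply_add (g : Gate W) (ρ σ : DM W) : g.apply (ρ + σ) = g.apply ρ + g.apply σ := by
  cases g <;> ext a b <;>
    simp only [Gate.apply, dephase, Matrix.of_apply, Matrix.add_apply, mul_add,
      Finset.sum_add_distrib]
  all_goals split_ifs <;> simp

theorem apply_smul (g : Gate W) (c : ℂ) (ρ : DM W) : g.apply (c • ρ) = c • g.apply ρ := by
  cases g <;> ext a b <;>
    simp only [Gate.apply, dephase, Matrix.of_apply, Matrix.smul_apply, smul_eq_mul,
      Finset.mul_sum, mul_ite, mul_zero, mul_left_comm c]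

theorem apply_posSemidef [Fintype W] (g : Gate W) {ρ : DM W} (hρ : ρ.PosSemidef) :
    (g.apply ρ).PosSemidef := by
  cases g with
  | had w =>
    have := hρ.kraus (fun (a : W → Bool) (s : Bool) => Function.update a w s)
      (fun a s => hadEntry (a w) s)
    simp only [star_hadEntry] at this
    exact this
  | phaseT w => exact hρ.kraus_one (fun a => a) (fun a => tEntry (a w))
  | classical B e => exact hρ.submatrix (xorEval B e)
  | measure w =>
    have h : ∀ s : Bool, _ := fun s =>
      hρ.kraus_one (fun a : W → Bool => a) (fun a => if a w = s then 1 else 0)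
    convert (h true).add (h false) using 1
    ext a b
    simp only [Gate.apply, dephase, Matrix.of_apply, Matrix.add_apply]
    by_cases ha : a w = true <;> by_cases hb : b w = true <;> simp_all
  | reset w =>
    have h : ∀ s : Bool, _ := fun s =>
      hρ.kraus_one (fun a : W → Bool => Function.update a w s) (fun a => if a w = false then 1 else 0)
    convert (h true).add (h false) using 1
    ext a b
    simp only [Gate.apply, Matrix.of_apply, Matrix.add_apply]
    by_cases ha : a w = false <;> by_cases hb : b w = false <;> simp [ha, hb]

theorem trace_apply [Fintype W] (g : Gate W) (ρ : DM W) : (g.apply ρ).trace = ρ.trace := by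
  cases g with
  | had w =>
    simp only [Matrix.trace, Matrix.diag, Gate.apply, Matrix.of_apply]
    rw [sum_eq_half_sum_update w, sum_eq_half_sum_update w (fun a => ρ a a)]
    congr 1
    refine Finset.sum_congr rfl fun a _ => ?_
    simp only [Function.update_self, Function.update_idem]
    rw [Finset.sum_comm]
    refine Finset.sum_congr rfl fun s _ => ?_
    rw [Finset.sum_comm]
    simp only [← Finset.sum_mul, sum_hadEntry]
    simp
  | phaseT w =>
    simp only [Matrix.trace, Matrix.diag, Gate.apply, Matrix.of_apply, tEntry_mul_star, one_mul]
  | classical B e =>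
    simp only [Matrix.trace, Matrix.diag, Gate.apply, Matrix.of_apply]
    exact Equiv.sum_comp (xorEval_involutive B e).toPerm (fun a => ρ a a)
  | measure w => simp [Matrix.trace, Gate.apply, dephase]
  | reset w =>
    simp only [Matrix.trace, Matrix.diag, Gate.apply, Matrix.of_apply]
    rw [sum_eq_half_sum_update w, sum_eq_half_sum_update w (fun a => ρ a a)]
    simp

/-- The qubits whose basis value a gate can change. -/
def writes : Gate W → Set W
  | had w => {w}
  | phaseT _ => ∅
  | classical _ e => Set.range fun i => e (Sum.inr i)
  | measure _ => ∅
  | reset w => {w}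

theorem writes_map {V : Type} (f : V ↪ W) (g : Gate V) : (g.map f).writes = f '' g.writes := by
  cases g <;> simp [writes, Gate.map, ← Set.range_comp, Function.comp_def]

theorem cost_map {V : Type} (f : V ↪ W) (g : Gate V) : (g.map f).cost = g.cost := by
  cases g <;> rfl

theorem map_map {U V : Type} (f : U ↪ V) (h : V ↪ W) (g : Gate U) :
    (g.map f).map h = g.map (f.trans h) := by
  cases g <;> rfl

end Gate

/-- The property `P` of basis states does not depend on the qubits in `s`. -/
def Unaffected {W : Type} (P : (W → Bool) → Prop) (s : Set W) : Prop :=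
  ∀ a b : W → Bool, (∀ w, w ∉ s → a w = b w) → (P a ↔ P b)

/-- The operator projected, on both sides, to the basis states with the property `P`. -/
noncomputable def restrict {W : Type} (P : (W → Bool) → Prop) (ρ : DM W) : DM W :=
  Matrix.of fun a b => if P a ∧ P b then ρ a b else 0

/-- All non-zero entries belong to basis states with the property `P`. -/
def Supported {W : Type} (P : (W → Bool) → Prop) (ρ : DM W) : Prop :=
  ∀ a b, ρ a b ≠ 0 → P a ∧ P b

section basic
variable {W : Type}

theorem Unaffected.mono {P : (W → Bool) → Prop} {s t : Set W} (h : Unaffected P t) (hst : s ⊆ t) :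
    Unaffected P s := fun a b hab => h a b fun w hw => hab w fun hs => hw (hst hs)

theorem unaffected_of_values {γ : Type*} (q : γ → W) (Q : (γ → Bool) → Prop) {s : Set W}
    (h : ∀ i, q i ∉ s) : Unaffected (fun a => Q fun i => a (q i)) s := by
  intro a b hab
  have : (fun i => a (q i)) = fun i => b (q i) := funext fun i => hab _ (h i)
  simp only [this]

theorem Unaffected.and {P Q : (W → Bool) → Prop} {s : Set W} (hP : Unaffected P s)
    (hQ : Unaffected Q s) : Unaffected (fun a => P a ∧ Q a) s :=
  fun a b hab => and_congr (hP a b hab) (hQ a b hab)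

theorem Supported.restrict_eq {P : (W → Bool) → Prop} {ρ : DM W} (h : Supported P ρ) :
    restrict P ρ = ρ := by
  ext a b
  simp only [restrict, Matrix.of_apply]
  split_ifs with hab
  · rfl
  · by_contra hne
    exact hab (h a b fun h0 => hne h0.symm)

theorem supported_restrict (P : (W → Bool) → Prop) (ρ : DM W) : Supported P (restrict P ρ) := by
  intro a b h
  by_contra hab
  exact h (by simp [restrict, hab])

theorem Supported.mono {P Q : (W → Bool) → Prop} {ρ : DM W} (h : Supported P ρ)
    (hPQ : ∀ a, P a → Q a) : Supported Q ρ :=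
  fun a b hab => ⟨hPQ _ (h a b hab).1, hPQ _ (h a b hab).2⟩

theorem Supported.and {P Q : (W → Bool) → Prop} {ρ : DM W} (h : Supported P ρ)
    (h' : Supported Q ρ) : Supported (fun a => P a ∧ Q a) ρ :=
  fun a b hab => ⟨⟨(h a b hab).1, (h' a b hab).1⟩, (h a b hab).2, (h' a b hab).2⟩

theorem Supported.restrict {P : (W → Bool) → Prop} {ρ : DM W} (h : Supported P ρ)
    (Q : (W → Bool) → Prop) : Supported P (restrict Q ρ) := by
  intro a b hab
  refine h a b fun h0 => hab ?_
  simp [_root_.restrict, h0]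

theorem restrict_posSemidef [Fintype W] (P : (W → Bool) → Prop) {ρ : DM W} (hρ : ρ.PosSemidef) :
    (restrict P ρ).PosSemidef := by
  convert hρ.kraus_one (fun a => a) (fun a => if P a then 1 else 0) using 1
  ext a b
  by_cases ha : P a <;> by_cases hb : P b <;> simp [restrict, ha, hb]

theorem prob_eq_trace_restrict [Fintype W] (P : (W → Bool) → Prop) (ρ : DM W) :
    prob P ρ = (restrict P ρ).trace.re := by
  simp only [prob, Matrix.trace, Matrix.diag, restrict, Matrix.of_apply, Complex.re_sum, and_self]
  exact Finset.sum_congr rfl fun a _ => by split_ifs <;> simp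

theorem diag_re_nonneg [Fintype W] {ρ : DM W} (hρ : ρ.PosSemidef) (a : W → Bool) :
    0 ≤ (ρ a a).re := (Complex.le_def.1 (hρ.diag_nonneg (i := a))).1

theorem prob_nonneg [Fintype W] (P : (W → Bool) → Prop) {ρ : DM W} (hρ : ρ.PosSemidef) :
    0 ≤ prob P ρ :=
  Finset.sum_nonneg fun a _ => by split_ifs; exacts [diag_re_nonneg hρ a, le_rfl]

theorem prob_mono_of_supported [Fintype W] {P Q R : (W → Bool) → Prop} {ρ : DM W}
    (hρ : ρ.PosSemidef) (hR : Supported R ρ) (h : ∀ a, R a → P a → Q a) : prob P ρ ≤ prob Q ρ := by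
  refine Finset.sum_le_sum fun a _ => ?_
  by_cases h0 : ρ a a = 0
  · simp [h0]
  · have hRa := (hR a a h0).1
    split_ifs with hP hQ hQ
    · exact le_rfl
    · exact absurd (h a hRa hP) hQ
    · exact diag_re_nonneg hρ a
    · exact le_rfl

theorem supported_true (ρ : DM W) : Supported (fun _ => True) ρ := fun _ _ _ => ⟨trivial, trivial⟩

theorem prob_mono [Fintype W] {P Q : (W → Bool) → Prop} {ρ : DM W} (hρ : ρ.PosSemidef)
    (h : ∀ a, P a → Q a) : prob P ρ ≤ prob Q ρ :=
  prob_mono_of_supported hρ (supported_true ρ) fun a _ => h a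

theorem prob_true [Fintype W] (ρ : DM W) : prob (fun _ => True) ρ = ρ.trace.re := by
  simp [prob, Matrix.trace]

theorem prob_le_trace [Fintype W] (P : (W → Bool) → Prop) {ρ : DM W} (hρ : ρ.PosSemidef) :
    prob P ρ ≤ ρ.trace.re := by
  rw [← prob_true]
  exact prob_mono hρ fun _ _ => trivial

theorem prob_or_le [Fintype W] (P Q : (W → Bool) → Prop) {ρ : DM W} (hρ : ρ.PosSemidef) :
    prob (fun a => P a ∨ Q a) ρ ≤ prob P ρ + prob Q ρ := by
  unfold prob
  rw [← Finset.sum_add_distrib]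
  refine Finset.sum_le_sum fun a _ => ?_
  have := diag_re_nonneg hρ a
  by_cases hP : P a <;> by_cases hQ : Q a <;> simp [hP, hQ, this]

theorem prob_restrict [Fintype W] (P Q : (W → Bool) → Prop) (ρ : DM W) :
    prob P (restrict Q ρ) = prob (fun a => P a ∧ Q a) ρ := by
  refine Finset.sum_congr rfl fun a _ => ?_
  by_cases hP : P a <;> by_cases hQ : Q a <;> simp [restrict, hP, hQ]

theorem prob_add [Fintype W] (P : (W → Bool) → Prop) (ρ σ : DM W) :
    prob P (ρ + σ) = prob P ρ + prob P σ := by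
  unfold prob
  rw [← Finset.sum_add_distrib]
  exact Finset.sum_congr rfl fun a _ => by split_ifs <;> simp

theorem prob_smul [Fintype W] (P : (W → Bool) → Prop) (c : ℝ) (ρ : DM W) :
    prob P ((c : ℂ) • ρ) = c * prob P ρ := by
  unfold prob
  rw [Finset.mul_sum]
  exact Finset.sum_congr rfl fun a _ => by split_ifs <;> simp

theorem prob_partition [Fintype W] {γ : Type*} [Fintype γ] (g : (W → Bool) → γ)
    (P : (W → Bool) → Prop) (ρ : DM W) :
    prob P ρ = ∑ v, prob (fun a => P a ∧ g a = v) ρ := by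
  unfold prob
  rw [Finset.sum_comm]
  refine Finset.sum_congr rfl fun a _ => ?_
  by_cases hP : P a <;> simp [hP]

/-- A gate commutes with the projection to a property of the basis state that the gate cannot
change. -/
theorem Gate.apply_restrict (g : Gate W) (P : (W → Bool) → Prop) (hP : Unaffected P g.writes)
    (ρ : DM W) : g.apply (restrict P ρ) = restrict P (g.apply ρ) := by
  have hup : ∀ w s (a : W → Bool), g.writes = {w} → (P (Function.update a w s) ↔ P a) := by
    intro w s a hg
    refine hP _ _ fun v hv => ?_
    rw [hg] at hv
    exact Function.update_of_ne hv _ _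
  cases g with
  | had w =>
    ext a b
    simp only [Gate.apply, restrict, Matrix.of_apply, hup w _ _ rfl]
    split_ifs <;> simp
  | phaseT w => ext a b; simp only [Gate.apply, restrict, Matrix.of_apply]; split_ifs <;> simp
  | classical B e =>
    ext a b
    have : ∀ a, P (xorEval B e a) ↔ P a := fun a => hP _ _ fun w hw =>
      xorEval_of_notMem _ _ _ _ fun i hi => hw ⟨i, hi⟩
    simp only [Gate.apply, restrict, Matrix.of_apply, this]
  | measure w =>
    ext a b
    simp only [Gate.apply, dephase, restrict, Matrix.of_apply]; split_ifs <;> simp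
  | reset w =>
    ext a b
    simp only [Gate.apply, restrict, Matrix.of_apply, hup w _ _ rfl]
    split_ifs <;> simp

theorem Gate.apply_supported_reset {P : (W → Bool) → Prop} {ρ : DM W} (w : W)
    (h : Supported P ρ) :
    Supported (fun a => a w = false ∧ ∃ s, P (Function.update a w s)) ((Gate.reset w).apply ρ) := by
  intro a b hab
  simp only [Gate.apply, Matrix.of_apply, ne_eq, ite_eq_right_iff, not_forall] at hab
  obtain ⟨⟨ha, hb⟩, hs⟩ := hab
  obtain ⟨s, -, hs⟩ := Finset.exists_ne_zero_of_sum_ne_zero hs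
  exact ⟨⟨ha, s, (h _ _ hs).1⟩, hb, s, (h _ _ hs).2⟩

theorem Gate.apply_supported_classical {P : (W → Bool) → Prop} {ρ : DM W} {α β : Type}
    (B : BCirc α β) (e : α ⊕ β ↪ W) (h : Supported P ρ) :
    Supported (fun a => P (xorEval B e a)) ((Gate.classical B e).apply ρ) :=
  fun _ _ hab => h _ _ hab

end basic

namespace Circuit

variable {V W : Type}

@[simp] theorem run_nil (ρ : DM W) : run [] ρ = ρ := rfl

@[simp] theorem run_cons (g : Gate W) (C : Circuit W) (ρ : DM W) :
    run (g :: C) ρ = run C (g.apply ρ) := rfl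

theorem run_append (C D : Circuit W) (ρ : DM W) : run (C ++ D) ρ = run D (run C ρ) := by
  simp [run]

theorem run_add (C : Circuit W) (ρ σ : DM W) : run C (ρ + σ) = run C ρ + run C σ := by
  induction C generalizing ρ σ with
  | nil => rfl
  | cons g C ih => simp [Gate.apply_add, ih]

theorem run_smul (C : Circuit W) (c : ℂ) (ρ : DM W) : run C (c • ρ) = c • run C ρ := by
  induction C generalizing ρ with
  | nil => rfl
  | cons g C ih => simp [Gate.apply_smul, ih]

theorem run_zero (C : Circuit W) : run C (0 : DM W) = 0 := by
  simpa using run_smul C 0 0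

theorem run_sum {ι : Type*} (C : Circuit W) (s : Finset ι) (ρ : ι → DM W) :
    run C (∑ i ∈ s, ρ i) = ∑ i ∈ s, run C (ρ i) := by
  induction s using Finset.induction_on with
  | empty => simp [run_zero]
  | insert i s hi ih => simp [Finset.sum_insert hi, run_add, ih]

theorem run_posSemidef [Fintype W] (C : Circuit W) {ρ : DM W} (hρ : ρ.PosSemidef) :
    (run C ρ).PosSemidef := by
  induction C generalizing ρ with
  | nil => exact hρ
  | cons g C ih => exact ih (g.apply_posSemidef hρ)

theorem trace_run [Fintype W] (C : Circuit W) (ρ : DM W) : (run C ρ).trace = ρ.trace := by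
  induction C generalizing ρ with
  | nil => rfl
  | cons g C ih => rw [run_cons, ih, Gate.trace_apply]

/-- The qubits whose basis value a circuit can change. -/
def writes (C : Circuit W) : Set W := {w | ∃ g ∈ C, w ∈ g.writes}

theorem writes_nil : writes ([] : Circuit W) = ∅ := by simp [writes]

theorem writes_cons (g : Gate W) (C : Circuit W) : writes (g :: C) = g.writes ∪ writes C := by
  ext w; simp [writes]

theorem writes_append (C D : Circuit W) : writes (C ++ D) = writes C ∪ writes D := by
  ext w; simp [writes, or_and_right, exists_or]

theorem writes_on (f : V ↪ W) (C : Circuit V) : writes (C.on f) = f '' writes C := by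
  ext w
  simp only [writes, on, List.mem_map, Set.mem_ofPred_eq, exists_exists_and_eq_and,
    Gate.writes_map, Set.mem_image]
  constructor
  · rintro ⟨g, hg, v, hv, rfl⟩; exact ⟨v, ⟨g, hg, hv⟩, rfl⟩
  · rintro ⟨v, ⟨g, hg, hv⟩, rfl⟩; exact ⟨g, hg, v, hv, rfl⟩

theorem writes_on_subset (f : V ↪ W) (C : Circuit V) : writes (C.on f) ⊆ Set.range f := by
  rw [writes_on]; exact Set.image_subset_range _ _

theorem size_append (C D : Circuit W) : size (C ++ D) = size C + size D := by simp [size]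

theorem size_on (f : V ↪ W) (C : Circuit V) : (C.on f).size = C.size := by
  simp [size, on, Function.comp_def, Gate.cost_map]

theorem on_append (f : V ↪ W) (C D : Circuit V) : (C ++ D : Circuit V).on f = C.on f ++ D.on f := by
  simp [on]

theorem on_on {U : Type} (f : U ↪ V) (h : V ↪ W) (C : Circuit U) :
    (C.on f).on h = C.on (f.trans h) := by
  simp [on, Gate.map_map]

/-- Conditioning on classical values that a circuit does not write can be done before or after it.
-/
theorem run_restrict (C : Circuit W) (P : (W → Bool) → Prop) (hP : Unaffected P C.writes)
    (ρ : DM W) : run C (restrict P ρ) = restrict P (run C ρ) := by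
  induction C generalizing ρ with
  | nil => rfl
  | cons g C ih =>
    rw [writes_cons] at hP
    rw [run_cons, g.apply_restrict P (hP.mono Set.subset_union_left),
      ih (hP.mono Set.subset_union_right), run_cons]

theorem prob_run [Fintype W] (C : Circuit W) (P : (W → Bool) → Prop) (hP : Unaffected P C.writes)
    (ρ : DM W) : prob P (run C ρ) = prob P ρ := by
  rw [prob_eq_trace_restrict, ← run_restrict C P hP, trace_run, prob_eq_trace_restrict]

theorem run_supported (C : Circuit W) {P : (W → Bool) → Prop} (hP : Unaffected P C.writes)
    {ρ : DM W} (h : Supported P ρ) : Supported P (run C ρ) := by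
  rw [← h.restrict_eq, run_restrict C P hP]
  exact supported_restrict _ _

end Circuit

/-! ### Circuits on a part of a larger system -/

/-- The block of `ρ` on the qubits in the range of `f` in which the other qubits have the basis
values of `a` (left) and `b` (right). -/
noncomputable def slice {V W : Type} (f : V ↪ W) (a b : W → Bool) (ρ : DM W) : DM V :=
  Matrix.of fun v v' => ρ (Function.extend f v a) (Function.extend f v' b)

section local_action
variable {V W : Type}

theorem sum_ite_eq_univ {X M : Type*} [Fintype X] [AddCommMonoid M] (x : X) (c : M) :
    (∑ y, if x = y then c else 0) = c := by
  simp

theorem ite_and_eq_mul (P Q : Prop) (c : ℂ) [Decidable P] [Decidable Q] [Decidable (P ∧ Q)] :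
    (if P ∧ Q then c else 0) = (if P then 1 else 0) * star (if Q then 1 else 0) * c := by
  by_cases hP : P <;> by_cases hQ : Q <;> simp [hP, hQ]

/-- Overwriting a basis state on the range of `f` by its own values there. -/
theorem extend_comp_self (f : V ↪ W) (a : W → Bool) :
    Function.extend f (fun v => a (f v)) a = a := by
  funext w
  by_cases h : ∃ v, f v = w
  · obtain ⟨v, rfl⟩ := h
    rw [f.injective.extend_apply]
  · rw [Function.extend_apply' _ _ _ h]

theorem extend_update (f : V ↪ W) (v : V → Bool) (a : W → Bool) (i : V) (s : Bool) :
    Function.update (Function.extend f v a) (f i) s =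
      Function.extend f (Function.update v i s) a := by
  funext w
  by_cases h : ∃ j, f j = w
  · obtain ⟨j, rfl⟩ := h
    rw [f.injective.extend_apply]
    by_cases hj : j = i
    · subst hj; simp
    · rw [Function.update_of_ne (f.injective.ne hj), f.injective.extend_apply,
        Function.update_of_ne hj]
  · rw [Function.extend_apply' _ _ _ h, Function.update_of_ne (fun h' => h ⟨i, h'.symm⟩),
      Function.extend_apply' _ _ _ h]

theorem xorEval_extend (f : V ↪ W) {α β : Type} (B : BCirc α β) (e : α ⊕ β ↪ V) (v : V → Bool)
    (a : W → Bool) :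
    xorEval B (e.trans f) (Function.extend f v a) = Function.extend f (xorEval B e v) a := by
  funext w
  by_cases h : ∃ j, f j = w
  · obtain ⟨j, rfl⟩ := h
    rw [f.injective.extend_apply]
    by_cases hj : ∃ i, e (Sum.inr i) = j
    · obtain ⟨i, rfl⟩ := hj
      have := xorEval_inr B (e.trans f) (Function.extend f v a) i
      simp only [Function.Embedding.trans_apply, f.injective.extend_apply] at this
      rw [this, xorEval_inr]
    · push Not at hj
      rw [xorEval_of_notMem _ _ _ _ hj, xorEval_of_notMem _ _ _ _ fun i hi => hj i (f.injective hi),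
        f.injective.extend_apply]
  · rw [Function.extend_apply' _ _ _ h, xorEval_of_notMem _ _ _ _ fun i hi => h ⟨_, hi⟩,
      Function.extend_apply' _ _ _ h]

theorem slice_ext (f : V ↪ W) {ρ σ : DM W} (h : ∀ a b, slice f a b ρ = slice f a b σ) : ρ = σ := by
  ext a b
  have := congr_fun (congr_fun (h a b) fun v => a (f v)) fun v => b (f v)
  simpa only [slice, Matrix.of_apply, extend_comp_self] using this

theorem slice_apply_map (f : V ↪ W) (a b : W → Bool) (g : Gate V) (ρ : DM W) :
    slice f a b ((g.map f).apply ρ) = g.apply (slice f a b ρ) := by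
  cases g <;> ext v v' <;>
    simp only [slice, Gate.map, Gate.apply, dephase, Matrix.of_apply, f.injective.extend_apply,
      extend_update, xorEval_extend]
  split_ifs <;> rfl

/-- Circuits act blockwise: the qubits that a circuit does not act on only label blocks. -/
theorem slice_run_on (f : V ↪ W) (a b : W → Bool) (C : Circuit V) (ρ : DM W) :
    slice f a b ((C.on f).run ρ) = C.run (slice f a b ρ) := by
  induction C generalizing ρ with
  | nil => rfl
  | cons g C ih =>
    have := ih ((g.map f).apply ρ)
    rw [slice_apply_map] at this
    exact this

theorem reduce_eq_sum_slice [Fintype W] (f : V ↪ W) (ρ : DM W) :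
    reduce f ρ = ∑ z : W → Bool, if ∀ v, z (f v) = false then slice f z z ρ else 0 := by
  ext a b
  rw [Matrix.sum_apply]
  have key : ∀ z : W → Bool, (if ∀ v, z (f v) = false then slice f z z ρ else 0) a b =
      ∑ a' : W → Bool, ∑ b' : W → Bool,
        if a' = Function.extend f a z ∧ b' = Function.extend f b z ∧ ∀ v, z (f v) = false
        then ρ a' b' else 0 := by
    intro z
    rw [Finset.sum_eq_single (Function.extend f a z), Finset.sum_eq_single (Function.extend f b z)]
    · by_cases h : ∀ v, z (f v) = false <;> simp [h, slice]
    · intro b' _ hb; simp [hb]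
    · simp
    · intro a' _ ha; simp [ha]
    · simp
  simp only [key, reduce, Matrix.of_apply]
  conv_rhs => rw [Finset.sum_comm]
  refine Finset.sum_congr rfl fun a' _ => ?_
  conv_rhs => rw [Finset.sum_comm]
  refine Finset.sum_congr rfl fun b' _ => ?_
  rw [Finset.sum_eq_single (Function.extend f (fun _ => false) a')]
  · refine if_congr ⟨?_, ?_⟩ rfl rfl
    · rintro ⟨rfl, rfl, h⟩
      refine ⟨?_, ?_, fun v => f.injective.extend_apply _ _ _⟩ <;> funext w <;>
        by_cases hw : ∃ v, f v = w
      · obtain ⟨v, rfl⟩ := hw; rw [f.injective.extend_apply]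
      · rw [Function.extend_apply' _ _ _ hw, Function.extend_apply' _ _ _ hw]
      · obtain ⟨v, rfl⟩ := hw; rw [f.injective.extend_apply]
      · rw [Function.extend_apply' _ _ _ hw, Function.extend_apply' _ _ _ hw, h w hw]
    · rintro ⟨ha, hb, -⟩
      refine ⟨?_, ?_, ?_⟩
      · funext v; rw [ha, f.injective.extend_apply]
      · funext v; rw [hb, f.injective.extend_apply]
      · intro w hw
        have hb' := congr_fun hb w
        rw [Function.extend_apply' _ _ _ hw, Function.extend_apply' _ _ _ hw] at hb'
        exact hb'.symm
  · intro z _ hz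
    refine if_neg ?_
    rintro ⟨rfl, -, h⟩
    refine hz ?_
    funext w
    by_cases hw : ∃ v, f v = w
    · obtain ⟨v, rfl⟩ := hw; rw [f.injective.extend_apply (fun _ => false)]; exact h v
    · rw [Function.extend_apply' _ _ _ hw, Function.extend_apply' _ _ _ hw]
  · simp

/-- A circuit on a part of the system can be applied after the rest has been traced out. -/
theorem reduce_run_on [Fintype W] (f : V ↪ W) (C : Circuit V) (ρ : DM W) :
    reduce f ((C.on f).run ρ) = C.run (reduce f ρ) := by
  simp only [reduce_eq_sum_slice, Circuit.run_sum, slice_run_on]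
  refine Finset.sum_congr rfl fun z _ => ?_
  split_ifs
  · rfl
  · exact (Circuit.run_zero C).symm

theorem reduce_posSemidef [Fintype W] (f : V ↪ W) {ρ : DM W} (hρ : ρ.PosSemidef) :
    (reduce f ρ).PosSemidef := by
  rw [reduce_eq_sum_slice]
  refine Matrix.posSemidef_sum _ fun z _ => ?_
  split_ifs
  · exact hρ.submatrix fun v => Function.extend f v z
  · exact Matrix.PosSemidef.zero

theorem reduce_diag [Fintype W] (f : V ↪ W) (ρ : DM W) (v : V → Bool) :
    reduce f ρ v v = ∑ a : W → Bool, if (fun i => a (f i)) = v then ρ a a else 0 := by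
  simp only [reduce, Matrix.of_apply]
  refine Finset.sum_congr rfl fun a _ => ?_
  rw [Finset.sum_eq_single a]
  · simp
  · intro b _ hb
    refine if_neg ?_
    rintro ⟨ha, hb', h⟩
    refine hb (funext fun w => ?_)
    by_cases hw : w ∈ Set.range f
    · obtain ⟨i, rfl⟩ := hw
      exact (congr_fun hb' i).trans (congr_fun ha i).symm
    · exact (h w hw).symm
  · simp

theorem trace_reduce [Fintype V] [Fintype W] (f : V ↪ W) (ρ : DM W) :
    (reduce f ρ).trace = ρ.trace := by
  simp only [Matrix.trace, Matrix.diag, reduce_diag]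
  rw [Finset.sum_comm]
  refine Finset.sum_congr rfl fun a _ => ?_
  exact sum_ite_eq_univ _ _

theorem prob_reduce [Fintype V] [Fintype W] (f : V ↪ W) (P : (V → Bool) → Prop) (ρ : DM W) :
    prob P (reduce f ρ) = prob (fun a => P fun v => a (f v)) ρ := by
  have h : ∀ v : V → Bool, (if P v then (reduce f ρ v v).re else 0) =
      ∑ a : W → Bool, if (fun i => a (f i)) = v then (if P v then (ρ a a).re else 0) else 0 := by
    intro v
    rw [reduce_diag]
    split_ifs
    · rw [Complex.re_sum]
      exact Finset.sum_congr rfl fun a _ => by split_ifs <;> simp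
    · simp
  have h' : prob P (reduce f ρ) = ∑ v : V → Bool, ∑ a : W → Bool,
      if (fun i => a (f i)) = v then (if P v then (ρ a a).re else 0) else 0 :=
    Finset.sum_congr (by congr!) fun v _ => h v
  rw [h', Finset.sum_comm]
  refine Finset.sum_congr rfl fun a _ => ?_
  simp

theorem slice_place (f : V ↪ W) (ρ : DM V) (z a b : W → Bool) :
    slice f a b (place f ρ z) =
      if ∀ w, w ∉ Set.range f → a w = z w ∧ b w = z w then ρ else 0 := by
  ext v v'
  have h : (∀ w, w ∉ Set.range f → Function.extend f v a w = z w ∧ Function.extend f v' b w = z w) ↔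
      ∀ w, w ∉ Set.range f → a w = z w ∧ b w = z w :=
    forall₂_congr fun w hw => by
      rw [Function.extend_apply' _ _ _ hw, Function.extend_apply' _ _ _ hw]
  simp only [slice, place, Matrix.of_apply, h, f.injective.extend_apply]
  split_ifs <;> rfl

theorem run_on_place (f : V ↪ W) (C : Circuit V) (ρ : DM V) (z : W → Bool) :
    (C.on f).run (place f ρ z) = place f (C.run ρ) z := by
  refine slice_ext f fun a b => ?_
  rw [slice_run_on, slice_place, slice_place]
  split_ifs
  · rfl
  · exact Circuit.run_zero C

theorem supported_place (f : V ↪ W) (ρ : DM V) (z : W → Bool) :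
    Supported (fun a => ∀ w, w ∉ Set.range f → a w = z w) (place f ρ z) := by
  intro a b hab
  by_cases h : ∀ w, w ∉ Set.range f → a w = z w ∧ b w = z w
  · exact ⟨fun w hw => (h w hw).1, fun w hw => (h w hw).2⟩
  · exact absurd (if_neg h) hab

theorem place_posSemidef [Fintype V] [Fintype W] (f : V ↪ W) {ρ : DM V} (hρ : ρ.PosSemidef)
    (z : W → Bool) : (place f ρ z).PosSemidef := by
  convert hρ.kraus_one (fun (a : W → Bool) v => a (f v))
    (fun a => if ∀ w, w ∉ Set.range f → a w = z w then 1 else 0) using 1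
  ext a b
  simp only [place, Matrix.of_apply, forall_and]
  exact ite_and_eq_mul _ _ _

theorem reduce_apply_of_supported [Fintype W] (f : V ↪ W) {σ : DM W} {z : W → Bool}
    (h : Supported (fun a => ∀ w, w ∉ Set.range f → a w = z w) σ) (v v' : V → Bool) :
    reduce f σ v v' = σ (Function.extend f v z) (Function.extend f v' z) := by
  simp only [reduce, Matrix.of_apply]
  rw [Finset.sum_eq_single (Function.extend f v z), Finset.sum_eq_single (Function.extend f v' z)]
  · refine if_pos ⟨?_, ?_, ?_⟩
    · funext i; rw [f.injective.extend_apply]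
    · funext i; rw [f.injective.extend_apply]
    · intro w hw; rw [Function.extend_apply' _ _ _ hw, Function.extend_apply' _ _ _ hw]
  · intro b _ hb
    split_ifs with hc
    · by_contra hne
      refine hb (funext fun w => ?_)
      by_cases hw : ∃ i, f i = w
      · obtain ⟨i, rfl⟩ := hw
        rw [f.injective.extend_apply]; exact congr_fun hc.2.1 i
      · rw [Function.extend_apply' _ _ _ hw]; exact (h _ _ hne).2 w hw
    · rfl
  · simp
  · intro a _ ha
    refine Finset.sum_eq_zero fun b _ => ?_
    split_ifs with hc
    · by_contra hne
      refine ha (funext fun w => ?_)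
      by_cases hw : ∃ i, f i = w
      · obtain ⟨i, rfl⟩ := hw
        rw [f.injective.extend_apply]; exact congr_fun hc.1 i
      · rw [Function.extend_apply' _ _ _ hw]; exact (h _ _ hne).1 w hw
    · rfl
  · simp

/-- If the other qubits are in a basis state, then tracing them out loses nothing. -/
theorem place_reduce [Fintype W] (f : V ↪ W) {σ : DM W} {z : W → Bool}
    (h : Supported (fun a => ∀ w, w ∉ Set.range f → a w = z w) σ) :
    place f (reduce f σ) z = σ := by
  ext a b
  simp only [place, Matrix.of_apply, reduce_apply_of_supported f h]
  have hext : ∀ a : W → Bool, (∀ w, w ∉ Set.range f → a w = z w) →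
      Function.extend f (fun v => a (f v)) z = a := by
    intro a ha
    funext w
    by_cases hw : ∃ i, f i = w
    · obtain ⟨i, rfl⟩ := hw
      rw [f.injective.extend_apply]
    · rw [Function.extend_apply' _ _ _ hw, ha w hw]
  split_ifs with hc
  · rw [hext a fun w hw => (hc w hw).1, hext b fun w hw => (hc w hw).2]
  · by_contra hne
    have := h a b fun h0 => hne h0.symm
    exact hc fun w hw => ⟨this.1 w hw, this.2 w hw⟩

theorem reduce_place [Fintype W] (f : V ↪ W) (ρ : DM V) (z : W → Bool) :
    reduce f (place f ρ z) = ρ := by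
  ext v v'
  rw [reduce_apply_of_supported f (supported_place f ρ z)]
  simp only [place, Matrix.of_apply, f.injective.extend_apply]
  refine if_pos fun w hw => ?_
  rw [Function.extend_apply' _ _ _ hw, Function.extend_apply' _ _ _ hw]
  exact ⟨rfl, rfl⟩

theorem IsDensity.place [Fintype V] [Fintype W] (f : V ↪ W) {ρ : DM V} (hρ : IsDensity ρ)
    (z : W → Bool) : IsDensity (place f ρ z) :=
  ⟨place_posSemidef f hρ.1 z, by rw [← trace_reduce f, reduce_place, hρ.2]⟩

theorem place_trans {U : Type} (f : U ↪ V) (g : V ↪ W) (ρ : DM U) (z : W → Bool) :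
    place (f.trans g) ρ z = place g (place f ρ fun v => z (g v)) z := by
  ext a b
  simp only [place, Matrix.of_apply, Function.Embedding.trans_apply]
  rw [← ite_and]
  refine if_congr ⟨fun h => ⟨fun w hw => h w ?_, fun v hv => h (g v) ?_⟩, fun h w hw => ?_⟩ rfl rfl
  · rintro ⟨u, rfl⟩; exact hw ⟨f u, rfl⟩
  · rintro ⟨u, hu⟩; exact hv ⟨u, g.injective hu⟩
  · by_cases hw' : w ∈ Set.range g
    · obtain ⟨v, rfl⟩ := hw'
      refine h.2 v ?_
      rintro ⟨u, rfl⟩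
      exact hw ⟨u, rfl⟩
    · exact h.1 w hw'

/-- A Boolean circuit that is evaluated on qubits in a basis state only changes the basis state. -/
theorem classical_apply_place (f : V ↪ W) (ρ : DM V) (z : W → Bool) {α β : Type} (B : BCirc α β)
    (e : α ⊕ β ↪ W) (he : ∀ i, e i ∉ Set.range f) :
    (Gate.classical B e).apply (place f ρ z) = place f ρ (xorEval B e z) := by
  have key : ∀ a : W → Bool, (∀ w, w ∉ Set.range f → xorEval B e a w = z w) ↔
      ∀ w, w ∉ Set.range f → a w = xorEval B e z w := by
    have : ∀ a z : W → Bool, (∀ w, w ∉ Set.range f → a w = z w) →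
        ∀ w, w ∉ Set.range f → xorEval B e a w = xorEval B e z w := by
      intro a z h w hw
      unfold xorEval
      have e1 : (fun i => a (e (Sum.inl i))) = fun i => z (e (Sum.inl i)) :=
        funext fun i => h _ (he _)
      rw [h w hw, e1]
    intro a
    constructor
    · intro h
      have := this _ _ h
      rwa [xorEval_involutive B e a] at this
    · intro h
      have := this _ _ h
      rwa [xorEval_involutive B e z] at this
  have hr : ∀ (a : W → Bool) v, xorEval B e a (f v) = a (f v) := fun a v =>
    xorEval_of_notMem _ _ _ _ fun i hi => he (Sum.inr i) (hi ▸ ⟨v, rfl⟩)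
  ext a b
  simp only [Gate.apply, place, Matrix.of_apply, hr, forall_and, key]

end local_action

/-! ### Negligible functions and the soundness of arguments of knowledge -/

theorem Negligible.tendsto_zero {ν : ℕ → ℝ} (h : Negligible ν) : Tendsto ν atTop (nhds 0) := by
  simpa using h 0

theorem Negligible.eventually_lt {ν : ℕ → ℝ} (h : Negligible ν) {r : ℝ} (hr : 0 < r) :
    ∀ᶠ κ in atTop, ν κ < r :=
  h.tendsto_zero.eventually (gt_mem_nhds hr)

theorem polyBounded_const (k : ℕ) : PolyBounded fun _ => k :=
  ⟨Polynomial.C k, fun κ => by simp⟩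

theorem PolyBounded.mono {s t : ℕ → ℕ} (h : PolyBounded t) (hst : ∀ κ, s κ ≤ t κ) :
    PolyBounded s := by
  obtain ⟨q, hq⟩ := h
  exact ⟨q, fun κ => (hst κ).trans (hq κ)⟩

/-- Finitely many values do not matter, as long as the function is not negative. -/
theorem Negligible.of_eventually_le {ν μ : ℕ → ℝ} (h : Negligible ν) (h0 : ∀ κ, 0 ≤ μ κ)
    (hle : ∀ᶠ κ in atTop, μ κ ≤ ν κ) : Negligible μ := by
  refine Asymptotics.SuperpolynomialDecay.trans_eventually_abs_le h ?_
  filter_upwards [hle] with κ hκ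
  simpa [abs_of_nonneg (h0 κ)] using hκ.trans (le_abs_self _)

/-- The pure state of a standard basis vector. -/
noncomputable def basisState {W : Type} (v : W → Bool) : DM W :=
  Matrix.of fun a b => if a = v ∧ b = v then 1 else 0

theorem isDensity_basisState {W : Type} [Fintype W] (v : W → Bool) : IsDensity (basisState v) := by
  refine ⟨?_, ?_⟩
  · convert (Matrix.PosSemidef.one (n := Unit) (R := ℂ)).kraus_one (fun _ : W → Bool => ())
      (fun a => if a = v then 1 else 0) using 1
    ext a b
    by_cases ha : a = v <;> by_cases hb : b = v <;> simp [basisState, ha, hb]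
  · simp [basisState, Matrix.trace]

namespace ArgSystem

/-- An argument of knowledge is sound with a constant error: since extraction from a prover of a
statement without witnesses never succeeds, such a prover is accepted with probability less than
`1 - 1 / (2 * c)` from some `κ` on. The bound holds for all provers of a given polynomial size
at once, because a family of provers can be put together from the worst ones. -/
theorem LinearlyKnowledgeSound.eventually_acceptProb_lt {V : ArgSystem} {c : ℝ} (hc : 0 < c)
    (h : V.LinearlyKnowledgeSound c) {a b : ℕ → ℕ}
    (R : ∀ κ, BCirc (Fin (a κ) ⊕ Fin (b κ)) Unit)
    (ha : PolyBounded a) (hb : PolyBounded b) (hR : PolyBounded fun κ => (R κ).size)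
    {k s : ℕ → ℕ} (hk : PolyBounded k) (hs : PolyBounded s) :
    ∀ᶠ κ in atTop, ∀ (A : ℕ → Circuit (Fin (k κ) ⊕ (V κ (a κ) (b κ) (R κ)).Msg))
      (x : Fin (a κ) → Bool) (ρ : DM (Fin (k κ) ⊕ (V κ (a κ) (b κ) (R κ)).Msg)),
      (V κ (a κ) (b κ) (R κ)).advSize A ≤ s κ → IsDensity ρ →
      (∀ w, (R κ).eval (Sum.elim x w) () ≠ true) →
      V.acceptProb κ (a κ) (b κ) (R κ) A ρ x < 1 - 1 / (2 * c) := by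
  let Bad (κ : ℕ) (t : (ℕ → Circuit (Fin (k κ) ⊕ (V κ (a κ) (b κ) (R κ)).Msg)) ×
      (Fin (a κ) → Bool) × DM (Fin (k κ) ⊕ (V κ (a κ) (b κ) (R κ)).Msg)) : Prop :=
    (V κ (a κ) (b κ) (R κ)).advSize t.1 ≤ s κ ∧ IsDensity t.2.2 ∧
      (∀ w, (R κ).eval (Sum.elim t.2.1 w) () ≠ true) ∧
      1 - 1 / (2 * c) ≤ V.acceptProb κ (a κ) (b κ) (R κ) t.1 t.2.2 t.2.1
  by_contra hcon
  have hfreq : ∃ᶠ κ in atTop, ∃ t, Bad κ t := by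
    refine fun hev => hcon ?_
    filter_upwards [hev] with κ hκ A x ρ hA hρ hx
    by_contra hlt
    exact hκ ⟨(A, x, ρ), hA, hρ, hx, not_lt.1 hlt⟩
  -- a prover with its statement and state, bad if there is a bad one, and trivial otherwise
  have hworst : ∀ κ, ∃ t : (ℕ → Circuit (Fin (k κ) ⊕ (V κ (a κ) (b κ) (R κ)).Msg)) ×
      (Fin (a κ) → Bool) × DM (Fin (k κ) ⊕ (V κ (a κ) (b κ) (R κ)).Msg),
      (V κ (a κ) (b κ) (R κ)).advSize t.1 ≤ s κ ∧ IsDensity t.2.2 ∧ ((∃ t, Bad κ t) → Bad κ t) := by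
    intro κ
    by_cases hex : ∃ t, Bad κ t
    · obtain ⟨t, ht⟩ := hex
      exact ⟨t, ht.1, ht.2.1, fun _ => ht⟩
    · exact ⟨(fun _ => [], fun _ => false, basisState fun _ => false),
        by simp [Machine.advSize, Circuit.size], isDensity_basisState _, fun h => absurd h hex⟩
  choose t hsize hdens hbad using hworst
  -- with `δ = 1 / (2 * c)`, the extractor would succeed with probability `1 / 2 - negl(κ)`
  have hδ : ∃ q : Polynomial ℕ, ∀ κ : ℕ, 1 / (1 / (2 * c)) ≤ ((q.eval κ : ℕ) : ℝ) :=
    ⟨Polynomial.C ⌈2 * c⌉₊, fun κ => by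
      rw [Polynomial.eval_C, one_div_one_div]; exact Nat.le_ceil _⟩
  obtain ⟨e, E, adv, -, -, -, hext⟩ := h (fun _ => 1 / (2 * c)) (fun _ => by positivity) hδ a b R
    ha hb hR k (fun κ => (t κ).1) hk (hs.mono hsize)
  obtain ⟨ν, hν, hle⟩ := hext (fun κ => (t κ).2.1) (fun κ => (t κ).2.2) hdens
  obtain ⟨κ, hκ, hνκ⟩ := (hfreq.and_eventually (hν.eventually_lt (r := 1 / 2) (by norm_num))).exists
  obtain ⟨-, -, hno, hacc⟩ := hbad κ hκ
  have h0 := hle κ hacc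
  have hzero : extractProb (R κ) (E κ) (adv κ) (t κ).2.2 (t κ).2.1 = 0 := by
    refine Finset.sum_eq_zero fun d _ => if_neg (hno _)
  rw [hzero] at h0
  have : c * (1 / (2 * c)) = 1 / 2 := by field_simp
  linarith

end ArgSystem

/-! ### Fixed collisions of a collapsing hash function -/

/-- The operator `∑ s t, c s t • |v s⟩⟨v t|` on the span of two basis states. -/
noncomputable def twoPoint {W : Type} (v : Bool → W → Bool) (c : Bool → Bool → ℂ) : DM W :=
  Matrix.of fun a b => ∑ s, ∑ t, if a = v s ∧ b = v t then c s t else 0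

section twoPoint
variable {W : Type}

theorem twoPoint_classical {α β : Type} (B : BCirc α β) (e : α ⊕ β ↪ W) (v : Bool → W → Bool)
    (c : Bool → Bool → ℂ) :
    (Gate.classical B e).apply (twoPoint v c) = twoPoint (fun s => xorEval B e (v s)) c := by
  have h : ∀ a b, xorEval B e a = b ↔ a = xorEval B e b := fun a b =>
    (xorEval_involutive B e).eq_iff
  ext a b
  simp only [Gate.apply, twoPoint, Matrix.of_apply, h]

theorem twoPoint_dephase {γ : Type} (g : (W → Bool) → γ) (v : Bool → W → Bool)
    (c : Bool → Bool → ℂ) :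
    dephase g (twoPoint v c) =
      twoPoint v fun s t => if g (v s) = g (v t) then c s t else 0 := by
  ext a b
  simp only [dephase, twoPoint, Matrix.of_apply]
  have h0 : ∀ p : Prop, ∀ F : Bool → Bool → ℂ, (if p then ∑ s, ∑ t, F s t else 0) =
      ∑ s, ∑ t, if p then F s t else 0 := fun p F => by by_cases hp : p <;> simp [hp]
  rw [h0]
  refine Finset.sum_congr rfl fun s _ => Finset.sum_congr rfl fun t _ => ?_
  by_cases h : a = v s ∧ b = v t
  · obtain ⟨rfl, rfl⟩ := h; simp
  · simp [h]

theorem twoPoint_supported (P : (W → Bool) → Prop) (v : Bool → W → Bool)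
    (c : Bool → Bool → ℂ) (h : ∀ s, P (v s)) : Supported P (twoPoint v c) := by
  intro a b hab
  simp only [twoPoint, Matrix.of_apply] at hab
  obtain ⟨s, -, hs⟩ := Finset.exists_ne_zero_of_sum_ne_zero hab
  obtain ⟨t, -, ht⟩ := Finset.exists_ne_zero_of_sum_ne_zero hs
  have h' : a = v s ∧ b = v t := by by_contra h0; exact ht (if_neg h0)
  rw [h'.1, h'.2]
  exact ⟨h s, h t⟩

theorem eq_update_of_values {w : W} {z : W → Bool} {v : Bool → W → Bool} (hw : ∀ s, v s w = s)
    (hv : ∀ s w', w' ≠ w → v s w' = z w') : v = fun s => Function.update z w s := by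
  funext s w'
  by_cases h : w' = w
  · subst h; simp [hw]
  · rw [Function.update_of_ne h, hv s w' h]

/-- A Hadamard gate on a qubit in `|0⟩`; `v s` is the basis state with value `s` there. -/
theorem had_apply_basisState {w : W} {z : W → Bool} {v : Bool → W → Bool} (hz : z w = false)
    (hw : ∀ s, v s w = s) (hvz : ∀ s w', w' ≠ w → v s w' = z w') :
    (Gate.had w).apply (basisState z) = twoPoint v fun _ _ => 1 / 2 := by
  rw [eq_update_of_values hw hvz]
  have hu : ∀ (a : W → Bool) s, Function.update a w s = z ↔
      s = false ∧ a = Function.update z w (a w) := by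
    intro a s
    constructor
    · rintro rfl
      simp only [Function.update_self] at hz
      simp [hz]
    · rintro ⟨rfl, ha⟩
      rw [ha, Function.update_idem, ← hz, Function.update_eq_self]
  have hv : ∀ (a : W → Bool) s, a = Function.update z w s ↔
      s = a w ∧ a = Function.update z w (a w) := by
    intro a s
    constructor
    · intro h
      have : a w = s := by rw [h, Function.update_self]
      rw [this]; exact ⟨rfl, h⟩
    · rintro ⟨rfl, h⟩; exact h
  have hh : ∀ s t, hadEntry s false * hadEntry t false = 1 / 2 := fun s t => by
    have := hadEntry_false_mul_self s
    cases s <;> cases t <;> simpa [hadEntry] using this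
  ext a b
  simp only [Gate.apply, twoPoint, basisState, Matrix.of_apply, hu]
  rw [Finset.sum_eq_single false, Finset.sum_eq_single false, Finset.sum_eq_single (a w),
    Finset.sum_eq_single (b w)]
  · rw [hv a, hv b, hh]
    simp
  · intro t _ ht
    rw [if_neg]
    rintro ⟨-, h⟩
    exact ht ((hv _ _).1 h).1
  · simp
  · intro s _ hs
    refine Finset.sum_eq_zero fun t _ => if_neg ?_
    rintro ⟨h, -⟩
    exact hs ((hv _ _).1 h).1
  · simp
  · intro t _ ht
    simp [ht]
  · simp
  · intro s _ hs
    simp [hs]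
  · simp

/-- Whether a qubit is still in superposition: the outcome `0` after a Hadamard gate has probability
`1` for the coherent state `c = 1 / 2`, and probability `1 / 2` for its diagonal part. -/
theorem prob_had_twoPoint [Fintype W] {w : W} {z : W → Bool} {v : Bool → W → Bool}
    (hw : ∀ s, v s w = s) (hvz : ∀ s w', w' ≠ w → v s w' = z w') (c : Bool → Bool → ℂ) :
    prob (fun a => a w = false) ((Gate.had w).apply (twoPoint v c)) =
      (1 / 2) * (∑ s, ∑ t, c s t).re := by
  rw [eq_update_of_values hw hvz]
  have hh : ∀ s t, hadEntry false s * hadEntry false t = 1 / 2 := fun s t => by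
    have := hadEntry_false_mul_self false
    cases s <;> cases t <;> simpa [hadEntry] using this
  have ht : ∀ (a : W → Bool) s t, a w = false →
      twoPoint (fun s => Function.update z w s) c (Function.update a w s) (Function.update a w t) =
        if a = Function.update z w false then c s t else 0 := by
    intro a s t ha
    have hv : ∀ s s', Function.update a w s = Function.update z w s' ↔
        s' = s ∧ a = Function.update z w false := by
      intro s s'
      constructor
      · intro h
        have h1 := congr_fun h w
        simp only [Function.update_self] at h1
        refine ⟨h1.symm, ?_⟩
        have := congr_arg (fun x => Function.update x w false) h
        simp only [Function.update_idem] at this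
        rw [← this, ← ha, Function.update_eq_self]
      · rintro ⟨rfl, h⟩
        rw [h, Function.update_idem]
    simp only [twoPoint, Matrix.of_apply, hv]
    by_cases h : a = Function.update z w false <;> simp [h, ite_and]
  unfold prob
  rw [Finset.sum_eq_single (Function.update z w false)]
  · simp only [Function.update_self, if_true, Gate.apply, Matrix.of_apply, hh]
    simp only [ht _ _ _ (Function.update_self (β := fun _ => Bool) w false z), if_true,
      ← Finset.mul_sum]
    rw [show (1 / 2 : ℂ) = ((1 / 2 : ℝ) : ℂ) by norm_num, Complex.re_ofReal_mul]
  · intro a _ ha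
    split_ifs with h0
    · simp only [Gate.apply, Matrix.of_apply, ht _ _ _ h0, ha, if_false]
      simp
    · rfl
  · simp

theorem place_basisState {V : Type} (f : V ↪ W) (u : V → Bool) (z : W → Bool) :
    place f (basisState u) z =
      basisState (Function.extend f u z) := by
  have h : ∀ a : W → Bool, a = Function.extend f u z ↔
      (∀ w, w ∉ Set.range f → a w = z w) ∧ (fun v => a (f v)) = u := by
    intro a
    constructor
    · rintro rfl
      refine ⟨fun w hw => Function.extend_apply' _ _ _ hw, ?_⟩
      funext v
      rw [f.injective.extend_apply]
    · rintro ⟨h, rfl⟩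
      funext w
      by_cases hw : ∃ v, f v = w
      · obtain ⟨v, rfl⟩ := hw; rw [f.injective.extend_apply]
      · rw [Function.extend_apply' _ _ _ hw, h w hw]
  ext a b
  simp only [place, Matrix.of_apply, basisState, forall_and, h]
  rw [← ite_and]
  exact if_congr (by tauto) rfl rfl

end twoPoint

namespace HashFamily

/-- The probability that two given strings have the same hash value. -/
noncomputable def collisionProb (H : HashFamily) (n κ : ℕ) (y₀ y₁ : Fin n → Bool) : ℝ :=
  (∑ u : Fin (H.coins n κ) → Bool,
    if (H.ev n κ).eval (Sum.elim ((H.gen n κ).eval u) y₀) =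
      (H.ev n κ).eval (Sum.elim ((H.gen n κ).eval u) y₁) then 1 else 0) / 2 ^ H.coins n κ

section attack

variable (d : ℕ) {n : ℕ} (y₀ y₁ : Fin n → Bool)

/-- Where `addFirst` acts. -/
def firstPart : Empty ⊕ {j // y₀ j = true} ↪ Fin d ⊕ (Fin n ⊕ Fin (0 + 1)) where
  toFun := Sum.elim Empty.elim fun j => .inr (.inl j)
  inj' := by
    rintro (i | i) (j | j) h
    · exact i.elim
    · exact i.elim
    · exact j.elim
    · exact congr_arg Sum.inr (Subtype.ext (Sum.inl_injective (Sum.inr_injective h)))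

/-- Where `addDiff` acts. -/
def diffPart : Unit ⊕ {j // y₀ j ≠ y₁ j} ↪ Fin d ⊕ (Fin n ⊕ Fin (0 + 1)) where
  toFun := Sum.elim (fun _ => .inr (.inr 0)) fun j => .inr (.inl j)
  inj' := by
    rintro (i | i) (j | j) h
    · rfl
    · simp at h
    · simp at h
    · exact congr_arg Sum.inr (Subtype.ext (Sum.inl_injective (Sum.inr_injective h)))

/-- Add the string `y₀` to the register `X` of the collapsing game. -/
noncomputable def addFirst : Gate (Fin d ⊕ (Fin n ⊕ Fin (0 + 1))) :=
  .classical ((BCirc.const true).comp (.wire fun _ => ())) (firstPart d y₀)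

/-- Add `y₀ + y₁` to the register `X`, controlled by the private qubit. -/
noncomputable def addDiff : Gate (Fin d ⊕ (Fin n ⊕ Fin (0 + 1))) :=
  .classical (.wire fun _ => ()) (diffPart d y₀ y₁)

/-- A superposition of `y₀` and `y₁` in the register `X`, entangled with the private qubit. -/
noncomputable def attack₁ : Circuit (Fin d ⊕ (Fin n ⊕ Fin (0 + 1))) :=
  [.had (.inr (.inr 0)), addFirst d y₀, addDiff d y₀ y₁]

/-- Disentangle the private qubit, and test whether it is still in superposition. -/
noncomputable def attack₂ : Circuit (Fin d ⊕ (Fin n ⊕ Fin (0 + 1))) :=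
  [addDiff d y₀ y₁, .had (.inr (.inr 0))]

theorem size_attack_le :
    (attack₁ d y₀ y₁).size + (attack₂ d y₀ y₁).size ≤ 3 * n + 6 := by
  have h0 : Fintype.card {j // y₀ j = true} ≤ n := by
    simpa using Fintype.card_subtype_le fun j => y₀ j = true
  have h1 : Fintype.card {j // y₀ j ≠ y₁ j} ≤ n := by
    simp
  simp only [attack₁, attack₂, addFirst, addDiff, Circuit.size, Gate.cost, BCirc.size,
    List.map_cons, List.map_nil, List.sum_cons, List.sum_nil]
  omega

theorem xorEval_firstPart (h : Fin d → Bool) (x : Fin n → Bool) (s : Fin (0 + 1) → Bool) :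
    xorEval ((BCirc.const true).comp (.wire fun _ => ())) (firstPart d y₀)
      (Sum.elim h (Sum.elim x s)) = Sum.elim h (Sum.elim (fun j => xor (x j) (y₀ j)) s) := by
  funext w
  rcases w with i | j | i
  · exact xorEval_of_notMem _ _ _ _ fun _ => Sum.inr_ne_inl
  · by_cases hj : y₀ j = true
    · refine (xorEval_inr _ (firstPart d y₀) _ ⟨j, hj⟩).trans ?_
      simp only [BCirc.eval]
      exact congr_arg (xor (x j)) hj.symm
    · rw [xorEval_of_notMem]
      · simp [hj]
      · rintro ⟨i, hi⟩ h0
        exact hj ((Sum.inl_injective (Sum.inr_injective h0) : i = j) ▸ hi)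
  · exact xorEval_of_notMem _ _ _ _ fun _ h0 => Sum.inl_ne_inr (Sum.inr_injective h0)

theorem xorEval_diffPart (h : Fin d → Bool) (x : Fin n → Bool) (s : Fin (0 + 1) → Bool) :
    xorEval (.wire fun _ => ()) (diffPart d y₀ y₁) (Sum.elim h (Sum.elim x s)) =
      Sum.elim h (Sum.elim (fun j => xor (x j) (s 0 && xor (y₀ j) (y₁ j))) s) := by
  funext w
  rcases w with i | j | i
  · exact xorEval_of_notMem _ _ _ _ fun _ => Sum.inr_ne_inl
  · by_cases hj : y₀ j ≠ y₁ j
    · refine (xorEval_inr _ (diffPart d y₀ y₁) _ ⟨j, hj⟩).trans ?_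
      have : (y₀ j ^^ y₁ j) = true := by simp [hj]
      simp only [BCirc.eval]
      change xor (x j) (s 0) = xor (x j) (s 0 && xor (y₀ j) (y₁ j))
      rw [this, Bool.and_true]
    · rw [xorEval_of_notMem]
      · push Not at hj
        simp [hj]
      · rintro ⟨i, hi⟩ h0
        exact hj ((Sum.inl_injective (Sum.inr_injective h0) : i = j) ▸ hi)
  · exact xorEval_of_notMem _ _ _ _ fun _ h0 => Sum.inl_ne_inr (Sum.inr_injective h0)

/-- The hypothesis of `had_apply_basisState` and `prob_had_twoPoint`, for the private qubit. -/
theorem private_values (h : Fin d → Bool) (x : Fin n → Bool) (s : Bool)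
    (w : Fin d ⊕ (Fin n ⊕ Fin (0 + 1))) (hw : w ≠ .inr (.inr 0)) :
    Sum.elim h (Sum.elim x fun _ : Fin (0 + 1) => s) w =
      Sum.elim h (Sum.elim x fun _ => false) w := by
  rcases w with i | j | i
  · rfl
  · rfl
  · exact absurd (by rw [show i = 0 from Fin.fin_one_eq_zero i]) hw

theorem attack₁_run (h : Fin d → Bool) :
    (attack₁ d y₀ y₁).run (basisState (Sum.elim h (Sum.elim (fun _ => false) fun _ => false))) =
      twoPoint (fun s => Sum.elim h (Sum.elim (fun j => if s then y₁ j else y₀ j) fun _ => s))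
        fun _ _ => 1 / 2 := by
  simp only [attack₁, Circuit.run_cons, Circuit.run_nil]
  rw [had_apply_basisState (v := fun s => Sum.elim h (Sum.elim (fun _ => false) fun _ => s))
    rfl (fun _ => rfl) (private_values d h _), addFirst, twoPoint_classical, addDiff, twoPoint_classical]
  congr 1
  funext s
  rw [xorEval_firstPart, xorEval_diffPart]
  congr 2
  funext j
  cases s <;> cases y₀ j <;> cases y₁ j <;> rfl

theorem addDiff_apply (h : Fin d → Bool) (c : Bool → Bool → ℂ) :
    (addDiff d y₀ y₁).apply (twoPoint (fun s => Sum.elim h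
      (Sum.elim (fun j => if s then y₁ j else y₀ j) fun _ => s)) c) =
      twoPoint (fun s => Sum.elim h (Sum.elim y₀ fun _ => s)) c := by
  rw [addDiff, twoPoint_classical]
  congr 1
  funext s
  rw [xorEval_diffPart]
  congr 2
  funext j
  cases s <;> cases y₀ j <;> cases y₁ j <;> rfl

end attack

/-- The outcome of the collapsing game for the superposition of `y₀` and `y₁`: `0` with probability
`1` if the measured function `M` does not separate them, and with probability `1 / 2` if it does. -/
theorem game_attack (H : HashFamily) (n κ : ℕ) (y₀ y₁ : Fin n → Bool) {γ : Type}
    (M : (Fin (H.desc n κ) → Bool) → (Fin n → Bool) → γ) :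
    H.game n κ 0 (attack₁ _ y₀ y₁) (attack₂ _ y₀ y₁)
        (basisState fun _ => false) M =
      (∑ u : Fin (H.coins n κ) → Bool, (1 / 2 + 1 / 2 *
        if M ((H.gen n κ).eval u) y₀ = M ((H.gen n κ).eval u) y₁ then 1 else 0)) /
        2 ^ H.coins n κ := by
  unfold game
  congr 1
  refine Finset.sum_congr rfl fun u _ => ?_
  have e0 : Function.extend
      ((Function.Embedding.inr.trans Function.Embedding.inr :
        Fin (0 + 1) ↪ Fin (H.desc n κ) ⊕ (Fin n ⊕ Fin (0 + 1))))
      (fun _ => false) (Sum.elim ((H.gen n κ).eval u) fun _ => false) =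
      Sum.elim ((H.gen n κ).eval u) (Sum.elim (fun _ => false) fun _ => false) := by
    funext w
    by_cases hw : ∃ v, (Function.Embedding.inr.trans Function.Embedding.inr :
        Fin (0 + 1) ↪ Fin (H.desc n κ) ⊕ (Fin n ⊕ Fin (0 + 1))) v = w
    · obtain ⟨v, rfl⟩ := hw
      rw [Function.Embedding.injective _ |>.extend_apply]
      rfl
    · rw [Function.extend_apply' _ _ _ hw]
      rcases w with i | i | i <;> rfl
  simp only
  rw [place_basisState, e0, attack₁_run, twoPoint_dephase, place_reduce]
  · simp only [attack₂, Circuit.run_cons, Circuit.run_nil]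
    rw [addDiff_apply, prob_had_twoPoint (fun _ => rfl) (private_values _ _ _)]
    simp only [Fintype.sum_bool, Sum.elim_inr, Sum.elim_inl, if_true, Bool.false_eq_true, if_false]
    by_cases h : M ((H.gen n κ).eval u) y₀ = M ((H.gen n κ).eval u) y₁
    · simp [h]; norm_num
    · simp [h, Ne.symm h]; norm_num
  · refine twoPoint_supported _ _ _ fun s w hw => ?_
    rcases w with i | w
    · rfl
    · exact absurd ⟨w, rfl⟩ hw

/-- Strings that do not depend on the hash function collide with negligible probability: if they
collide, then measuring the hash value leaves their superposition intact, while measuring the string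
destroys it. -/
theorem Collapsing.exists_collisionProb_le {H : HashFamily} (hH : H.Collapsing) {n : ℕ → ℕ}
    (hn : PolyBounded n) (y₀ y₁ : ∀ κ, Fin (n κ) → Bool) :
    ∃ ν : ℕ → ℝ, Negligible ν ∧ ∀ κ, y₀ κ ≠ y₁ κ →
      H.collisionProb (n κ) κ (y₀ κ) (y₁ κ) ≤ ν κ := by
  obtain ⟨ν, hν, hle⟩ := hH.2 n (fun _ => 0) (fun κ => attack₁ _ (y₀ κ) (y₁ κ))
    (fun κ => attack₂ _ (y₀ κ) (y₁ κ)) (fun _ => basisState fun _ => false)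
    hn (polyBounded_const 0)
    (by
      obtain ⟨q, hq⟩ := hn
      refine ⟨3 * q + 6, fun κ => (size_attack_le _ _ _).trans ?_⟩
      have := hq κ
      simp only [Polynomial.eval_add, Polynomial.eval_mul, Polynomial.eval_ofNat]
      omega)
    fun κ => isDensity_basisState _
  refine ⟨fun κ => 2 * ν κ, Asymptotics.SuperpolynomialDecay.const_mul hν 2, fun κ hκ => ?_⟩
  have h := hle κ
  rw [game_attack, game_attack, ← sub_div, ← Finset.sum_sub_distrib] at h
  have h2 := (le_abs_self _).trans h
  simp only [hκ, if_false, mul_zero, add_zero, add_sub_cancel_left, ← Finset.mul_sum] at h2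
  rw [mul_div_assoc] at h2
  have h3 : 1 / 2 * H.collisionProb (n κ) κ (y₀ κ) (y₁ κ) ≤ ν κ := by
    unfold collisionProb
    refine le_of_eq_of_le ?_ h2
    congr!
  linarith

end HashFamily

/-! ### Measurements, coins and segments of an interaction -/

section lifting
variable {V W : Type}

/-- A property of basis states that a circuit ensures is also ensured when the circuit acts on a
part of a larger system. -/
theorem Supported.run_on {P Q : (V → Bool) → Prop} (f : V ↪ W) {C : Circuit V}
    (hC : ∀ ρ, Supported P ρ → Supported Q (C.run ρ)) {ρ : DM W}
    (h : Supported (fun a => P fun v => a (f v)) ρ) :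
    Supported (fun a => Q fun v => a (f v)) ((C.on f).run ρ) := by
  intro a b hab
  have hs : Supported P (slice f a b ρ) := by
    intro v v' hv
    have h2 := h _ _ hv
    simp only [f.injective.extend_apply] at h2
    exact h2
  refine hC _ hs _ _ ?_
  rw [← slice_run_on]
  simp only [slice, Matrix.of_apply, extend_comp_self]
  exact hab

theorem Supported.reduce [Fintype W] {P : (V → Bool) → Prop} (f : V ↪ W) {ρ : DM W}
    (h : Supported (fun a => P fun v => a (f v)) ρ) : Supported P (reduce f ρ) := by
  intro v v' hv
  rw [reduce_eq_sum_slice, Matrix.sum_apply] at hv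
  obtain ⟨z, -, hz⟩ := Finset.exists_ne_zero_of_sum_ne_zero hv
  split_ifs at hz
  · have h2 := h _ _ hz
    simp only [f.injective.extend_apply] at h2
    exact h2
  · exact absurd rfl hz

theorem prob_run_on [Fintype V] [Fintype W] (f : V ↪ W) (C : Circuit V) (Q : (V → Bool) → Prop)
    (ρ : DM W) :
    prob (fun a => Q fun v => a (f v)) ((C.on f).run ρ) = prob Q (C.run (_root_.reduce f ρ)) := by
  rw [← reduce_run_on, prob_reduce]

theorem prob_classical [Fintype W] {α β : Type} (B : BCirc α β) (e : α ⊕ β ↪ W)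
    (P : (W → Bool) → Prop) (ρ : DM W) :
    prob P ((Gate.classical B e).apply ρ) = prob (fun a => P (xorEval B e a)) ρ := by
  unfold prob
  rw [← Equiv.sum_comp (xorEval_involutive B e).toPerm]
  refine Finset.sum_congr rfl fun a _ => ?_
  simp only [Gate.apply, Matrix.of_apply, Function.Involutive.coe_toPerm,
    xorEval_involutive B e a]

theorem prob_measure [Fintype W] (w : W) (P : (W → Bool) → Prop) (ρ : DM W) :
    prob P ((Gate.measure w).apply ρ) = prob P ρ := by
  refine Finset.sum_congr rfl fun a _ => ?_
  simp [Gate.apply, dephase]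

/-- A Hadamard gate on a qubit in the state `|0⟩`, followed by a measurement, is a coin flip. -/
theorem prob_flip [Fintype W] (w : W) (P : (W → Bool) → Prop) {ρ : DM W}
    (h : Supported (fun a => a w = false) ρ) :
    prob P (Circuit.run [Gate.had w, Gate.measure w] ρ) =
      1 / 2 * ∑ s, prob (fun a => P (Function.update a w s)) ρ := by
  rw [Circuit.run_cons, Circuit.run_cons, Circuit.run_nil, prob_measure]
  have key : ∀ a : W → Bool, (Gate.had w).apply ρ a a =
      1 / 2 * ρ (Function.update a w false) (Function.update a w false) := by
    intro a
    simp only [Gate.apply, Matrix.of_apply]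
    rw [Finset.sum_eq_single false, Finset.sum_eq_single false, hadEntry_false_mul_self]
    · intro t _ ht
      by_contra hne
      have := (h _ _ (right_ne_zero_of_mul hne)).2
      simp only [Function.update_self] at this
      exact ht this
    · simp
    · intro s _ hs
      refine Finset.sum_eq_zero fun t _ => ?_
      by_contra hne
      have := (h _ _ (right_ne_zero_of_mul hne)).1
      simp only [Function.update_self] at this
      exact hs this
    · simp
  have h0 : ∀ a : W → Bool, a w = true → ρ a a = 0 := by
    intro a ha
    by_contra hne
    have h1 : a w = false := (h a a hne).1
    rw [ha] at h1
    exact Bool.noConfusion h1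
  have e1 : prob P ((Gate.had w).apply ρ) = ((1 / 2 : ℂ) • ∑ a : W → Bool, ∑ s, (if P (Function.update a w s)
      then 1 / 2 * ρ (Function.update a w false) (Function.update a w false) else 0)).re := by
    have hφ := sum_eq_half_sum_update w fun a => if P a then (Gate.had w).apply ρ a a else 0
    simp only [key, Function.update_idem] at hφ
    rw [← hφ, Complex.re_sum]
    exact Finset.sum_congr rfl fun a _ => by rw [key]; split_ifs <;> simp
  have e2 : ∀ s, prob (fun a => P (Function.update a w s)) ρ =
      ((1 / 2 : ℂ) • ∑ a : W → Bool, (if P (Function.update a w s)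
      then ρ (Function.update a w false) (Function.update a w false) else 0)).re := by
    intro s
    have hφ := sum_eq_half_sum_update w fun a => if P (Function.update a w s) then ρ a a else 0
    have h1 : ∀ a : W → Bool, ρ (Function.update a w true) (Function.update a w true) = 0 :=
      fun a => h0 _ (Function.update_self (β := fun _ => Bool) w true a)
    simp only [Fintype.sum_bool, Function.update_idem, h1, ite_self, zero_add] at hφ
    rw [← hφ, Complex.re_sum]
    exact Finset.sum_congr rfl fun a _ => by split_ifs <;> simp
  rw [e1]
  simp only [e2]
  rw [← Complex.re_sum, ← Finset.smul_sum, Finset.sum_comm]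
  have e3 : ∀ z : ℂ, (1 / 2 : ℝ) * z.re = ((1 / 2 : ℂ) * z).re := fun z => by
    rw [show (1 / 2 : ℂ) = ((1 / 2 : ℝ) : ℂ) by norm_num, Complex.re_ofReal_mul]
  rw [e3]
  congr 1
  simp only [smul_eq_mul, Finset.mul_sum]
  refine Finset.sum_congr rfl fun s _ => Finset.sum_congr rfl fun a _ => ?_
  split_ifs <;> ring

end lifting

namespace Ingredients

variable {ι W : Type}

theorem writes_measureAll [Fintype ι] (q : ι → W) : Circuit.writes (measureAll q) = ∅ := by
  ext w
  simp [Circuit.writes, measureAll, Gate.writes]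

theorem writes_resetAll [Fintype ι] (q : ι → W) : Circuit.writes (resetAll q) = Set.range q := by
  ext w
  simp [Circuit.writes, resetAll, Gate.writes, eq_comm]

theorem writes_flipAll [Fintype ι] (q : ι → W) : Circuit.writes (flipAll q) = Set.range q := by
  ext w
  constructor
  · rintro ⟨g, hg, hw⟩
    simp only [flipAll, List.mem_flatMap, List.mem_cons, List.not_mem_nil, or_false] at hg
    obtain ⟨i, -, rfl | rfl⟩ := hg
    · exact ⟨i, hw.symm⟩
    · exact absurd hw (Set.notMem_empty _)
  · rintro ⟨i, rfl⟩
    exact ⟨Gate.had (q i), by simp [flipAll], rfl⟩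

theorem size_measureAll [Fintype ι] (q : ι → W) : Circuit.size (measureAll q) = Fintype.card ι := by
  simp [Circuit.size, measureAll, Gate.cost, Function.comp_def]

theorem size_resetAll [Fintype ι] (q : ι → W) : Circuit.size (resetAll q) = Fintype.card ι := by
  simp [Circuit.size, resetAll, Gate.cost, Function.comp_def]

theorem size_flipAll [Fintype ι] (q : ι → W) :
    Circuit.size (flipAll q) = 2 * Fintype.card ι := by
  have : ∀ l : List ι, Circuit.size (l.flatMap fun i => [Gate.had (q i), Gate.measure (q i)]) =
      2 * l.length := by
    intro l
    induction l with
    | nil => rfl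
    | cons i l ih =>
      rw [List.flatMap_cons, Circuit.size_append, ih, List.length_cons]
      simp only [Circuit.size, Gate.cost, List.map_cons, List.map_nil, List.sum_cons, List.sum_nil]
      ring
  rw [flipAll, this, Finset.length_toList, Finset.card_univ]

theorem supported_resetAll [Fintype ι] (q : ι → W) (ρ : DM W) :
    Supported (fun a => ∀ i, a (q i) = false) (Circuit.run (resetAll q) ρ) := by
  have key : ∀ (l : List ι) (S : Set W) (ρ : DM W), Supported (fun a => ∀ w ∈ S, a w = false) ρ →
      Supported (fun a => (∀ w ∈ S, a w = false) ∧ ∀ i ∈ l, a (q i) = false)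
        (Circuit.run (l.map fun i => Gate.reset (q i)) ρ) := by
    intro l
    induction l with
    | nil => intro S ρ h; simpa using h
    | cons i l ih =>
      intro S ρ h
      have h1 : Supported (fun a => ∀ w ∈ insert (q i) S, a w = false)
          ((Gate.reset (q i)).apply ρ) := by
        refine (Gate.apply_supported_reset (q i) h).mono ?_
        rintro a ⟨ha, s, hs⟩ w (rfl | hw)
        · exact ha
        · by_cases hwi : w = q i
          · rw [hwi, ha]
          · simpa [Function.update_of_ne hwi] using hs w hw
      refine (ih _ _ h1).mono ?_
      rintro a ⟨h2, h3⟩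
      refine ⟨fun w hw => h2 w (Set.mem_insert_of_mem _ hw), ?_⟩
      intro j hj
      rcases List.mem_cons.1 hj with rfl | hj
      · exact h2 _ (Set.mem_insert _ _)
      · exact h3 j hj
  refine (key Finset.univ.toList ∅ ρ (fun _ _ _ => by simp)).mono ?_
  rintro a ⟨-, h⟩ i
  exact h i (by simp)

/-- Overwrite the values of the qubits `q i`, for `i` in a list. -/
noncomputable def overwrite (q : ι → W) (u : ι → Bool) : List ι → (W → Bool) → W → Bool
  | [], a => a
  | i :: l, a => overwrite q u l (Function.update a (q i) (u i))

theorem overwrite_of_ne (q : ι → W) (u : ι → Bool) (l : List ι) (a : W → Bool) (w : W)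
    (hw : ∀ i ∈ l, q i ≠ w) : overwrite q u l a w = a w := by
  induction l generalizing a with
  | nil => rfl
  | cons i l ih =>
    rw [overwrite, ih _ fun j hj => hw j (List.mem_cons_of_mem _ hj),
      Function.update_of_ne (hw i List.mem_cons_self).symm]

theorem overwrite_of_mem {q : ι → W} (hq : Function.Injective q) (u : ι → Bool) (l : List ι)
    (hl : l.Nodup) (a : W → Bool) (i : ι) (hi : i ∈ l) : overwrite q u l a (q i) = u i := by
  induction l generalizing a with
  | nil => simp at hi
  | cons j l ih =>
    rw [List.nodup_cons] at hl
    rw [overwrite]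
    by_cases hij : i ∈ l
    · exact ih hl.2 _ hij
    · have : i = j := by simpa [hij] using hi
      subst this
      rw [overwrite_of_ne _ _ _ _ _ fun k hk h => hij (by rwa [← hq h]), Function.update_self]

theorem overwrite_congr (q : ι → W) (u u' : ι → Bool) (l : List ι) (a : W → Bool)
    (h : ∀ i ∈ l, u i = u' i) : overwrite q u l a = overwrite q u' l a := by
  induction l generalizing a with
  | nil => rfl
  | cons i l ih =>
    rw [overwrite, overwrite, h i List.mem_cons_self,
      ih _ fun j hj => h j (List.mem_cons_of_mem _ hj)]

/-- Flipping coins in a register of zeros gives each string with the same probability. -/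
theorem prob_flipAll [Fintype ι] [Fintype W] {q : ι → W} (hq : Function.Injective q)
    (P : (W → Bool) → Prop) {ρ : DM W} (h : Supported (fun a => ∀ i, a (q i) = false) ρ) :
    2 ^ Fintype.card ι * prob P (Circuit.run (flipAll q) ρ) =
      ∑ u : ι → Bool, prob (fun a => P (overwrite q u Finset.univ.toList a)) ρ := by
  have key : ∀ (l : List ι), l.Nodup → ∀ ρ : DM W,
      Supported (fun a => ∀ i ∈ l, a (q i) = false) ρ →
      2 ^ Fintype.card ι *
        prob P (Circuit.run (l.flatMap fun i => [Gate.had (q i), Gate.measure (q i)]) ρ) =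
      ∑ u : ι → Bool, prob (fun a => P (overwrite q u l a)) ρ := by
    intro l
    induction l with
    | nil => intro _ ρ _; simp [overwrite]
    | cons i l ih =>
      intro hl ρ hρ
      rw [List.nodup_cons] at hl
      rw [List.flatMap_cons, Circuit.run_append, ih hl.2]
      · have h1 : ∀ u : ι → Bool, _ := fun u => prob_flip (q i) (fun a => P (overwrite q u l a))
          (hρ.mono fun a ha => ha i List.mem_cons_self)
        simp only [h1, ← Finset.mul_sum]
        have h2 := sum_eq_half_sum_update i
          (fun u : ι → Bool => ((prob (fun a => P (overwrite q u (i :: l) a)) ρ : ℝ) : ℂ))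
        have h3 : ∀ (u : ι → Bool) s (a : W → Bool),
            overwrite q (Function.update u i s) (i :: l) a =
              overwrite q u l (Function.update a (q i) s) := by
          intro u s a
          rw [overwrite, Function.update_self]
          refine overwrite_congr _ _ _ _ _ fun j hj => Function.update_of_ne ?_ _ _
          rintro rfl
          exact hl.1 hj
        simp only [h3, smul_eq_mul] at h2
        apply Complex.ofReal_injective
        push_cast
        exact h2.symm
      · refine Circuit.run_supported _ ?_ (hρ.mono fun a ha j hj => ha j (List.mem_cons_of_mem _ hj))
        intro a b hab
        refine forall₂_congr fun j hj => ?_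
        rw [hab]
        simp only [Circuit.writes, Gate.writes, List.mem_cons, List.not_mem_nil, or_false,
          exists_eq_or_imp, exists_eq_left, Set.mem_empty_iff_false, Set.mem_singleton_iff,
          Set.mem_ofPred_eq]
        intro hji
        exact hl.1 (hq hji ▸ hj)
  refine key _ (Finset.nodup_toList _) ρ (h.mono fun a ha i _ => ha i)

end Ingredients

namespace Machine

variable {I O K : Type}

/-- The qubits on which the honest party acts. -/
def honestPart (V : Machine I O) (K : Type) : (V.Msg ⊕ (I ⊕ (O ⊕ V.Work))) ↪ V.Joint K :=
  Function.Embedding.sumMap Function.Embedding.inr (Function.Embedding.refl _)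

/-- The interaction restricted to a segment `l` of the steps, the first of which has number `j`. -/
def segment (V : Machine I O) (A : ℕ → Circuit (K ⊕ V.Msg))
    (l : List (Circuit (V.Msg ⊕ (I ⊕ (O ⊕ V.Work))))) (j : ℕ) : Circuit (V.Joint K) :=
  (l.zipIdx j).flatMap fun s =>
    (A s.2).on Function.Embedding.inl ++ s.1.on (V.honestPart K)

theorem interact_eq_segment (V : Machine I O) (A : ℕ → Circuit (K ⊕ V.Msg)) :
    V.interact A = V.segment A V.steps 0 := rfl

variable (V : Machine I O) (A : ℕ → Circuit (K ⊕ V.Msg))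

theorem segment_nil (j : ℕ) : V.segment A [] j = [] := rfl

theorem segment_cons (s) (l) (j : ℕ) :
    V.segment A (s :: l) j =
      (A j).on Function.Embedding.inl ++ s.on (V.honestPart K) ++ V.segment A l (j + 1) := by
  simp [segment, List.zipIdx_cons]

theorem segment_append (l l') (j : ℕ) :
    V.segment A (l ++ l') j = V.segment A l j ++ V.segment A l' (j + l.length) := by
  simp [segment, List.zipIdx_append]

end Machine

/-! ### The hashing step -/

theorem Unaffected.union {W : Type} {P : (W → Bool) → Prop} {s t : Set W} (hs : Unaffected P s)
    (ht : Unaffected P t) : Unaffected P (s ∪ t) := by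
  intro a b hab
  refine (hs a (fun w => if w ∈ s then b w else a w) fun w hw => by simp [hw]).trans
    (ht _ b fun w hw => ?_)
  by_cases h : w ∈ s
  · simp [h]
  · simpa [h] using hab w (by simp [h, hw])

theorem Unaffected.empty {W : Type} (P : (W → Bool) → Prop) : Unaffected P ∅ := by
  intro a b hab
  have : a = b := funext fun w => hab w (by simp)
  rw [this]

theorem Unaffected.image {V W : Type} {P : (V → Bool) → Prop} {s : Set V} (h : Unaffected P s)
    (f : V ↪ W) : Unaffected (fun a => P fun v => a (f v)) (f '' s) := by
  intro a b hab
  refine h _ _ fun v hv => hab _ ?_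
  rintro ⟨v', hv', h'⟩
  exact hv (f.injective h' ▸ hv')

namespace Machine

variable {I O K : Type} (V : Machine I O) (A : ℕ → Circuit (K ⊕ V.Msg))

/-- What is kept in the private registers of the honest party is not changed by the other party. -/
theorem unaffected_other {P : (V.Msg ⊕ (I ⊕ (O ⊕ V.Work)) → Bool) → Prop}
    (hP : Unaffected P (Set.range Sum.inl)) (C : Circuit (K ⊕ V.Msg)) :
    Unaffected (fun a : V.Joint K → Bool => P fun w => a (V.honestPart K w))
      (C.on Function.Embedding.inl).writes := by
  intro a b hab
  refine hP _ _ fun w hw => hab _ fun h => ?_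
  obtain ⟨u, hu⟩ := Circuit.writes_on_subset _ _ h
  rcases w with w | w
  · exact hw ⟨w, rfl⟩
  · exact Sum.inl_ne_inr hu

theorem unaffected_segment {P : (V.Msg ⊕ (I ⊕ (O ⊕ V.Work)) → Bool) → Prop}
    (hP : Unaffected P (Set.range Sum.inl))
    (l : List (Circuit (V.Msg ⊕ (I ⊕ (O ⊕ V.Work))))) (hl : ∀ s ∈ l, Unaffected P s.writes)
    (j : ℕ) :
    Unaffected (fun a : V.Joint K → Bool => P fun w => a (V.honestPart K w))
      (V.segment A l j).writes := by
  induction l generalizing j with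
  | nil => rw [segment_nil, Circuit.writes_nil]; exact Unaffected.empty _
  | cons s l ih =>
    rw [segment_cons, Circuit.writes_append, Circuit.writes_append, Circuit.writes_on _ s]
    exact ((V.unaffected_other hP _).union ((hl s List.mem_cons_self).image _)).union
      (ih (fun t ht => hl t (List.mem_cons_of_mem _ ht)) _)

end Machine

namespace Ingredients

variable (G : Ingredients) (κ : ℕ) (p : Params)

/-- The gates of `hashStep`, with names for their embeddings and with the properties of these that
matter. -/
theorem hashStep_eq : ∃ (e₁ : Fin (G.Hash.coins p.m κ) ⊕ Fin (G.Hash.desc p.m κ) ↪ AllReg G κ p)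
    (e₂ : (Fin (G.Hash.desc p.m κ) ⊕ Fin p.m) ⊕ Fin κ ↪ AllReg G κ p)
    (e₃ : (Fin (G.Hash.desc p.m κ) ⊕ Fin κ) ⊕ (Fin (G.Hash.desc p.m κ) ⊕ Fin κ) ↪ AllReg G κ p)
    (e₄ : Empty ⊕ Unit ↪ AllReg G κ p),
    ((∀ i, e₁ (.inl i) = qCoin G κ p i) ∧ ∀ i, e₁ (.inr i) = qHash G κ p (.inl i)) ∧
    ((∀ i, e₂ (.inl (.inl i)) = qHash G κ p (.inl i)) ∧ (∀ i, e₂ (.inl (.inr i)) = qY G κ p i) ∧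
      ∀ i, e₂ (.inr i) = qHash G κ p (.inr i)) ∧
    (∀ i, e₃ (.inr i) = qMsgHash G κ p i) ∧ (∀ i, e₄ (.inr i) = qAcc G κ p 0) ∧
    hashStep G κ p = measureAll (qY G κ p) ++ flipAll (qCoin G κ p) ++
      [Gate.classical (G.Hash.gen p.m κ) e₁, Gate.classical (G.Hash.ev p.m κ) e₂] ++
      resetAll (qMsgHash G κ p) ++
      [Gate.classical (BCirc.wire id) e₃, Gate.classical (BCirc.const (α := Empty) true) e₄] :=
  ⟨_, _, _, _, ⟨fun _ => rfl, fun _ => rfl⟩, ⟨fun _ => rfl, fun _ => rfl, fun _ => rfl⟩,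
    fun _ => rfl, fun _ => rfl, rfl⟩

theorem writes_hashStep_subset : (hashStep G κ p).writes ⊆
    Set.range (qCoin G κ p) ∪ Set.range (qHash G κ p) ∪ Set.range (qMsgHash G κ p) ∪
      {qAcc G κ p 0} := by
  obtain ⟨e₁, e₂, e₃, e₄, ⟨-, h₁⟩, ⟨-, -, h₂⟩, h₃, h₄, h⟩ := hashStep_eq G κ p
  rw [h]
  simp only [Circuit.writes_append, Circuit.writes_cons, Circuit.writes_nil, writes_measureAll,
    writes_flipAll, writes_resetAll, Gate.writes, h₁, h₂, h₃, h₄, Set.union_empty,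
    Set.empty_union, Set.union_subset_iff]
  refine ⟨⟨⟨?_, ?_, ?_⟩, ?_⟩, ?_, ?_⟩
  · intro w hw; simp [hw]
  · rintro _ ⟨i, rfl⟩; simp
  · rintro _ ⟨i, rfl⟩; simp
  · intro w hw; simp [hw]
  · intro w hw; simp [hw]
  · rintro _ ⟨i, rfl⟩; simp

/-- The string `y` is fixed before the hash function is sampled, so it collides with a given
string only with the collision probability of two fixed strings. -/
theorem prob_hashStep_collision_le [Fintype (AllReg G κ p)] (y₁ : Fin p.m → Bool) {M : ℝ}
    (hM : ∀ y, y ≠ y₁ → G.Hash.collisionProb p.m κ y y₁ ≤ M) (hM0 : 0 ≤ M)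
    {ρ : DM (AllReg G κ p)} (hpos : ρ.PosSemidef)
    (hρ : Supported (fun a => (∀ i, a (qCoin G κ p i) = false) ∧ ∀ i, a (qHash G κ p i) = false) ρ) :
    prob (fun a => (fun i => a (qY G κ p i)) ≠ y₁ ∧
        (G.Hash.ev p.m κ).eval (Sum.elim (fun i => a (qHash G κ p (.inl i))) y₁) =
          fun i => a (qHash G κ p (.inr i)))
      ((hashStep G κ p).run ρ) ≤ M * ρ.trace.re := by
  obtain ⟨e₁, e₂, e₃, e₄, ⟨h₁', h₁⟩, ⟨h₂, h₂', h₂''⟩, h₃, h₄, h⟩ := hashStep_eq G κ p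
  rw [h, List.append_assoc (measureAll _ ++ flipAll _ ++ _), Circuit.run_append,
    Circuit.prob_run]
  swap
  · intro a b hab
    simp only [Circuit.writes_append, Circuit.writes_cons, Circuit.writes_nil,
      writes_resetAll, Gate.writes, h₃, h₄] at hab
    have h1 : ∀ i, a (qHash G κ p i) = b (qHash G κ p i) := fun i =>
      hab _ (by simp [qHash, qMsgHash, qAcc])
    have h2 : ∀ i, a (qY G κ p i) = b (qY G κ p i) := fun i =>
      hab _ (by simp [qY, qMsgHash, qAcc])
    simp only [h1, h2]
  rw [Circuit.run_append, Circuit.run_cons, Circuit.run_cons, Circuit.run_nil, prob_classical,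
    prob_classical]
  have hpos' := Circuit.run_posSemidef (measureAll (qY G κ p) ++ flipAll (qCoin G κ p)) hpos
  have hsup : Supported (fun a => ∀ i, a (qHash G κ p i) = false)
      (Circuit.run (measureAll (qY G κ p) ++ flipAll (qCoin G κ p)) ρ) := by
    refine Circuit.run_supported _ ?_ (hρ.mono fun a ha => ha.2)
    intro a b hab
    simp only [Circuit.writes_append, writes_measureAll, writes_flipAll] at hab
    refine forall_congr' fun i => ?_
    rw [hab _ (by simp [qHash, qCoin])]
  -- the strings `y` and `y₁` collide under the hash function that is sampled with the coins `u`
  let coll (u : Fin (G.Hash.coins p.m κ) → Bool) (y : Fin p.m → Bool) : Prop :=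
    (G.Hash.ev p.m κ).eval (Sum.elim ((G.Hash.gen p.m κ).eval u) y) =
      (G.Hash.ev p.m κ).eval (Sum.elim ((G.Hash.gen p.m κ).eval u) y₁)
  refine (prob_mono_of_supported (Q := fun a => (fun i => a (qY G κ p i)) ≠ y₁ ∧
    coll (fun i => a (qCoin G κ p i)) fun i => a (qY G κ p i)) hpos' hsup ?_).trans ?_
  · intro a ha hE
    have hy : ∀ i, xorEval (G.Hash.ev p.m κ) e₂ (xorEval (G.Hash.gen p.m κ) e₁ a) (qY G κ p i) =
        a (qY G κ p i) := fun i => by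
      rw [xorEval_of_notMem _ e₂ _ _ (by simp [h₂'', qHash, qY]),
        xorEval_of_notMem _ e₁ _ _ (by simp [h₁, qHash, qY])]
    have hg : ∀ i, xorEval (G.Hash.gen p.m κ) e₁ a (qHash G κ p (.inl i)) =
        (G.Hash.gen p.m κ).eval (fun i => a (qCoin G κ p i)) i := fun i => by
      rw [← h₁, xorEval_inr]
      simp only [h₁, h₁', ha, Bool.false_xor]
    have hg' : ∀ i, xorEval (G.Hash.ev p.m κ) e₂ (xorEval (G.Hash.gen p.m κ) e₁ a)
        (qHash G κ p (.inl i)) = (G.Hash.gen p.m κ).eval (fun i => a (qCoin G κ p i)) i :=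
      fun i => by rw [xorEval_of_notMem _ e₂ _ _ (by simp [h₂'', qHash]), hg]
    have hc : ∀ i, xorEval (G.Hash.ev p.m κ) e₂ (xorEval (G.Hash.gen p.m κ) e₁ a)
        (qHash G κ p (.inr i)) = (G.Hash.ev p.m κ).eval
          (Sum.elim ((G.Hash.gen p.m κ).eval fun i => a (qCoin G κ p i))
            fun i => a (qY G κ p i)) i := fun i => by
      have h3 : (fun i => xorEval (G.Hash.gen p.m κ) e₁ a (e₂ (Sum.inl i))) =
          Sum.elim ((G.Hash.gen p.m κ).eval fun i => a (qCoin G κ p i))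
            fun i => a (qY G κ p i) := by
        funext i
        rcases i with i | i
        · rw [h₂, hg]; rfl
        · rw [h₂', xorEval_of_notMem _ e₁ _ _ (by simp [h₁, qHash, qY])]; rfl
      rw [← h₂'', xorEval_inr, h3, h₂'', xorEval_of_notMem _ e₁ _ _ (by simp [h₁, qHash]), ha,
        Bool.false_xor]
    simp only [hy, hg', hc] at hE
    exact ⟨hE.1, hE.2.symm⟩
  · rw [Circuit.run_append]
    set ρ' := Circuit.run (measureAll (qY G κ p)) ρ with hρ'
    have hpos₁ : ρ'.PosSemidef := Circuit.run_posSemidef _ hpos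
    have hq : Function.Injective (qCoin G κ p) := fun i j hij => by simpa [qCoin] using hij
    have hflip := prob_flipAll hq (fun a => (fun i => a (qY G κ p i)) ≠ y₁ ∧
      coll (fun i => a (qCoin G κ p i)) fun i => a (qY G κ p i)) (ρ := ρ')
      (Circuit.run_supported _ (by rw [writes_measureAll]; exact Unaffected.empty _)
        (hρ.mono fun a ha => ha.1))
    have hov : ∀ u a, (fun i => overwrite (qCoin G κ p) u Finset.univ.toList a (qCoin G κ p i)) =
        u := fun u a => funext fun i =>
      overwrite_of_mem hq u _ (Finset.nodup_toList _) a i (by simp)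
    have hoy : ∀ u a, (fun i => overwrite (qCoin G κ p) u Finset.univ.toList a (qY G κ p i)) =
        fun i => a (qY G κ p i) := fun u a => funext fun i =>
      overwrite_of_ne _ _ _ _ _ fun _ _ => by simp [qCoin, qY]
    simp only [hov, hoy, Fintype.card_fin] at hflip
    have hsum : ∑ u, prob (fun a => (fun i => a (qY G κ p i)) ≠ y₁ ∧
        coll u fun i => a (qY G κ p i)) ρ' ≤ 2 ^ G.Hash.coins p.m κ * (M * ρ.trace.re) := by
      rw [← Circuit.trace_run (measureAll (qY G κ p)) ρ, ← hρ', ← prob_true]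
      unfold prob
      rw [Finset.sum_comm, Finset.mul_sum, Finset.mul_sum]
      refine Finset.sum_le_sum fun a _ => ?_
      have hnn := diag_re_nonneg hpos₁ a
      by_cases hy : (fun i => a (qY G κ p i)) = y₁
      · simp only [hy, ne_eq, not_true_eq_false, false_and, if_false, Finset.sum_const_zero, if_true]
        positivity
      · have h5 := hM _ hy
        rw [HashFamily.collisionProb, div_le_iff₀ (by positivity)] at h5
        simp only [ne_eq, hy, not_false_eq_true, true_and, if_true]
        calc _ = (∑ u, if coll u fun i => a (qY G κ p i) then (1 : ℝ) else 0) * (ρ' a a).re := by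
              rw [Finset.sum_mul]
              exact Finset.sum_congr rfl fun u _ => by split_ifs <;> simp
          _ ≤ (M * 2 ^ G.Hash.coins p.m κ) * (ρ' a a).re := by
              refine mul_le_mul_of_nonneg_right (le_of_eq_of_le ?_ h5) hnn
              congr!
          _ = _ := by ring
    refine le_of_mul_le_mul_left (hflip.le.trans (le_of_eq_of_le ?_ hsum))
      (by positivity : (0 : ℝ) < 2 ^ G.Hash.coins p.m κ)
    congr!

end Ingredients

/-! ### The client as a prover -/

namespace Ingredients

variable (G : Ingredients) (κ : ℕ) (p : Params)

/-- The statement is copied by a gate on qubits that are embedded as listed. -/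
theorem setupStep_eq : ∃ e : StmtReg G κ p ⊕ Fin (stmtLen G κ p) ↪ AllReg G κ p,
    (∀ i, e (.inl (.inl i)) = qHash G κ p i) ∧ (∀ i, e (.inl (.inr i)) = qPub G κ p i) ∧
    (∀ i, e (.inr i) = qStmt G κ p i) ∧
    setupStep G κ p = resetAll (qStmt G κ p) ++ resetAll (qVer G κ p) ++
      [Gate.classical (BCirc.wire (stmtEquiv G κ p).symm) e] :=
  ⟨_, fun _ => rfl, fun _ => rfl, fun _ => rfl, rfl⟩

/-- The result of the round is recorded by a gate on qubits that are embedded as listed. -/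
theorem recordStep_eq (i : Fin (rounds G p)) : ∃ e : (Unit ⊕ Unit) ⊕ Unit ↪ AllReg G κ p,
    e (.inl (.inl ())) = qAcc G κ p i.castSucc ∧ e (.inl (.inr ())) = qVer G κ p (.inl ()) ∧
    (∀ j, e (.inr j) = qAcc G κ p i.succ) ∧
    recordStep G κ p i = [Gate.measure (qVer G κ p (.inl ())),
      Gate.classical (BCirc.gate fun a b => a && b) e] :=
  ⟨_, rfl, rfl, fun _ => rfl, rfl⟩

theorem writes_setupStep_subset : (setupStep G κ p).writes ⊆
    Set.range (qStmt G κ p) ∪ Set.range (qVer G κ p) := by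
  obtain ⟨e, -, -, h₁, h⟩ := setupStep_eq G κ p
  rw [h]
  simp only [Circuit.writes_append, Circuit.writes_cons, Circuit.writes_nil,
    writes_resetAll, Gate.writes, h₁, Set.union_empty, Set.union_subset_iff]
  exact ⟨⟨Set.subset_union_left, Set.subset_union_right⟩, Set.subset_union_left⟩

theorem writes_recordStep_subset (i : Fin (rounds G p)) :
    (recordStep G κ p i).writes ⊆ {qAcc G κ p i.succ} := by
  obtain ⟨e, -, -, h₁, h⟩ := recordStep_eq G κ p i
  rw [h]
  simp only [Circuit.writes_cons, Circuit.writes_nil, Gate.writes, h₁, Set.union_empty,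
    Set.empty_union]
  rintro _ ⟨i, rfl⟩
  rfl

/-- The statement with hash function and hash value `v` and public inputs `pub`. -/
def stmtString (v : Fin (G.Hash.desc p.m κ) ⊕ Fin κ → Bool) (pub : PubReg G.Com κ p → Bool) :
    Fin (stmtLen G κ p) → Bool :=
  fun i => Sum.elim v pub ((stmtEquiv G κ p).symm i)

/-- The verifier of a round starts afresh, with the statement that belongs to the stored values. -/
theorem supported_setupStep (v : Fin (G.Hash.desc p.m κ) ⊕ Fin κ → Bool)
    (pub : PubReg G.Com κ p → Bool) {ρ : DM (AllReg G κ p)}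
    (hρ : Supported (fun a => (∀ i, a (qHash G κ p i) = v i) ∧ ∀ i, a (qPub G κ p i) = pub i) ρ) :
    Supported (fun a => (∀ i, a (qStmt G κ p i) = stmtString G κ p v pub i) ∧
      ∀ i, a (qVer G κ p i) = false) ((setupStep G κ p).run ρ) := by
  obtain ⟨e, h₁, h₂, h₃, h⟩ := setupStep_eq G κ p
  rw [h, Circuit.run_append]
  have hkeep : Supported (fun a => (∀ i, a (qHash G κ p i) = v i) ∧ ∀ i, a (qPub G κ p i) = pub i)
      (Circuit.run (resetAll (qStmt G κ p) ++ resetAll (qVer G κ p)) ρ) := by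
    refine Circuit.run_supported _ ?_ hρ
    intro a b hab
    simp only [Circuit.writes_append, writes_resetAll] at hab
    have e1 : ∀ i, a (qHash G κ p i) = b (qHash G κ p i) := fun i =>
      hab _ (by simp [qHash, qStmt, qVer])
    have e2 : ∀ i, a (qPub G κ p i) = b (qPub G κ p i) := fun i =>
      hab _ (by simp [qPub, qStmt, qVer])
    simp only [e1, e2]
  have hzero : Supported (fun a => ∀ i, a (qStmt G κ p i) = false)
      (Circuit.run (resetAll (qStmt G κ p) ++ resetAll (qVer G κ p)) ρ) := by
    rw [Circuit.run_append]
    refine Circuit.run_supported _ ?_ (supported_resetAll _ _)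
    intro a b hab
    simp only [writes_resetAll] at hab
    refine forall_congr' fun i => ?_
    rw [hab _ (by simp [qStmt, qVer])]
  have hzero' : Supported (fun a => ∀ i, a (qVer G κ p i) = false)
      (Circuit.run (resetAll (qStmt G κ p) ++ resetAll (qVer G κ p)) ρ) := by
    rw [Circuit.run_append]
    exact supported_resetAll _ _
  refine (Gate.apply_supported_classical _ e (hkeep.and (hzero.and hzero'))).mono ?_
  rintro a ⟨⟨ha, hb⟩, hc, hd⟩
  have e1 : ∀ i, xorEval (BCirc.wire (stmtEquiv G κ p).symm) e a (qHash G κ p i) =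
      a (qHash G κ p i) := fun i => by rw [← h₁, xorEval_inl]
  have e2 : ∀ i, xorEval (BCirc.wire (stmtEquiv G κ p).symm) e a (qPub G κ p i) =
      a (qPub G κ p i) := fun i => by rw [← h₂, xorEval_inl]
  have e3 : ∀ i, xorEval (BCirc.wire (stmtEquiv G κ p).symm) e a (qVer G κ p i) =
      a (qVer G κ p i) := fun i => xorEval_of_notMem _ _ _ _ (by simp [h₃, qStmt, qVer])
  simp only [e1, e2, e3] at ha hb hd
  refine ⟨fun i => ?_, hd⟩
  have h4 := hc i
  rw [← h₃, xorEval_inr] at h4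
  have h5 : (fun i => a (e (Sum.inl i))) = Sum.elim v pub := by
    funext i
    rcases i with i | i
    · rw [h₁, ha]; rfl
    · rw [h₂, hb]; rfl
  rw [h5, h₃] at h4
  simpa [BCirc.eval, stmtString] using h4

/-- The first `i` rounds have passed, and `v` is the stored hash function and hash value. -/
def PassedWith (v : Fin (G.Hash.desc p.m κ) ⊕ Fin κ → Bool) (i : Fin (rounds G p + 1))
    (a : AllReg G κ p → Bool) : Prop :=
  a (qAcc G κ p i) = true ∧ ∀ w, a (qHash G κ p w) = v w

/-- The first `i + 1` rounds count as passed only if the first `i` do and the verifier accepts. -/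
theorem prob_recordStep_le [Fintype (AllReg G κ p)]
    (v : Fin (G.Hash.desc p.m κ) ⊕ Fin κ → Bool) (i : Fin (rounds G p)) {ρ : DM (AllReg G κ p)}
    (hpos : ρ.PosSemidef) (hρ : Supported (fun a => a (qAcc G κ p i.succ) = false) ρ) :
    prob (PassedWith G κ p v i.succ) ((recordStep G κ p i).run ρ) ≤
      prob (fun a => a (qVer G κ p (.inl ())) = true ∧ PassedWith G κ p v i.castSucc a) ρ := by
  obtain ⟨e, h₁, h₂, h₃, h⟩ := recordStep_eq G κ p i
  rw [h, Circuit.run_cons, Circuit.run_cons, Circuit.run_nil, prob_classical, prob_measure]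
  refine prob_mono_of_supported hpos hρ ?_
  rintro a ha ⟨hb, hc⟩
  rw [← h₃ (), xorEval_inr, h₃, ha] at hb
  simp only [BCirc.eval, h₁, h₂, Bool.false_xor, Bool.and_eq_true] at hb
  refine ⟨hb.2, hb.1, fun w => ?_⟩
  rw [← hc w, xorEval_of_notMem _ _ _ _ (by simp [h₃, qAcc, qHash])]

/-- The steps of one round. -/
noncomputable def roundSteps (i : Fin (rounds G p)) : List (Circuit (AllReg G κ p)) :=
  [setupStep G κ p] ++ (verifier G κ p).steps.map (Circuit.on (verifierPart G κ p)) ++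
    [recordStep G κ p i]

/-- The messages of the protocol that do not belong to the argument of knowledge. -/
abbrev OtherMsg : Type := (G.SFVP κ p).Msg ⊕ (Fin (G.Hash.desc p.m κ) ⊕ Fin κ)

section prover

variable {K E : Type} {k : ℕ} (ψ : (K ⊕ OtherMsg G κ p) ≃ Fin k)

/-- The client, seen as a prover: its private register, and the messages of the other parts of the
protocol, are the prover's private register. -/
def proverPart : (K ⊕ MsgReg G κ p) ↪ Fin k ⊕ (verifier G κ p).Msg where
  toFun := Sum.elim (fun x => .inl (ψ (.inl x)))
    (Sum.elim (fun m => .inl (ψ (.inr (.inl m))))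
      (Sum.elim (fun m => .inl (ψ (.inr (.inr m)))) .inr))
  inj' := by
    rintro (x | x | x | x) (y | y | y | y) h <;> simp_all

/-- The prover's private qubits among all qubits outside the server. -/
def privatePlace : K ⊕ OtherMsg G κ p → (K ⊕ E) ⊕ MsgReg G κ p :=
  Sum.elim (fun x => .inl (.inl x)) (Sum.elim (fun m => .inr (.inl m)) fun m => .inr (.inr (.inl m)))

/-- The prover's qubits and the messages of the argument of knowledge, among all qubits outside the
server. -/
def proverPlace : (Fin k ⊕ (verifier G κ p).Msg) ↪ (K ⊕ E) ⊕ MsgReg G κ p where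
  toFun := Sum.elim (fun i => privatePlace G κ p (ψ.symm i)) fun m => .inr (.inr (.inr m))
  inj' := by
    have h : Function.Injective (privatePlace (E := E) G κ p (K := K)) := by
      rintro (x | x | x) (y | y | y) h <;> simp_all [privatePlace]
    have h' : ∀ (x : K ⊕ OtherMsg G κ p) (m : (verifier G κ p).Msg),
        privatePlace (E := E) G κ p x ≠ .inr (.inr (.inr m)) := by
      rintro (x | x | x) m h <;> simp_all [privatePlace]
    rintro (x | x) (y | y) hxy
    · exact congr_arg _ (ψ.symm.injective (h hxy))
    · exact absurd hxy (h' _ _)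
    · exact absurd hxy.symm (h' _ _)
    · exact congr_arg _ (Sum.inr_injective (Sum.inr_injective (Sum.inr_injective hxy)))

theorem proverPlace_proverPart (x : K ⊕ MsgReg G κ p) :
    proverPlace (E := E) G κ p ψ (proverPart G κ p ψ x) =
      Function.Embedding.sumMap Function.Embedding.inl (Function.Embedding.refl _) x := by
  rcases x with x | x | x | x
  · exact congr_arg (privatePlace G κ p) (ψ.symm_apply_apply (.inl x))
  · exact congr_arg (privatePlace G κ p) (ψ.symm_apply_apply (.inr (.inl x)))
  · exact congr_arg (privatePlace G κ p) (ψ.symm_apply_apply (.inr (.inr x)))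
  · rfl

/-- The verifier's registers among those of the server. -/
def verifierPlace : (Fin (stmtLen G κ p) ⊕ (Unit ⊕ (verifier G κ p).Work)) ↪
    PubReg G.Com κ p ⊕ (ServerOut p ⊕ WorkReg G κ p) where
  toFun i := .inr (.inr (.inr (.inr (.inl i))))
  inj' _ _ h := Sum.inl_injective (Sum.inr_injective (Sum.inr_injective
    (Sum.inr_injective (Sum.inr_injective h))))

/-- The qubits of one argument of knowledge. -/
def argumentPlace : (verifier G κ p).Joint (Fin k) ↪ (SFVP2 G κ p).Joint (K ⊕ E) :=
  Function.Embedding.sumMap (proverPlace G κ p ψ) (verifierPlace G κ p)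

/-- The operations of the client, who does not act on the environment `E`. -/
def withEnv (E : Type) (act : ℕ → Circuit (K ⊕ MsgReg G κ p)) (j : ℕ) :
    Circuit ((K ⊕ E) ⊕ MsgReg G κ p) :=
  (act j).on (Function.Embedding.sumMap Function.Embedding.inl (Function.Embedding.refl _))

/-- The prover that behaves like the client from step `j` on. -/
def proverFrom (act : ℕ → Circuit (K ⊕ MsgReg G κ p)) (j t : ℕ) :
    Circuit (Fin k ⊕ (verifier G κ p).Msg) :=
  (act (j + t)).on (proverPart G κ p ψ)

/-- The part of a round between `setupStep` and `recordStep` is an interaction of the verifier with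
the client as a prover. -/
theorem segment_verifier (act : ℕ → Circuit (K ⊕ MsgReg G κ p)) (j : ℕ) :
    (SFVP2 G κ p).segment (withEnv G κ p E act)
        ((verifier G κ p).steps.map (Circuit.on (verifierPart G κ p))) j =
      ((verifier G κ p).interact (proverFrom G κ p ψ act j)).on (argumentPlace G κ p ψ) := by
  have key : ∀ l t, (SFVP2 G κ p).segment (withEnv G κ p E act)
        (l.map (Circuit.on (verifierPart G κ p))) (j + t) =
      ((verifier G κ p).segment (proverFrom G κ p ψ act j) l t).on (argumentPlace G κ p ψ) := by
    intro l
    induction l with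
    | nil => intro t; rfl
    | cons s l ih =>
      intro t
      rw [List.map_cons]
      erw [Machine.segment_cons]
      rw [Machine.segment_cons, Circuit.on_append,
        Circuit.on_append, add_assoc, ih (t + 1)]
      congr 2
      · rw [withEnv, proverFrom, Circuit.on_on, Circuit.on_on]
        refine (Circuit.on_on _ _ _).trans ?_
        congr 1
        ext x
        exact congr_arg Sum.inl (proverPlace_proverPart G κ p ψ x).symm
      · erw [Circuit.on_on]
        rw [Circuit.on_on]
        congr 1
        ext (x | x | x) <;> rfl
  exact key _ 0

end prover

end Ingredients

/-! ### One round -/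

theorem Matrix.trace_eq_trace_of_fintype {X : Type*} (i j : Fintype X) (M : Matrix X X ℂ) :
    @Matrix.trace _ _ i _ M = @Matrix.trace _ _ j _ M := by
  rw [Subsingleton.elim i j]

theorem place_smul {V W : Type} (f : V ↪ W) (c : ℂ) (ρ : DM V) (z : W → Bool) :
    place f (c • ρ) z = c • place f ρ z := by
  ext a b
  simp only [place, Matrix.of_apply, Matrix.smul_apply, smul_eq_mul, mul_ite, mul_zero]

theorem trace_eq_re {W : Type} [Fintype W] {ρ : DM W} (hρ : ρ.PosSemidef) :
    ρ.trace = (ρ.trace.re : ℂ) :=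
  Complex.ext rfl (Complex.le_def.1 hρ.trace_nonneg).2.symm

theorem trace_re_nonneg {W : Type} [Fintype W] {ρ : DM W} (hρ : ρ.PosSemidef) :
    0 ≤ ρ.trace.re := (Complex.le_def.1 hρ.trace_nonneg).1

/-- A positive operator is a density operator, rescaled. -/
theorem exists_isDensity_smul {W : Type} [Fintype W] {ρ : DM W} (hρ : ρ.PosSemidef) :
    ∃ σ : DM W, IsDensity σ ∧ ρ = (ρ.trace.re : ℂ) • σ := by
  rcases (trace_re_nonneg hρ).eq_or_lt with h | h
  · refine ⟨basisState fun _ => false, isDensity_basisState _, ?_⟩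
    rw [← h, Complex.ofReal_zero, zero_smul]
    refine hρ.trace_eq_zero_iff.1 ?_
    rw [trace_eq_re hρ, ← h, Complex.ofReal_zero]
  · refine ⟨((ρ.trace.re)⁻¹ : ℝ) • ρ, ⟨hρ.smul (inv_nonneg.2 h.le), ?_⟩, ?_⟩
    · rw [Matrix.trace_smul, trace_eq_re hρ]
      simp only [Complex.ofReal_re, Complex.real_smul]
      rw [← Complex.ofReal_mul, inv_mul_cancel₀ h.ne', Complex.ofReal_one]
    · rw [Complex.coe_smul, smul_smul, mul_inv_cancel₀ h.ne', one_smul]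

/-- An upper bound on the acceptance probability of all provers' initial states, for states that
are not normalised. -/
theorem ArgSystem.prob_accept_le {V : ArgSystem} {κ a b : ℕ} {R : BCirc (Fin a ⊕ Fin b) Unit}
    {k : ℕ} {A : ℕ → Circuit (Fin k ⊕ (V κ a b R).Msg)} {x : Fin a → Bool} {θ : ℝ}
    (hA : ∀ ρ, IsDensity ρ → V.acceptProb κ a b R A ρ x ≤ θ)
    {σ : DM ((V κ a b R).Joint (Fin k))} (hpos : σ.PosSemidef)
    (hσ : Supported (fun c => (∀ i, c (.inr (.inl i)) = x i) ∧ ∀ i, c (.inr (.inr i)) = false) σ) :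
    prob (fun c => c (.inr (.inr (.inl ()))) = true) (((V κ a b R).interact A).run σ) ≤
      θ * σ.trace.re := by
  obtain ⟨τ, hτ, h⟩ := exists_isDensity_smul (reduce_posSemidef Function.Embedding.inl hpos)
  have h1 := place_reduce (Function.Embedding.inl : _ ↪ (V κ a b R).Joint (Fin k)) (σ := σ)
    (z := Sum.elim (fun _ => false) (Sum.elim x fun _ => false)) (hσ.mono (by
      rintro c ⟨h1, h2⟩ (w | w | w) hw
      · exact absurd ⟨w, rfl⟩ hw
      · exact h1 w
      · exact h2 w))
  rw [h, place_smul, trace_reduce] at h1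
  have h2 := hA τ hτ
  rw [acceptProb] at h2
  conv_lhs => rw [← h1]
  rw [Circuit.run_smul, prob_smul, mul_comm]
  refine (mul_le_mul_of_nonneg_right h2 (trace_re_nonneg hpos)).trans (le_of_eq ?_)
  congr!

namespace Ingredients

variable (G : Ingredients) (κ : ℕ) (p : Params)

/-- All qubits during the execution of the protocol. -/
abbrev FullReg (K : Type) : Type :=
  (K ⊕ MsgReg G κ p) ⊕ (PubReg G.Com κ p ⊕ (ServerOut p ⊕ WorkReg G κ p))

/-- The qubits on which the server acts. -/
def serverPart (K : Type) : AllReg G κ p ↪ FullReg G κ p K :=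
  Function.Embedding.sumMap Function.Embedding.inr (Function.Embedding.refl _)

variable {K : Type} (A : ℕ → Circuit (K ⊕ MsgReg G κ p))

/-- A part of the execution of the protocol: the steps `l` of the server, the first of which has
number `j`. -/
noncomputable def phase (l : List (Circuit (AllReg G κ p))) (j : ℕ) : Circuit (FullReg G κ p K) :=
  (SFVP2 G κ p).segment A l j

theorem phase_nil (j : ℕ) : phase G κ p A [] j = [] := rfl

theorem phase_cons (s) (l) (j : ℕ) : phase G κ p A (s :: l) j =
    (A j).on Function.Embedding.inl ++ s.on (serverPart G κ p K) ++ phase G κ p A l (j + 1) :=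
  (SFVP2 G κ p).segment_cons A s l j

theorem phase_append (l l') (j : ℕ) : phase G κ p A (l ++ l') j =
    phase G κ p A l j ++ phase G κ p A l' (j + l.length) :=
  (SFVP2 G κ p).segment_append A l l' j

theorem unaffected_other {P : (AllReg G κ p → Bool) → Prop} (hP : Unaffected P (Set.range Sum.inl))
    (C : Circuit (K ⊕ MsgReg G κ p)) :
    Unaffected (fun a : FullReg G κ p K → Bool => P fun w => a (serverPart G κ p K w))
      (C.on Function.Embedding.inl).writes :=
  (SFVP2 G κ p).unaffected_other hP C

theorem unaffected_phase {P : (AllReg G κ p → Bool) → Prop} (hP : Unaffected P (Set.range Sum.inl))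
    (l : List (Circuit (AllReg G κ p))) (hl : ∀ s ∈ l, Unaffected P s.writes) (j : ℕ) :
    Unaffected (fun a : FullReg G κ p K → Bool => P fun w => a (serverPart G κ p K w))
      (phase G κ p A l j).writes :=
  (SFVP2 G κ p).unaffected_segment A hP l hl j

/-- The qubits whose values an argument of knowledge may change. -/
def volatile : Set (AllReg G κ p) :=
  Set.range Sum.inl ∪ (Set.range (qStmt G κ p) ∪ Set.range (qVer G κ p))

theorem range_verifierPart_subset : Set.range (verifierPart G κ p) ⊆ volatile G κ p := by
  rintro _ ⟨i | i | i, rfl⟩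
  · exact Or.inl ⟨_, rfl⟩
  · exact Or.inr (Or.inl ⟨i, rfl⟩)
  · exact Or.inr (Or.inr ⟨i, rfl⟩)

variable {G κ p} in
/-- The steps of an argument of knowledge, with its setup, change only volatile qubits. -/
theorem unaffected_argument {P : (AllReg G κ p → Bool) → Prop} (hP : Unaffected P (volatile G κ p)) :
    ∀ s ∈ [setupStep G κ p] ++ (verifier G κ p).steps.map (Circuit.on (verifierPart G κ p)),
      Unaffected P s.writes := by
  intro s hs
  rcases List.mem_append.1 hs with hs | hs
  · rw [List.mem_singleton.1 hs]
    exact hP.mono ((writes_setupStep_subset G κ p).trans Set.subset_union_right)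
  · obtain ⟨t, -, rfl⟩ := List.mem_map.1 hs
    exact hP.mono ((Circuit.writes_on_subset _ _).trans (range_verifierPart_subset G κ p))

section round

variable {G κ p} {E : Type} {k : ℕ} (ψ : (K ⊕ OtherMsg G κ p) ≃ Fin k)

/-- If no initial state of the prover convinces the verifier of the statement with hash value `v`
with probability more than `θ`, then a round reduces the probability that all rounds so far have
passed, with `v` stored, by the factor `θ`. -/
theorem prob_round_le [Fintype K] [Fintype E] {act : ℕ → Circuit (K ⊕ MsgReg G κ p)}
    {v : Fin (G.Hash.desc p.m κ) ⊕ Fin κ → Bool} {pub : PubReg G.Com κ p → Bool} {θ : ℝ}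
    {j : ℕ} (hacc : ∀ σ, IsDensity σ → G.AoK.acceptProb κ _ _ (relation G κ p)
      (proverFrom G κ p ψ act (j + 1)) σ (stmtString G κ p v pub) ≤ θ)
    (i : Fin (rounds G p)) {ρ : DM (FullReg G κ p (K ⊕ E))} (hpos : ρ.PosSemidef)
    (hpub : Supported (fun a => ∀ w, a (serverPart G κ p _ (qPub G κ p w)) = pub w) ρ)
    (hnext : Supported (fun a => a (serverPart G κ p _ (qAcc G κ p i.succ)) = false) ρ) :
    prob (fun a => PassedWith G κ p v i.succ fun w => a (serverPart G κ p _ w))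
        ((phase G κ p (withEnv G κ p E act) (roundSteps G κ p i) j).run ρ) ≤
      θ * prob (fun a => PassedWith G κ p v i.castSucc fun w => a (serverPart G κ p _ w)) ρ := by
  set sp := serverPart G κ p (K ⊕ E) with hsp
  set l := (verifier G κ p).steps.map (Circuit.on (verifierPart G κ p)) with hl
  have hpass : Unaffected (PassedWith G κ p v i.castSucc) (volatile G κ p) := by
    intro a b hab
    have e1 : ∀ w, a (qHash G κ p w) = b (qHash G κ p w) := fun w =>
      hab _ (by simp [volatile, qHash, qStmt, qVer])
    have e2 : a (qAcc G κ p i.castSucc) = b (qAcc G κ p i.castSucc) :=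
      hab _ (by simp [volatile, qAcc, qStmt, qVer])
    simp only [PassedWith, e1, e2]
  have hnext' : Unaffected (fun a => a (qAcc G κ p i.succ) = false) (volatile G κ p) := by
    intro a b hab
    have e2 : a (qAcc G κ p i.succ) = b (qAcc G κ p i.succ) :=
      hab _ (by simp [volatile, qAcc, qStmt, qVer])
    simp only [e2]
  have hin : Set.range Sum.inl ⊆ volatile G κ p := Set.subset_union_left
  -- the state before the result of the round is recorded
  set C := phase G κ p (withEnv G κ p E act) ([setupStep G κ p] ++ l) j with hC
  set B := (withEnv G κ p E act (j + (1 + l.length))).on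
    (Function.Embedding.inl : _ ↪ FullReg G κ p (K ⊕ E)) with hB
  have hsplit : phase G κ p (withEnv G κ p E act) (roundSteps G κ p i) j =
      C ++ (B ++ (recordStep G κ p i).on sp ++ []) := by
    rw [roundSteps, phase_append, phase_cons, phase_nil, hC, hl, List.length_append]
    rfl
  have hpassC := unaffected_phase G κ p (withEnv G κ p E act) (hpass.mono hin) _
    (unaffected_argument hpass) j
  have hpassB := unaffected_other G κ p (hpass.mono hin) (withEnv G κ p E act (j + (1 + l.length)))
  have hnextC := unaffected_phase G κ p (withEnv G κ p E act) (hnext'.mono hin) _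
    (unaffected_argument hnext') j
  have hnextB := unaffected_other G κ p (hnext'.mono hin) (withEnv G κ p E act (j + (1 + l.length)))
  rw [hsplit, List.append_nil, Circuit.run_append, Circuit.run_append]
  rw [prob_run_on sp (recordStep G κ p i) (PassedWith G κ p v i.succ)]
  have hs : Supported (fun a => a (sp (qAcc G κ p i.succ)) = false) (B.run (C.run ρ)) :=
    Circuit.run_supported _ hnextB (Circuit.run_supported _ hnextC hnext)
  refine (prob_recordStep_le G κ p v i (reduce_posSemidef _ (Circuit.run_posSemidef _
    (Circuit.run_posSemidef _ hpos))) (Supported.reduce sp hs)).trans ?_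
  rw [prob_reduce]
  set P : (FullReg G κ p (K ⊕ E) → Bool) → Prop :=
    fun a => PassedWith G κ p v i.castSucc fun w => a (sp w) with hP
  -- the event that the earlier rounds have passed can be moved to the beginning of the round
  have h1 : prob (fun a => a (sp (qVer G κ p (.inl ()))) = true ∧ P a) (B.run (C.run ρ)) =
      prob (fun a => a (sp (qVer G κ p (.inl ()))) = true) (C.run (restrict P ρ)) := by
    rw [← prob_restrict (fun a => a (sp (qVer G κ p (.inl ()))) = true) P,
      ← Circuit.run_restrict B P hpassB, ← Circuit.run_restrict C P hpassC]
    refine Circuit.prob_run _ _ ?_ _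
    refine unaffected_other G κ p (P := fun a => a (qVer G κ p (.inl ())) = true) ?_ _
    intro a b hab
    have : a (qVer G κ p (.inl ())) = b (qVer G κ p (.inl ())) := hab _ (by simp [qVer])
    simp only [this]
  refine h1.le.trans ?_
  rw [prob_eq_trace_restrict P ρ]
  set ρ₁ := restrict P ρ with hρ₁
  have hpos₁ : ρ₁.PosSemidef := restrict_posSemidef _ hpos
  rw [hC, phase_append, Circuit.run_append, phase_cons, phase_nil, List.append_nil,
    Circuit.run_append]
  -- the state before the verifier's first step
  set σ := ((setupStep G κ p).on sp).run
    ((((withEnv G κ p E act) j).on Function.Embedding.inl).run ρ₁) with hσ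
  have hσpos : σ.PosSemidef := Circuit.run_posSemidef _ (Circuit.run_posSemidef _ hpos₁)
  have hσtr : σ.trace = ρ₁.trace := by rw [hσ, Circuit.trace_run, Circuit.trace_run]
  have hσsupp : Supported (fun a => (∀ w, a (sp (qStmt G κ p w)) = stmtString G κ p v pub w) ∧
      ∀ w, a (sp (qVer G κ p w)) = false) σ := by
    refine Supported.run_on sp (fun _ => supported_setupStep G κ p v pub) ?_
    refine Circuit.run_supported _ (unaffected_other G κ p (P := fun a =>
      (∀ w, a (qHash G κ p w) = v w) ∧ ∀ w, a (qPub G κ p w) = pub w) ?_ _) ?_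
    · intro a b hab
      have e1 : ∀ w, a (qHash G κ p w) = b (qHash G κ p w) := fun w => hab _ (by simp [qHash])
      have e2 : ∀ w, a (qPub G κ p w) = b (qPub G κ p w) := fun w => hab _ (by simp [qPub])
      simp only [e1, e2]
    · exact ((supported_restrict P ρ).mono fun a h => h.2).and (hpub.restrict P)
  rw [← hσtr]
  have h2 : phase G κ p (withEnv G κ p E act) l (j + [setupStep G κ p].length) =
      ((verifier G κ p).interact (proverFrom G κ p ψ act (j + 1))).on
        (argumentPlace G κ p (E := E) ψ) := segment_verifier G κ p ψ act (j + 1)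
  rw [h2]
  refine le_of_eq_of_le (prob_run_on (argumentPlace G κ p (E := E) ψ) _
    (fun c => c (.inr (.inr (.inl ()))) = true) σ) ?_
  refine (ArgSystem.prob_accept_le hacc (reduce_posSemidef _ hσpos)
    (Supported.reduce (argumentPlace G κ p (E := E) ψ) hσsupp)).trans (le_of_eq ?_)
  refine congr_arg (fun t : ℂ => θ * t.re) ?_
  refine Eq.trans ?_ ((trace_reduce (argumentPlace G κ p (E := E) ψ) σ).trans ?_)
  · congr!
  · exact Matrix.trace_eq_trace_of_fintype _ _ _

end round

end Ingredients

/-! ### The sequence of rounds and the output -/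

namespace Ingredients

variable (G : Ingredients) (κ : ℕ) (p : Params)

/-- The gates of `outputStep`, with names for their embeddings. -/
theorem outputStep_eq : ∃ (e₀ : Unit ⊕ Unit ↪ AllReg G κ p)
    (e : Fin p.m → ((Unit ⊕ Unit) ⊕ Unit ↪ AllReg G κ p)),
    (e₀ (.inl ()) = qAcc G κ p (Fin.last _) ∧ ∀ i, e₀ (.inr i) = qFlag G κ p) ∧
    (∀ j, e j (.inl (.inl ())) = qAcc G κ p (Fin.last _) ∧ e j (.inl (.inr ())) = qY G κ p j ∧
      ∀ i, e j (.inr i) = qOut G κ p j) ∧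
    outputStep G κ p = Gate.classical (BCirc.wire id) e₀ ::
      (List.finRange p.m).map fun i => Gate.classical (BCirc.gate fun a b => a && b) (e i) :=
  ⟨_, _, ⟨rfl, fun _ => rfl⟩, fun _ => ⟨rfl, rfl, fun _ => rfl⟩, rfl⟩

theorem writes_outputStep_subset : (outputStep G κ p).writes ⊆
    {qFlag G κ p} ∪ Set.range (qOut G κ p) := by
  obtain ⟨e₀, e, ⟨-, h₀⟩, h₁, h⟩ := outputStep_eq G κ p
  rw [h, Circuit.writes_cons]
  refine Set.union_subset ?_ ?_
  · rintro _ ⟨i, rfl⟩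
    exact Or.inl (h₀ i)
  · rintro w ⟨g, hg, hw⟩
    obtain ⟨j, -, rfl⟩ := List.mem_map.1 hg
    obtain ⟨i, rfl⟩ := hw
    exact Or.inr ⟨j, ((h₁ j).2.2 i).symm⟩

/-- The flag is set if all rounds have passed, and the output is `y` in that case. -/
def OutputCorrect (a : AllReg G κ p → Bool) : Prop :=
  a (qFlag G κ p) = a (qAcc G κ p (Fin.last _)) ∧
    ∀ i, a (qOut G κ p i) = (a (qAcc G κ p (Fin.last _)) && a (qY G κ p i))

theorem supported_outputCorrect {ρ : DM (AllReg G κ p)}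
    (hρ : Supported (fun a => a (qFlag G κ p) = false ∧ ∀ i, a (qOut G κ p i) = false) ρ) :
    Supported (OutputCorrect G κ p) ((outputStep G κ p).run ρ) := by
  obtain ⟨e₀, e, ⟨h₀, h₀'⟩, h₁, h⟩ := outputStep_eq G κ p
  rw [h, Circuit.run_cons]
  -- the output bits in `S` have been written
  have key : ∀ (l : List (Fin p.m)) (S : Finset (Fin p.m)) (ρ : DM (AllReg G κ p)), l.Nodup →
      (∀ i ∈ l, i ∉ S) →
      Supported (fun a => a (qFlag G κ p) = a (qAcc G κ p (Fin.last _)) ∧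
        ∀ i, a (qOut G κ p i) =
          if i ∈ S then (a (qAcc G κ p (Fin.last _)) && a (qY G κ p i)) else false) ρ →
      Supported (fun a => a (qFlag G κ p) = a (qAcc G κ p (Fin.last _)) ∧
        ∀ i, a (qOut G κ p i) =
          if i ∈ S ∨ i ∈ l then (a (qAcc G κ p (Fin.last _)) && a (qY G κ p i)) else false)
        (Circuit.run (l.map fun i => Gate.classical (BCirc.gate fun a b => a && b) (e i)) ρ) := by
    intro l
    induction l with
    | nil => intro S ρ _ _ hρ; simpa [Circuit.run_nil] using hρ
    | cons j l ih =>
      intro S ρ hl hS hρ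
      rw [List.nodup_cons] at hl
      rw [List.map_cons, Circuit.run_cons]
      refine (ih (insert j S) _ hl.2 ?_ ?_).mono ?_
      · intro i hi
        rw [Finset.mem_insert, not_or]
        exact ⟨fun hij => hl.1 (hij ▸ hi), hS i (List.mem_cons_of_mem _ hi)⟩
      · refine (Gate.apply_supported_classical _ (e j) hρ).mono ?_
        rintro a ⟨ha, hb⟩
        obtain ⟨hj, hj', hj''⟩ := h₁ j
        have e1 : xorEval (BCirc.gate fun a b => a && b) (e j) a (qAcc G κ p (Fin.last _)) =
            a (qAcc G κ p (Fin.last _)) :=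
          xorEval_of_notMem _ _ _ _ (by simp [hj'', qAcc, qOut])
        have e2 : ∀ i, xorEval (BCirc.gate fun a b => a && b) (e j) a (qY G κ p i) =
            a (qY G κ p i) := fun i => xorEval_of_notMem _ _ _ _ (by simp [hj'', qY, qOut])
        have e3 : xorEval (BCirc.gate fun a b => a && b) (e j) a (qFlag G κ p) =
            a (qFlag G κ p) := xorEval_of_notMem _ _ _ _ (by simp [hj'', qFlag, qOut])
        simp only [e1, e2, e3] at ha hb
        refine ⟨ha, fun i => ?_⟩
        by_cases hij : i = j
        · subst hij
          have h2 := hb i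
          rw [if_neg (hS i List.mem_cons_self), ← hj'' (), xorEval_inr, hj''] at h2
          simp only [BCirc.eval, hj, hj'] at h2
          rw [if_pos (Finset.mem_insert_self _ _)]
          simpa using h2
        · have h2 := hb i
          rw [xorEval_of_notMem _ _ _ _ (by simpa [hj'', qOut] using Ne.symm hij)] at h2
          rw [h2]
          refine if_congr ?_ rfl rfl
          simp [hij]
      · rintro a ⟨ha, hb⟩
        refine ⟨ha, fun i => (hb i).trans (if_congr ?_ rfl rfl)⟩
        rw [Finset.mem_insert, List.mem_cons]
        tauto
  refine (key (List.finRange p.m) ∅ _ (List.nodup_finRange _) (fun _ _ => Finset.notMem_empty _)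
    ?_).mono ?_
  · refine (Gate.apply_supported_classical _ e₀ hρ).mono ?_
    rintro a ⟨ha, hb⟩
    have e2 : ∀ i, xorEval (BCirc.wire id) e₀ a (qOut G κ p i) = a (qOut G κ p i) :=
      fun i => xorEval_of_notMem _ _ _ _ (by simp [h₀', qFlag, qOut])
    rw [← h₀' (), xorEval_inr, h₀'] at ha
    simp only [BCirc.eval, id, h₀] at ha
    refine ⟨by simpa using ha, fun i => ?_⟩
    rw [if_neg (Finset.notMem_empty _), ← e2, hb]
  · rintro a ⟨ha, hb⟩
    refine ⟨ha, fun i => (hb i).trans (if_pos (Or.inr (List.mem_finRange i)))⟩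

variable {G κ p}

theorem unaffected_round {P : (AllReg G κ p → Bool) → Prop} {i : Fin (rounds G p)}
    (hP : Unaffected P (volatile G κ p ∪ {qAcc G κ p i.succ})) :
    ∀ s ∈ roundSteps G κ p i, Unaffected P s.writes := by
  intro s hs
  rcases List.mem_append.1 hs with hs | hs
  · exact unaffected_argument (hP.mono Set.subset_union_left) s hs
  · rw [List.mem_singleton.1 hs]
    exact hP.mono ((writes_recordStep_subset G κ p i).trans Set.subset_union_right)

theorem unaffected_rounds {P : (AllReg G κ p → Bool) → Prop} {l : List (Fin (rounds G p))}
    (hP : ∀ i ∈ l, Unaffected P (volatile G κ p ∪ {qAcc G κ p i.succ})) :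
    ∀ s ∈ l.flatMap (roundSteps G κ p), Unaffected P s.writes := by
  intro s hs
  obtain ⟨i, hi, hs⟩ := List.mem_flatMap.1 hs
  exact unaffected_round (hP i hi) s hs

theorem length_roundSteps (i : Fin (rounds G p)) :
    (roundSteps G κ p i).length = (verifier G κ p).steps.length + 2 := by
  simp [roundSteps]

theorem length_rounds (l : List (Fin (rounds G p))) :
    (l.flatMap (roundSteps G κ p)).length = l.length * ((verifier G κ p).steps.length + 2) := by
  induction l with
  | nil => simp
  | cons i l ih =>
    rw [List.flatMap_cons, List.length_append, ih, length_roundSteps, List.length_cons]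
    ring

section

variable {K E : Type} [Fintype K] [Fintype E] {k : ℕ} (ψ : (K ⊕ OtherMsg G κ p) ≃ Fin k)
  {act : ℕ → Circuit (K ⊕ MsgReg G κ p)} {pub : PubReg G.Com κ p → Bool} {θ : ℝ}

/-- The rounds multiply the probability that all rounds so far have passed, with `v` stored, by
`θ ^ rounds`; here `N` is any bound on the number of steps up to the end of the last round. -/
theorem prob_rounds_le (hθ : 0 ≤ θ) {v : Fin (G.Hash.desc p.m κ) ⊕ Fin κ → Bool} {j N : ℕ}
    (hacc : ∀ j', j' + (verifier G κ p).steps.length + 2 ≤ N → ∀ σ, IsDensity σ →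
      G.AoK.acceptProb κ _ _ (relation G κ p) (proverFrom G κ p ψ act (j' + 1)) σ
        (stmtString G κ p v pub) ≤ θ)
    (hj : j + rounds G p * ((verifier G κ p).steps.length + 2) ≤ N)
    {ρ : DM (FullReg G κ p (K ⊕ E))} (hpos : ρ.PosSemidef)
    (hpub : Supported (fun a => ∀ w, a (serverPart G κ p _ (qPub G κ p w)) = pub w) ρ)
    (hnext : Supported (fun a => ∀ i : Fin (rounds G p),
      a (serverPart G κ p _ (qAcc G κ p i.succ)) = false) ρ) :
    prob (fun a => PassedWith G κ p v (Fin.last _) fun w => a (serverPart G κ p _ w))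
        ((phase G κ p (withEnv G κ p E act)
          ((List.finRange (rounds G p)).flatMap (roundSteps G κ p)) j).run ρ) ≤
      θ ^ rounds G p *
        prob (fun a => PassedWith G κ p v 0 fun w => a (serverPart G κ p _ w)) ρ := by
  have key : ∀ t (ht : t ≤ rounds G p),
      prob (fun a => PassedWith G κ p v ⟨t, Nat.lt_succ_of_le ht⟩
          fun w => a (serverPart G κ p _ w))
        ((phase G κ p (withEnv G κ p E act)
          (((List.finRange (rounds G p)).take t).flatMap (roundSteps G κ p)) j).run ρ) ≤
      θ ^ t * prob (fun a => PassedWith G κ p v 0 fun w => a (serverPart G κ p _ w)) ρ := by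
    intro t
    induction t with
    | zero => intro _; rw [List.take_zero, List.flatMap_nil, phase_nil, pow_zero, one_mul]; rfl
    | succ t ih =>
      intro ht
      have hlen : t < (List.finRange (rounds G p)).length := by
        rw [List.length_finRange]; exact ht
      have ht' : t < rounds G p := ht
      rw [List.take_succ_eq_append_getElem hlen, List.flatMap_append, phase_append,
        Circuit.run_append, List.flatMap_singleton, List.getElem_finRange, length_rounds,
        List.length_take_of_le hlen.le]
      set ρ' := (phase G κ p (withEnv G κ p E act)
        (((List.finRange (rounds G p)).take t).flatMap (roundSteps G κ p)) j).run ρ with hρ'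
      have hmem : ∀ i ∈ (List.finRange (rounds G p)).take t, i.val < t := by
        intro i hi
        obtain ⟨n, hn, rfl⟩ := List.mem_take_iff_getElem.1 hi
        simpa using (lt_min_iff.1 hn).1
      have h1 : Supported (fun a => ∀ w, a (serverPart G κ p _ (qPub G κ p w)) = pub w) ρ' := by
        refine Circuit.run_supported _ (unaffected_phase G κ p _
          (P := fun a => ∀ w, a (qPub G κ p w) = pub w) ?_ _
          (unaffected_rounds fun i _ => ?_) _) hpub
        · exact unaffected_of_values (qPub G κ p) (fun b => ∀ w, b w = pub w) (by simp [qPub])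
        · exact unaffected_of_values (qPub G κ p) (fun b => ∀ w, b w = pub w)
            (by simp [qPub, volatile, qStmt, qVer, qAcc])
      have h2 : Supported (fun a =>
          a (serverPart G κ p _ (qAcc G κ p (Fin.succ ⟨t, ht'⟩))) = false) ρ' := by
        refine Circuit.run_supported _ (unaffected_phase G κ p _
          (P := fun a => a (qAcc G κ p (Fin.succ ⟨t, ht'⟩)) = false) ?_ _
          (unaffected_rounds fun i hi => ?_) _) (hnext.mono fun a ha => ha _)
        · exact unaffected_of_values (fun _ : Unit => qAcc G κ p (Fin.succ ⟨t, ht'⟩))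
            (fun b => b () = false) (by simp [qAcc])
        · refine unaffected_of_values (fun _ : Unit => qAcc G κ p (Fin.succ ⟨t, ht'⟩))
            (fun b => b () = false) ?_
          have := hmem i hi
          simp [volatile, qStmt, qVer, qAcc, Fin.ext_iff]
          omega
      refine (prob_round_le ψ (θ := θ) (v := v) (pub := pub) (hacc _ ?_) ⟨t, ht'⟩
        (Circuit.run_posSemidef _ hpos) h1 h2).trans ?_
      · refine le_trans ?_ hj
        rw [add_assoc, add_assoc, ← Nat.succ_mul]
        exact Nat.add_le_add_left (Nat.mul_le_mul_right _ ht) _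
      · refine (mul_le_mul_of_nonneg_left (ih ht'.le) hθ).trans_eq ?_
        exact (mul_assoc θ _ _).symm.trans (by rw [pow_succ'])
  have := key _ le_rfl
  rwa [List.take_of_length_le (List.length_finRange).le] at this

end

end Ingredients

/-! ### The whole execution -/

namespace Ingredients

variable {G : Ingredients} {κ : ℕ} {p : Params}

variable (G κ p) in
/-- The steps of the server after the hash value has been sent, up to the output. -/
noncomputable def allRounds : List (Circuit (AllReg G κ p)) :=
  (List.finRange (rounds G p)).flatMap (roundSteps G κ p)

variable (G κ p) in
/-- The SFVP subprotocol. -/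
noncomputable def sfvpSteps : List (Circuit (AllReg G κ p)) :=
  (G.SFVP κ p).steps.map (Circuit.on (sfvpPart G κ p))

variable (G κ p) in
theorem length_steps : (SFVP2 G κ p).steps.length =
    (sfvpSteps G κ p ++ [hashStep G κ p]).length +
      rounds G p * ((verifier G κ p).steps.length + 2) + 1 := by
  change (sfvpSteps G κ p ++ [hashStep G κ p] ++ allRounds G κ p ++ [outputStep G κ p]).length = _
  rw [List.length_append, List.length_append (bs := allRounds G κ p), allRounds, length_rounds,
    List.length_finRange, List.length_singleton]

variable (G κ p) in
/-- The execution of the whole protocol. -/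
noncomputable def execution {K : Type} (A : ℕ → Circuit (K ⊕ MsgReg G κ p)) :
    Circuit (FullReg G κ p K) :=
  phase G κ p A (sfvpSteps G κ p ++ [hashStep G κ p] ++ allRounds G κ p ++ [outputStep G κ p]) 0

variable (G κ p) in
/-- The qubits that may change after the hash value has been sent and before the output. -/
def roundsWrite : Set (AllReg G κ p) :=
  volatile G κ p ∪ Set.range fun i : Fin (rounds G p) => qAcc G κ p i.succ

theorem unaffected_allRounds {P : (AllReg G κ p → Bool) → Prop}
    (hP : Unaffected P (roundsWrite G κ p)) : ∀ s ∈ allRounds G κ p, Unaffected P s.writes := by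
  refine unaffected_rounds fun i _ => hP.mono (Set.union_subset_union_right _ ?_)
  rintro _ rfl
  exact ⟨i, rfl⟩

variable (G κ p) in
/-- The qubits that may change in the SFVP subprotocol. -/
def sfvpWrite : Set (AllReg G κ p) :=
  Set.range Sum.inl ∪ (Set.range (qY G κ p) ∪ Set.range fun i => .inr (.inr (.inr (.inl (.inl i)))))

theorem unaffected_sfvpSteps {P : (AllReg G κ p → Bool) → Prop}
    (hP : Unaffected P (sfvpWrite G κ p)) : ∀ s ∈ sfvpSteps G κ p, Unaffected P s.writes := by
  intro s hs
  obtain ⟨t, -, rfl⟩ := List.mem_map.1 hs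
  refine hP.mono ((Circuit.writes_on_subset _ _).trans ?_)
  rintro _ ⟨i | i | i | i, rfl⟩
  · exact Or.inl ⟨_, rfl⟩
  · exact i.elim
  · exact Or.inr (Or.inl ⟨i, rfl⟩)
  · exact Or.inr (Or.inr ⟨i, rfl⟩)

variable (G κ p) in
/-- The initial state of the server: the public inputs, and zeros. -/
def Initial (pub : PubReg G.Com κ p → Bool) (a : AllReg G κ p → Bool) : Prop :=
  (∀ i, a (qPub G κ p i) = pub i) ∧ (a (qFlag G κ p) = false ∧ ∀ i, a (qOut G κ p i) = false) ∧
    (∀ i, a (qAcc G κ p i) = false) ∧ (∀ i, a (qCoin G κ p i) = false) ∧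
      ∀ i, a (qHash G κ p i) = false

theorem unaffected_initial (pub : PubReg G.Com κ p → Bool) :
    Unaffected (Initial G κ p pub) (sfvpWrite G κ p) := by
  unfold Initial
  refine Unaffected.and ?_ (.and (.and ?_ ?_) (.and ?_ (.and ?_ ?_)))
  · exact unaffected_of_values (qPub G κ p) (fun b => ∀ w, b w = pub w)
      (by simp [qPub, sfvpWrite, qY])
  · exact unaffected_of_values (fun _ : Unit => qFlag G κ p) (fun b => b () = false)
      (by simp [qFlag, sfvpWrite, qY])
  · exact unaffected_of_values (qOut G κ p) (fun b => ∀ w, b w = false)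
      (by simp [qOut, sfvpWrite, qY])
  · exact unaffected_of_values (qAcc G κ p) (fun b => ∀ w, b w = false)
      (by simp [qAcc, sfvpWrite, qY])
  · exact unaffected_of_values (qCoin G κ p) (fun b => ∀ w, b w = false)
      (by simp [qCoin, sfvpWrite, qY])
  · exact unaffected_of_values (qHash G κ p) (fun b => ∀ w, b w = false)
      (by simp [qHash, sfvpWrite, qY])

variable (G κ p) in
/-- The state before the first round, as far as the rounds and the output depend on it. -/
def Prepared (pub : PubReg G.Com κ p → Bool) (a : AllReg G κ p → Bool) : Prop :=
  (∀ i, a (qPub G κ p i) = pub i) ∧ (a (qFlag G κ p) = false ∧ ∀ i, a (qOut G κ p i) = false) ∧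
    ∀ i : Fin (rounds G p), a (qAcc G κ p i.succ) = false

theorem unaffected_prepared (pub : PubReg G.Com κ p → Bool) :
    Unaffected (Prepared G κ p pub) (hashStep G κ p).writes := by
  refine Unaffected.mono ?_ (writes_hashStep_subset G κ p)
  unfold Prepared
  refine Unaffected.and ?_ (.and (.and ?_ ?_) ?_)
  · exact unaffected_of_values (qPub G κ p) (fun b => ∀ w, b w = pub w)
      (by simp [qPub, qCoin, qHash, qMsgHash, qAcc])
  · exact unaffected_of_values (fun _ : Unit => qFlag G κ p) (fun b => b () = false)
      (by simp [qFlag, qCoin, qHash, qMsgHash, qAcc])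
  · exact unaffected_of_values (qOut G κ p) (fun b => ∀ w, b w = false)
      (by simp [qOut, qCoin, qHash, qMsgHash, qAcc])
  · exact unaffected_of_values (fun i : Fin (rounds G p) => qAcc G κ p i.succ)
      (fun b => ∀ w, b w = false) (by simp [qCoin, qHash, qMsgHash, qAcc])

variable {K E : Type}

theorem supported_afterHash (A : ℕ → Circuit (K ⊕ MsgReg G κ p)) {pub : PubReg G.Com κ p → Bool}
    {ρ : DM (FullReg G κ p K)}
    (hρ : Supported (fun a => Initial G κ p pub fun w => a (serverPart G κ p _ w)) ρ) :
    Supported (fun a => Prepared G κ p pub fun w => a (serverPart G κ p _ w))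
      ((phase G κ p A (sfvpSteps G κ p ++ [hashStep G κ p]) 0).run ρ) := by
  have hP : Unaffected (Initial G κ p pub) (Set.range Sum.inl) :=
    (unaffected_initial pub).mono Set.subset_union_left
  rw [phase_append, phase_cons, phase_nil, List.append_nil, Circuit.run_append, Circuit.run_append]
  refine Supported.run_on _ (fun _ => Circuit.run_supported _ (unaffected_prepared pub)) ?_
  refine (Circuit.run_supported _ (unaffected_other G κ p hP _) (Circuit.run_supported _
    (unaffected_phase G κ p A hP _ (unaffected_sfvpSteps (unaffected_initial pub)) 0) hρ)).mono ?_
  exact fun a ha => ⟨ha.1, ha.2.1, fun i => ha.2.2.1 _⟩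

theorem supported_final (A : ℕ → Circuit (K ⊕ MsgReg G κ p)) {pub : PubReg G.Com κ p → Bool}
    {ρ : DM (FullReg G κ p K)}
    (hρ : Supported (fun a => Initial G κ p pub fun w => a (serverPart G κ p _ w)) ρ) :
    Supported (fun a => OutputCorrect G κ p fun w => a (serverPart G κ p _ w))
      ((execution G κ p A).run ρ) := by
  have hP : Unaffected (fun a => a (qFlag G κ p) = false ∧ ∀ i, a (qOut G κ p i) = false)
      (roundsWrite G κ p) := by
    refine Unaffected.and ?_ ?_
    · exact unaffected_of_values (fun _ : Unit => qFlag G κ p) (fun b => b () = false)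
        (by simp [qFlag, roundsWrite, volatile, qStmt, qVer, qAcc])
    · exact unaffected_of_values (qOut G κ p) (fun b => ∀ w, b w = false)
        (by simp [qOut, roundsWrite, volatile, qStmt, qVer, qAcc])
  have hP' := hP.mono (Set.subset_union_left.trans Set.subset_union_left :
    Set.range Sum.inl ⊆ roundsWrite G κ p)
  rw [execution, phase_append, phase_append, phase_cons, phase_nil, List.append_nil,
    Circuit.run_append, Circuit.run_append, Circuit.run_append]
  refine Supported.run_on _ (fun _ => supported_outputCorrect G κ p) ?_
  refine Circuit.run_supported _ (unaffected_other G κ p hP' _) (Circuit.run_supported _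
    (unaffected_phase G κ p A hP' _ (unaffected_allRounds hP) _) ?_)
  exact (supported_afterHash A hρ).mono fun a ha => ha.2.1

section

variable [Fintype K] [Fintype E] {k : ℕ} (ψ : (K ⊕ OtherMsg G κ p) ≃ Fin k)
  {act : ℕ → Circuit (K ⊕ MsgReg G κ p)} {pub : PubReg G.Com κ p → Bool} {θ M : ℝ}

/-- The probability that all rounds pass although the outcome is different from `y₁`: either there
is a collision of the hash function, or all arguments of knowledge succeed for a statement with a
wrong hash value. -/
theorem prob_passed_and_ne_le (y₁ : Fin p.m → Bool)
    (hM : ∀ y, y ≠ y₁ → G.Hash.collisionProb p.m κ y y₁ ≤ M) (hM0 : 0 ≤ M) (hθ : 0 ≤ θ)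
    (hacc : ∀ (v : Fin (G.Hash.desc p.m κ) ⊕ Fin κ → Bool),
      (G.Hash.ev p.m κ).eval (Sum.elim (fun i => v (.inl i)) y₁) ≠ (fun i => v (.inr i)) →
      ∀ j, j + (verifier G κ p).steps.length + 2 ≤ (SFVP2 G κ p).steps.length →
      ∀ σ, IsDensity σ → G.AoK.acceptProb κ _ _ (relation G κ p)
        (proverFrom G κ p ψ act (j + 1)) σ (stmtString G κ p v pub) ≤ θ)
    {ρ : DM (FullReg G κ p (K ⊕ E))} (hpos : ρ.PosSemidef) (htr : ρ.trace = 1)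
    (hρ : Supported (fun a => Initial G κ p pub fun w => a (serverPart G κ p _ w)) ρ) :
    prob (fun a => a (serverPart G κ p _ (qAcc G κ p (Fin.last _))) = true ∧
        (fun i => a (serverPart G κ p _ (qY G κ p i))) ≠ y₁)
      ((execution G κ p (withEnv G κ p E act)).run ρ) ≤
      M + θ ^ rounds G p := by
  refine le_of_le_of_eq (b := (M + θ ^ rounds G p) * ρ.trace.re) ?_
    (by rw [htr, Complex.one_re, mul_one])
  set sp := serverPart G κ p (K ⊕ E) with hsp
  set A := withEnv G κ p E act with hA
  set h : (FullReg G κ p (K ⊕ E) → Bool) → (Fin (G.Hash.desc p.m κ) ⊕ Fin κ → Bool) :=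
    fun a w => a (sp (qHash G κ p w)) with hh
  set good : (Fin (G.Hash.desc p.m κ) ⊕ Fin κ → Bool) → Prop := fun v =>
    (G.Hash.ev p.m κ).eval (Sum.elim (fun i => v (.inl i)) y₁) = fun i => v (.inr i) with hgood
  set n₁ := (sfvpSteps G κ p ++ [hashStep G κ p]).length with hn₁
  set n₂ := n₁ + (allRounds G κ p).length with hn₂
  set ρ₁ := (phase G κ p A (sfvpSteps G κ p ++ [hashStep G κ p]) 0).run ρ with hρ₁
  set ρ₂ := (phase G κ p A (allRounds G κ p) n₁).run ρ₁ with hρ₂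
  have hpos₁ : ρ₁.PosSemidef := Circuit.run_posSemidef _ hpos
  have hpos₂ : ρ₂.PosSemidef := Circuit.run_posSemidef _ hpos₁
  have htr₁ : ρ₁.trace = ρ.trace := Circuit.trace_run _ _
  have hprep := supported_afterHash A hρ
  rw [← hρ₁] at hprep
  have hrun : (execution G κ p A).run ρ = (phase G κ p A [outputStep G κ p] n₂).run ρ₂ := by
    rw [execution, phase_append, phase_append, Circuit.run_append, Circuit.run_append,
      List.length_append, Nat.zero_add, Nat.zero_add]
  -- the output does not change the event
  have hout : ∀ P : (AllReg G κ p → Bool) → Prop,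
      Unaffected P (Set.range Sum.inl ∪ ({qFlag G κ p} ∪ Set.range (qOut G κ p))) →
      prob (fun a => P fun w => a (sp w)) ((execution G κ p A).run ρ) =
        prob (fun a => P fun w => a (sp w)) ρ₂ := by
    intro P hP
    rw [hrun]
    refine Circuit.prob_run _ _ (unaffected_phase G κ p A (hP.mono Set.subset_union_left) _ ?_ _) _
    intro s hs
    rw [List.mem_singleton.1 hs]
    exact hP.mono ((writes_outputStep_subset G κ p).trans Set.subset_union_right)
  refine (hout (fun a => a (qAcc G κ p (Fin.last _)) = true ∧ (fun i => a (qY G κ p i)) ≠ y₁)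
    ?_).le.trans ?_
  · refine Unaffected.and ?_ ?_
    · exact unaffected_of_values (fun _ : Unit => qAcc G κ p (Fin.last _)) (fun b => b () = true)
        (by simp [qFlag, qOut, qAcc])
    · exact unaffected_of_values (qY G κ p) (fun b => b ≠ y₁) (by simp [qFlag, qOut, qY])
  -- either the stored hash value is also that of `y₁`, or it is wrong for `y₁`
  have hcover : prob (fun a => a (sp (qAcc G κ p (Fin.last _))) = true ∧
        (fun i => a (sp (qY G κ p i))) ≠ y₁) ρ₂ ≤
      prob (fun a => (fun i => a (sp (qY G κ p i))) ≠ y₁ ∧ good (h a)) ρ₂ +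
        prob (fun a => a (sp (qAcc G κ p (Fin.last _))) = true ∧ ¬ good (h a)) ρ₂ := by
    refine le_trans (prob_mono hpos₂ ?_) (prob_or_le _ _ hpos₂)
    rintro a ⟨h1, h2⟩
    by_cases h3 : good (h a)
    · exact Or.inl ⟨h2, h3⟩
    · exact Or.inr ⟨h1, h3⟩
  refine hcover.trans ?_
  rw [add_mul]
  refine add_le_add ?_ ?_
  · have hun : Unaffected (fun a : AllReg G κ p → Bool => (fun i => a (qY G κ p i)) ≠ y₁ ∧
        good fun w => a (qHash G κ p w)) (roundsWrite G κ p) := by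
      refine Unaffected.and ?_ ?_
      · exact unaffected_of_values (qY G κ p) (fun b => b ≠ y₁)
          (by simp [roundsWrite, volatile, qStmt, qVer, qAcc, qY])
      · exact unaffected_of_values (qHash G κ p) good
          (by simp [roundsWrite, volatile, qStmt, qVer, qAcc, qHash])
    have h1 : prob (fun a => (fun i => a (sp (qY G κ p i))) ≠ y₁ ∧ good (h a)) ρ₂ =
        prob (fun a => (fun i => a (sp (qY G κ p i))) ≠ y₁ ∧ good (h a)) ρ₁ :=
      Circuit.prob_run _ _ (unaffected_phase G κ p A
        (hun.mono (Set.subset_union_left.trans Set.subset_union_left)) _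
        (unaffected_allRounds hun) _) _
    rw [h1, hρ₁, phase_append, phase_cons, phase_nil, List.append_nil, Circuit.run_append,
      Circuit.run_append]
    set ρ₀ := ((A (0 + (sfvpSteps G κ p).length)).on Function.Embedding.inl).run
      ((phase G κ p A (sfvpSteps G κ p) 0).run ρ) with hρ₀
    have htr₀ : ρ₀.trace = ρ.trace := by rw [hρ₀, Circuit.trace_run, Circuit.trace_run]
    have hP : Unaffected (Initial G κ p pub) (Set.range Sum.inl) :=
      (unaffected_initial pub).mono Set.subset_union_left
    have hs₀ : Supported (fun a => Initial G κ p pub fun w => a (sp w)) ρ₀ :=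
      Circuit.run_supported _ (unaffected_other G κ p hP _) (Circuit.run_supported _
        (unaffected_phase G κ p A hP _ (unaffected_sfvpSteps (unaffected_initial pub)) 0) hρ)
    refine le_of_eq_of_le (prob_run_on sp (hashStep G κ p)
      (fun a => (fun i => a (qY G κ p i)) ≠ y₁ ∧ good fun w => a (qHash G κ p w)) ρ₀) ?_
    rw [← htr₀, ← trace_reduce sp ρ₀]
    refine prob_hashStep_collision_le G κ p y₁ hM hM0 (reduce_posSemidef sp
      (Circuit.run_posSemidef _ (Circuit.run_posSemidef _ hpos))) ?_
    exact (Supported.reduce sp hs₀).mono fun a ha => ha.2.2.2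
  · -- fix the stored hash function and hash value `v`, which the rounds do not change
    rw [prob_partition h, ← htr₁, ← prob_true, prob_partition h, Finset.mul_sum]
    refine Finset.sum_le_sum fun v _ => ?_
    by_cases hv : good v
    · refine le_trans (le_of_eq ?_) (mul_nonneg (pow_nonneg hθ _) (prob_nonneg _ hpos₁))
      refine Finset.sum_eq_zero fun a _ => if_neg ?_
      rintro ⟨⟨-, h1⟩, h2⟩
      exact h1 (h2 ▸ hv)
    · refine (prob_mono (Q := fun a => PassedWith G κ p v (Fin.last _) fun w => a (sp w)) hpos₂
        ?_).trans ?_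
      · rintro a ⟨⟨h1, -⟩, h2⟩
        exact ⟨h1, fun w => congr_fun h2 w⟩
      · refine (prob_rounds_le ψ (θ := θ) (v := v) (pub := pub) hθ (hacc v hv) ?_ hpos₁
          (hprep.mono fun a ha => ha.1) (hprep.mono fun a ha => ha.2.2)).trans ?_
        · rw [length_steps]
          exact Nat.le_add_right _ _
        · refine mul_le_mul_of_nonneg_left (prob_mono hpos₁ ?_) (pow_nonneg hθ _)
          rintro a ⟨-, h2⟩
          exact ⟨trivial, funext h2⟩

end

end Ingredients

/-! ### Classical functions of a measured register, and distinguishers -/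

section labels

/-- The reduced state, when the qubits that are traced out are listed by `Z`. -/
theorem reduce_apply_of_equiv {V W Z : Type} [Fintype W] [Fintype Z] (f : V ↪ W) (e : V ⊕ Z ≃ W)
    (hf : ∀ v, e (.inl v) = f v) (ρ : DM W) (x x' : V → Bool) :
    reduce f ρ x x' = ∑ z : Z → Bool,
      ρ (fun w => Sum.elim x z (e.symm w)) (fun w => Sum.elim x' z (e.symm w)) := by
  have hz : ∀ z, e (.inr z) ∉ Set.range f := by
    rintro z ⟨v, hv⟩
    rw [← hf] at hv
    exact Sum.inl_ne_inr (e.injective hv)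
  have hext : ∀ (x : V → Bool) (z : Z → Bool), Function.extend f x
      (fun w => Sum.elim (fun _ => false) z (e.symm w)) = fun w => Sum.elim x z (e.symm w) := by
    intro x z
    funext w
    obtain ⟨v | v, rfl⟩ := e.surjective w
    · rw [hf, f.injective.extend_apply, ← hf, Equiv.symm_apply_apply, Sum.elim_inl]
    · rw [Function.extend_apply' _ _ _ (hz v), Equiv.symm_apply_apply]
      rfl
  rw [reduce_eq_sum_slice, Matrix.sum_apply]
  have h1 : ∀ a : W → Bool, (if ∀ v, a (f v) = false then slice f a a ρ else 0) x x' =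
      if ∀ v, a (f v) = false then ρ (Function.extend f x a) (Function.extend f x' a) else 0 := by
    intro a; split_ifs <;> rfl
  rw [Finset.sum_congr rfl fun a _ => h1 a, ← Finset.sum_filter]
  refine Finset.sum_bij' (fun a _ z => a (e (.inr z)))
    (fun z _ w => Sum.elim (fun _ => false) z (e.symm w)) (fun _ _ => Finset.mem_univ _) ?_ ?_ ?_ ?_
  · intro z _
    refine Finset.mem_filter.2 ⟨Finset.mem_univ _, fun v => ?_⟩
    beta_reduce
    rw [← hf, Equiv.symm_apply_apply, Sum.elim_inl]
  · intro a ha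
    funext w
    obtain ⟨v | v, rfl⟩ := e.surjective w
    · rw [Equiv.symm_apply_apply, Sum.elim_inl, hf, (Finset.mem_filter.1 ha).2]
    · rw [Equiv.symm_apply_apply, Sum.elim_inr]
  · intro z _
    funext v
    beta_reduce
    rw [Equiv.symm_apply_apply, Sum.elim_inr]
  · intro a ha
    have h2 : a = fun w => Sum.elim (fun _ => false) (fun z => a (e (.inr z))) (e.symm w) := by
      funext w
      obtain ⟨v | v, rfl⟩ := e.surjective w
      · rw [Equiv.symm_apply_apply, Sum.elim_inl, hf, (Finset.mem_filter.1 ha).2]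
      · rw [Equiv.symm_apply_apply, Sum.elim_inr]
    conv_lhs => rw [h2]
    rw [hext, hext]

variable {X S Y : Type}

/-- The register `S` is measured and replaced by the classical function `F` of the outcome. -/
noncomputable def label [Fintype S] (F : (S → Bool) → Y → Bool) (τ : DM (X ⊕ S)) : DM (X ⊕ Y) :=
  Matrix.of fun a b => ∑ s : S → Bool,
    if (fun i => a (.inr i)) = F s ∧ (fun i => b (.inr i)) = F s then
      τ (Sum.elim (fun i => a (.inl i)) s) (Sum.elim (fun i => b (.inl i)) s) else 0

variable [Fintype S]

theorem label_posSemidef [Fintype X] [Fintype Y] (F : (S → Bool) → Y → Bool) {τ : DM (X ⊕ S)}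
    (hτ : τ.PosSemidef) : (label F τ).PosSemidef := by
  have : label F τ = ∑ s : S → Bool, Matrix.of fun a b : X ⊕ Y → Bool =>
      (if (fun i => a (.inr i)) = F s then (1 : ℂ) else 0) *
        star (if (fun i => b (.inr i)) = F s then (1 : ℂ) else 0) *
        τ (Sum.elim (fun i => a (.inl i)) s) (Sum.elim (fun i => b (.inl i)) s) := by
    ext a b
    rw [Matrix.sum_apply]
    refine Finset.sum_congr rfl fun s _ => ?_
    by_cases ha : (fun i => a (.inr i)) = F s <;> by_cases hb : (fun i => b (.inr i)) = F s <;>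
      simp [ha, hb]
  rw [this]
  exact Matrix.posSemidef_sum _ fun s _ => hτ.kraus_one
    (fun a : X ⊕ Y → Bool => Sum.elim (fun i => a (.inl i)) s)
    (fun a => if (fun i => a (.inr i)) = F s then (1 : ℂ) else 0)

theorem trace_label [Fintype X] [Fintype Y] {_i : Fintype (X ⊕ Y → Bool)}
    {_j : Fintype (X ⊕ S → Bool)} (F : (S → Bool) → Y → Bool) (τ : DM (X ⊕ S)) :
    (label F τ).trace = τ.trace := by
  simp only [Matrix.trace, Matrix.diag, label, Matrix.of_apply, and_self]
  rw [Finset.sum_comm]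
  refine Eq.trans ?_ ((Equiv.sumArrowEquivProdArrow X S Bool).symm.sum_comp fun a => τ a a)
  refine Eq.trans ?_ (Finset.sum_comm.trans (Fintype.sum_prod_type _).symm)
  refine Finset.sum_congr rfl fun s _ => ?_
  refine (Equiv.sum_comp (M := ℂ) (Equiv.sumArrowEquivProdArrow X Y Bool).symm _).symm.trans ?_
  rw [Fintype.sum_prod_type]
  refine Finset.sum_congr rfl fun x _ => ?_
  rw [Finset.sum_eq_single (F s)]
  · exact if_pos rfl
  · intro y _ hy
    exact if_neg hy
  · simp

theorem prob_true_label [Fintype X] [Fintype Y] (F : (S → Bool) → Y → Bool) (τ : DM (X ⊕ S)) :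
    prob (fun _ => True) (label F τ) = prob (fun _ => True) τ := by
  rw [prob_true, prob_true, trace_label]

theorem label_eq_add (F : (S → Bool) → Y → Bool) (P : (S → Bool) → Prop) (τ : DM (X ⊕ S)) :
    label F τ = label F (restrict (fun a => P fun i => a (.inr i)) τ) +
      label F (restrict (fun a => ¬ P fun i => a (.inr i)) τ) := by
  ext a b
  rw [Matrix.add_apply]
  simp only [label, restrict, Matrix.of_apply, Sum.elim_inr, and_self]
  rw [← Finset.sum_add_distrib]
  refine Finset.sum_congr rfl fun s _ => ?_
  by_cases hP : P s <;> simp [hP]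

theorem label_restrict_congr {F F' : (S → Bool) → Y → Bool} {P : (S → Bool) → Prop}
    (h : ∀ s, P s → F s = F' s) (τ : DM (X ⊕ S)) :
    label F (restrict (fun a => P fun i => a (.inr i)) τ) =
      label F' (restrict (fun a => P fun i => a (.inr i)) τ) := by
  ext a b
  simp only [label, restrict, Matrix.of_apply, Sum.elim_inr, and_self]
  refine Finset.sum_congr rfl fun s _ => ?_
  by_cases hP : P s
  · rw [h s hP]
  · simp [hP]

end labels

section distinguisher

variable {W Z : Type}

/-- The product state of a state and an advice state. -/
noncomputable def tensor (σ : DM W) (adv : DM Z) : DM (W ⊕ Z) :=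
  Matrix.of fun a b => σ (fun i => a (.inl i)) (fun i => b (.inl i)) *
    adv (fun i => a (.inr i)) (fun i => b (.inr i))

theorem tensor_add (σ σ' : DM W) (adv : DM Z) :
    tensor (σ + σ') adv = tensor σ adv + tensor σ' adv := by
  ext a b; simp [tensor, add_mul]

theorem tensor_smul (c : ℂ) (σ : DM W) (adv : DM Z) :
    tensor (c • σ) adv = c • tensor σ adv := by
  ext a b; simp [tensor, mul_assoc]

theorem tensor_posSemidef [Fintype W] [Fintype Z] {σ : DM W} {adv : DM Z} (hσ : σ.PosSemidef)
    (hadv : adv.PosSemidef) : (tensor σ adv).PosSemidef :=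
  (hσ.kronecker hadv).submatrix fun a : W ⊕ Z → Bool => (fun i => a (.inl i), fun i => a (.inr i))

theorem trace_tensor {_i : Fintype (W ⊕ Z → Bool)} {_j : Fintype (W → Bool)} {_k : Fintype (Z → Bool)}
    (σ : DM W) (adv : DM Z) : (tensor σ adv).trace = σ.trace * adv.trace := by
  simp only [Matrix.trace, Matrix.diag, tensor, Matrix.of_apply]
  refine ((Equiv.sumArrowEquivProdArrow W Z Bool).symm.sum_comp _).symm.trans ?_
  rw [Fintype.sum_prod_type,
    Finset.sum_mul_sum]
  rfl

/-- The probability that a distinguisher with an advice state outputs `0`. -/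
noncomputable def outputProb [Fintype W] {k : ℕ} (D : Circuit (W ⊕ Fin (k + 1))) (adv : DM (Fin (k + 1)))
    (σ : DM W) : ℝ :=
  prob (fun a => a (.inr 0) = false) (D.run (tensor σ adv))

variable [Fintype W] {k : ℕ} (D : Circuit (W ⊕ Fin (k + 1))) {adv : DM (Fin (k + 1))}

theorem outputProb_add (σ σ' : DM W) :
    outputProb D adv (σ + σ') = outputProb D adv σ + outputProb D adv σ' := by
  rw [outputProb, tensor_add, Circuit.run_add, prob_add]; rfl

theorem outputProb_smul (c : ℝ) (σ : DM W) :
    outputProb D adv ((c : ℂ) • σ) = c * outputProb D adv σ := by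
  rw [outputProb, tensor_smul, Circuit.run_smul, prob_smul]; rfl

theorem outputProb_sum {ι : Type*} (s : Finset ι) (σ : ι → DM W) :
    outputProb D adv (∑ i ∈ s, σ i) = ∑ i ∈ s, outputProb D adv (σ i) := by
  induction s using Finset.induction_on with
  | empty =>
    have h := outputProb_smul D (adv := adv) 0 0
    rw [smul_zero, zero_mul] at h
    simpa using h
  | insert i s hi ih => rw [Finset.sum_insert hi, Finset.sum_insert hi, outputProb_add, ih]

theorem outputProb_nonneg (hadv : IsDensity adv) {σ : DM W} (hσ : σ.PosSemidef) :
    0 ≤ outputProb D adv σ :=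
  prob_nonneg _ (Circuit.run_posSemidef _ (tensor_posSemidef hσ hadv.1))

theorem outputProb_le (hadv : IsDensity adv) {σ : DM W} (hσ : σ.PosSemidef) :
    outputProb D adv σ ≤ prob (fun _ => True) σ := by
  refine (prob_le_trace _ (Circuit.run_posSemidef _ (tensor_posSemidef hσ hadv.1))).trans_eq ?_
  rw [Circuit.trace_run, prob_true, trace_tensor, hadv.2, mul_one]

/-- Two classical functions of a measurement outcome are as hard to distinguish as it is unlikely
that their values differ. -/
theorem abs_outputProb_label_sub_le {X S Y : Type} [Fintype X] [Fintype S] [Fintype Y] {k : ℕ}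
    (D : Circuit ((X ⊕ Y) ⊕ Fin (k + 1))) {adv : DM (Fin (k + 1))} (hadv : IsDensity adv)
    (F F' : (S → Bool) → Y → Bool) {τ : DM (X ⊕ S)} (hτ : τ.PosSemidef) :
    |outputProb D adv (label F τ) - outputProb D adv (label F' τ)| ≤
      prob (fun a => F (fun i => a (.inr i)) ≠ F' (fun i => a (.inr i))) τ := by
  rw [label_eq_add F (fun s => F s ≠ F' s), label_eq_add F' (fun s => F s ≠ F' s),
    label_restrict_congr (F := F) (F' := F') (fun s h => not_not.1 h), outputProb_add, outputProb_add,
    add_sub_add_right_eq_sub]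
  have hpos := restrict_posSemidef
    (fun a : X ⊕ S → Bool => F (fun i => a (.inr i)) ≠ F' (fun i => a (.inr i))) hτ
  have h1 := outputProb_nonneg D hadv (label_posSemidef F hpos)
  have h2 := outputProb_nonneg D hadv (label_posSemidef F' hpos)
  have h3 := outputProb_le D hadv (label_posSemidef F hpos)
  have h4 := outputProb_le D hadv (label_posSemidef F' hpos)
  rw [prob_true_label, prob_restrict] at h3 h4
  simp only [true_and] at h3 h4
  rw [abs_sub_le_iff]
  constructor <;> linarith

end distinguisher

/-! ### The ideal functionality with a simulated server -/

theorem sum_eq_sum_of_injective {ι X : Type} {_i : Fintype ι} {_j : Fintype X} (e : ι → X)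
    (he : Function.Injective e) (f : ι → ℂ) (g : X → ℂ) (h : ∀ x, x ∉ Set.range e → g x = 0)
    (h' : ∀ i, f i = g (e i)) : ∑ i, f i = ∑ x, g x :=
  Fintype.sum_of_injective e he f g h h'

/-- Adding qubits to the other party, on which it does not act. -/
theorem Machine.segment_on {I O K K' : Type} (V : Machine I O) (g : K ↪ K')
    (A : ℕ → Circuit (K ⊕ V.Msg)) (l : List (Circuit (V.Msg ⊕ (I ⊕ (O ⊕ V.Work))))) (j : ℕ) :
    (V.segment A l j).on (Function.Embedding.sumMap
      (Function.Embedding.sumMap g (Function.Embedding.refl _)) (Function.Embedding.refl _)) =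
      V.segment (fun i => (A i).on (Function.Embedding.sumMap g (Function.Embedding.refl _))) l j := by
  induction l generalizing j with
  | nil => rfl
  | cons s l ih =>
    rw [segment_cons, segment_cons, Circuit.on_append, Circuit.on_append, ih, Circuit.on_on,
      Circuit.on_on, Circuit.on_on]
    congr 2
    congr 1
    ext (w | w) <;> rfl

theorem reduce_sumMap_inl_refl {X Z Y : Type} [Fintype X] [Fintype Z] [Fintype Y]
    (ρ : DM ((X ⊕ Z) ⊕ Y)) (a a' : X ⊕ Y → Bool) :
    reduce (Function.Embedding.sumMap Function.Embedding.inl (Function.Embedding.refl _)) ρ a a' =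
      ∑ z : Z → Bool, ρ (Sum.elim (Sum.elim (fun i => a (.inl i)) z) fun i => a (.inr i))
        (Sum.elim (Sum.elim (fun i => a' (.inl i)) z) fun i => a' (.inr i)) := by
  let e : (X ⊕ Y) ⊕ Z ≃ (X ⊕ Z) ⊕ Y :=
    { toFun := Sum.elim (Sum.map .inl id) fun z => .inl (.inr z)
      invFun := Sum.elim (Sum.map .inl id) fun y => .inl (.inr y)
      left_inv := by rintro ((x | y) | z) <;> rfl
      right_inv := by rintro ((x | y) | z) <;> rfl }
  rw [reduce_apply_of_equiv _ e (by rintro (x | y) <;> rfl)]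
  have h : ∀ (a : X ⊕ Y → Bool) z, (fun w => Sum.elim a z (e.symm w)) =
      Sum.elim (Sum.elim (fun i => a (.inl i)) z) fun i => a (.inr i) := by
    intro a z
    funext w
    rcases w with (w | w) | w <;> rfl
  simp only [h]

/-- If the output register is a classical function of the other private registers, then discarding
these leaves the output register measured, so the reduced state is given by `label`. -/
theorem reduce_sumMap_refl_middle {X I Y Z : Type} [Fintype X] [Fintype I] [Fintype Y] [Fintype Z]
    {G : (I ⊕ (Y ⊕ Z) → Bool) → Y → Bool} (ρ : DM (X ⊕ (I ⊕ (Y ⊕ Z))))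
    (hG : ∀ s s' : I ⊕ (Y ⊕ Z) → Bool, (∀ i, s (.inl i) = s' (.inl i)) →
      (∀ i, s (.inr (.inr i)) = s' (.inr (.inr i))) → G s = G s')
    (hρ : Supported (fun a => (fun i => a (.inr (.inr (.inl i)))) = G fun i => a (.inr i)) ρ) :
    reduce (Function.Embedding.sumMap (Function.Embedding.refl _)
      (Function.Embedding.inl.trans Function.Embedding.inr)) ρ =
      label (fun s i => s (.inr (.inl i))) ρ := by
  let e : (X ⊕ Y) ⊕ (I ⊕ Z) ≃ X ⊕ (I ⊕ (Y ⊕ Z)) :=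
    { toFun := Sum.elim (Sum.map id fun y => .inr (.inl y))
        (Sum.elim (fun i => .inr (.inl i)) fun z => .inr (.inr (.inr z)))
      invFun := Sum.elim (fun x => .inl (.inl x)) (Sum.elim (fun i => .inr (.inl i))
        (Sum.elim (fun y => .inl (.inr y)) fun z => .inr (.inr z)))
      left_inv := by rintro ((x | y) | (z | z)) <;> rfl
      right_inv := by rintro (x | i | y | z) <;> rfl }
  ext a a'
  rw [reduce_apply_of_equiv _ e (by rintro (x | y) <;> rfl)]
  have h : ∀ (a : X ⊕ Y → Bool) z, (fun w => Sum.elim a z (e.symm w)) =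
      Sum.elim (fun i => a (.inl i)) (Sum.elim (fun i => z (.inl i))
        (Sum.elim (fun i => a (.inr i)) fun i => z (.inr i))) := by
    intro a z
    funext w
    rcases w with w | w | w | w <;> rfl
  simp only [h]
  rw [label, Matrix.of_apply]
  refine sum_eq_sum_of_injective (fun z : I ⊕ Z → Bool => Sum.elim (fun i => z (.inl i))
    (Sum.elim (fun i => a (.inr i)) fun i => z (.inr i))) ?_ _ _ ?_ ?_
  · intro z z' hz
    funext i
    rcases i with i | i
    · exact congr_fun hz (.inl i)
    · exact congr_fun hz (.inr (.inr i))
  · intro s hs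
    refine if_neg ?_
    rintro ⟨h1, -⟩
    refine hs ⟨Sum.elim (fun i => s (.inl i)) fun i => s (.inr (.inr i)), ?_⟩
    funext i
    rcases i with i | i | i
    · rfl
    · exact congr_fun h1 i
    · rfl
  · intro z
    -- off the diagonal of the output register there is nothing by the support of `ρ`
    by_cases haa : (fun i => a' (.inr i)) = fun i => a (.inr i)
    · have hc : (fun i => a (.inr i)) = (fun i => Sum.elim (fun i => z (.inl i))
          (Sum.elim (fun i => a (.inr i)) fun i => z (.inr i)) (.inr (.inl i)) : Y → Bool) := rfl
      refine Eq.trans ?_ (if_pos ⟨hc, haa.trans hc⟩).symm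
      rw [haa]
    · refine Eq.trans ?_ (if_neg ?_).symm
      · by_contra hne
        obtain ⟨h1, h2⟩ := hρ _ _ hne
        refine haa (Eq.trans h2 (Eq.trans (hG _ _ ?_ ?_) h1.symm))
        · intro i; rfl
        · intro i; rfl
      · rintro ⟨-, h2⟩
        exact haa h2

/-- A copy of the negation of a qubit. -/
def BCirc.not : BCirc Unit Unit :=
  BCirc.comp (BCirc.wire (β := Unit ⊕ Unit) fun _ => ()) (BCirc.gate fun a _ => !a)

/-- If the ideal functionality gets the negation of the flag of a simulated server, then its output
is a classical function of the state of that server. -/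
theorem reduce_idealFunctionality {X S : Type} [Fintype X] [Fintype S] {m k : ℕ}
    (s : S ↪ Fin (k + 1)) (hs : ∀ i, s i ≠ 0) (flag : S) (y : Fin m → Bool) (τ : DM (X ⊕ S))
    {z : (X ⊕ Fin (k + 1)) ⊕ (Unit ⊕ Fin m) → Bool} (hz0 : z (.inl (.inr 0)) = false)
    (hz : ∀ i, z (.inr i) = false) (e : Unit ⊕ Unit ↪ (X ⊕ Fin (k + 1)) ⊕ (Unit ⊕ Fin m))
    (he : e (.inl ()) = .inl (.inr (s flag))) (he' : ∀ i, e (.inr i) = .inl (.inr 0)) :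
    reduce (Function.Embedding.sumMap Function.Embedding.inl (Function.Embedding.refl _))
      (idealFunctionality (.inr 0) y ((Gate.classical BCirc.not e).apply
        (place ((Function.Embedding.sumMap (Function.Embedding.refl X) s).trans
          Function.Embedding.inl) τ z))) =
      label (fun t => Sum.elim (fun _ => t flag) fun j => t flag && y j) τ := by
  ext a a'
  rw [reduce_sumMap_inl_refl, label, Matrix.of_apply]
  set η : X ⊕ S ↪ (X ⊕ Fin (k + 1)) ⊕ (Unit ⊕ Fin m) :=
    (Function.Embedding.sumMap (Function.Embedding.refl X) s).trans Function.Embedding.inl with hη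
  -- the basis state before the flag is copied and the output is written
  set B : (X ⊕ (Unit ⊕ Fin m) → Bool) → (Fin (k + 1) → Bool) →
      (X ⊕ Fin (k + 1)) ⊕ (Unit ⊕ Fin m) → Bool := fun a t =>
    Sum.elim (Sum.elim (fun i => a (.inl i)) fun i => xor (t i) (if i = 0 then !t (s flag) else false))
      (Sum.elim (fun _ => xor (a (.inr (.inl ()))) (!t 0))
        fun j => xor (a (.inr (.inr j))) (!t 0 && y j)) with hB
  set Y : (S → Bool) → Fin (k + 1) → Bool := fun t i =>
    if i = 0 then !t flag else Function.extend s t (fun i => z (.inl (.inr i))) i with hY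
  have hYs : ∀ t i, Y t (s i) = t i := by
    intro t i
    rw [hY]
    exact (if_neg (hs i)).trans (s.injective.extend_apply _ _ _)
  have hx : ∀ (a : X ⊕ (Unit ⊕ Fin m) → Bool) t,
      xorEval BCirc.not e (Sum.elim (Sum.elim (fun i => a (.inl i)) t)
        (Sum.elim (fun _ => xor (a (.inr (.inl ()))) (!t 0))
          fun j => xor (a (.inr (.inr j))) (!t 0 && y j))) = B a t := by
    intro a t
    funext w
    by_cases hw : w = .inl (.inr 0)
    · subst hw
      rw [← he' (), xorEval_inr, he']
      simp [hB, BCirc.eval, BCirc.not, he]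
    · rw [xorEval_of_notMem _ _ _ _ (by intro i; rw [he']; exact Ne.symm hw)]
      rcases w with (w | w) | w | w
      · rfl
      · have : w ≠ 0 := fun h => hw (by rw [h])
        simp [hB, this]
      · rfl
      · rfl
  have hterm : ∀ t, idealFunctionality (.inr 0) y ((Gate.classical BCirc.not e).apply (place η τ z))
      (Sum.elim (Sum.elim (fun i => a (.inl i)) t) fun i => a (.inr i))
      (Sum.elim (Sum.elim (fun i => a' (.inl i)) t) fun i => a' (.inr i)) =
      place η τ z (B a t) (B a' t) := by
    intro t
    rw [← hx a t, ← hx a' t]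
    exact if_pos rfl
  rw [Finset.sum_congr rfl fun t _ => hterm t]
  symm
  have hoff : ∀ i : Unit ⊕ Fin m, (.inr i : (X ⊕ Fin (k + 1)) ⊕ (Unit ⊕ Fin m)) ∉ Set.range η := by
    rintro i ⟨w, hw⟩
    exact Sum.inl_ne_inr hw
  have hoff0 : (.inl (.inr 0) : (X ⊕ Fin (k + 1)) ⊕ (Unit ⊕ Fin m)) ∉ Set.range η := by
    rintro ⟨w | w, hw⟩
    · exact Sum.inl_ne_inr (Sum.inl_injective hw)
    · exact hs w (Sum.inr_injective (Sum.inl_injective hw))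
  refine sum_eq_sum_of_injective Y ?_ _ _ ?_ ?_
  · intro t t' h
    funext i
    rw [← hYs t, h, hYs]
  · intro t ht
    refine if_neg fun hcond => ht ⟨fun i => t (s i), ?_⟩
    funext i
    rw [hY]
    by_cases hi : i = 0
    · have h1 := (hcond _ hoff0).1
      rw [hz0] at h1
      simp only [hB, Sum.elim_inl, Sum.elim_inr, if_true] at h1
      simp only [hi, if_true]
      revert h1
      cases t 0 <;> cases t (s flag) <;> decide
    · refine (if_neg hi).trans ?_
      by_cases hr : ∃ j, s j = i
      · obtain ⟨j, rfl⟩ := hr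
        exact s.injective.extend_apply _ _ _
      · rw [Function.extend_apply' _ _ _ hr]
        have h1 := (hcond (.inl (.inr i)) (by
          rintro ⟨w | w, hw⟩
          · exact Sum.inl_ne_inr (Sum.inl_injective hw)
          · exact hr ⟨w, Sum.inr_injective (Sum.inl_injective hw)⟩)).1
        rw [← h1]
        simp [hB, hi]
  · intro t
    have hY0 : Y t 0 = !t flag := if_pos rfl
    have hO : ∀ a : X ⊕ (Unit ⊕ Fin m) → Bool, (∀ i, B a (Y t) (.inr i) = z (.inr i)) ↔
        (fun i => a (.inr i)) = Sum.elim (fun _ => t flag) fun j => t flag && y j := by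
      intro a
      simp only [hz, Sum.forall, funext_iff, hB, hY0, Sum.elim_inl, Sum.elim_inr, Bool.not_not]
      refine and_congr (forall_congr' fun i => ?_) (forall_congr' fun i => ?_)
      · cases a (.inr (.inl ())) <;> cases t flag <;> simp
      · cases a (.inr (.inr i)) <;> cases t flag <;> cases y i <;> simp
    have hrest : ∀ a : X ⊕ (Unit ⊕ Fin m) → Bool, ∀ w, w ∉ Set.range η →
        (∀ i, B a (Y t) (.inr i) = z (.inr i)) → B a (Y t) w = z w := by
      intro a w hw h
      rcases w with (w | w) | w
      · exact absurd ⟨.inl w, rfl⟩ hw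
      · by_cases hw0 : w = 0
        · subst hw0
          rw [hz0]
          simp [hB, hY0, hYs]
        · have hr : ¬ ∃ j, s j = w := by
            rintro ⟨j, rfl⟩
            exact hw ⟨.inr j, rfl⟩
          have : Y t w = z (.inl (.inr w)) := (if_neg hw0).trans (Function.extend_apply' _ _ _ hr)
          simp [hB, hw0, this]
      · exact h w
    have hval : ∀ a : X ⊕ (Unit ⊕ Fin m) → Bool, (fun v => B a (Y t) (η v)) =
        Sum.elim (fun i => a (.inl i)) t := by
      intro a
      funext v
      rcases v with v | v
      · rfl
      · have : B a (Y t) (η (.inr v)) = xor (Y t (s v)) (if s v = 0 then !Y t (s flag) else false) :=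
          rfl
        rw [this, if_neg (hs v), hYs, Bool.xor_false, Sum.elim_inr]
    have hiff : ((fun i => a (.inr i)) = Sum.elim (fun _ => t flag) (fun j => t flag && y j) ∧
        (fun i => a' (.inr i)) = Sum.elim (fun _ => t flag) (fun j => t flag && y j)) ↔
        ∀ w, w ∉ Set.range η → B a (Y t) w = z w ∧ B a' (Y t) w = z w := by
      rw [← hO a, ← hO a']
      constructor
      · rintro ⟨h1, h2⟩ w hw
        exact ⟨hrest a w hw h1, hrest a' w hw h2⟩
      · intro h
        exact ⟨fun i => (h _ (hoff i)).1, fun i => (h _ (hoff i)).2⟩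
    rw [place, Matrix.of_apply, hval, hval]
    by_cases hc : ∀ w, w ∉ Set.range η → B a (Y t) w = z w ∧ B a' (Y t) w = z w
    · exact (if_pos (hiff.2 hc)).trans (if_pos hc).symm
    · exact (if_neg fun h => hc (hiff.1 h)).trans (if_neg hc).symm

/-! ### The simulator -/

section simulation

variable {Com : CommitFamily} {π : ServerProtocol Com} (A : MaliciousClient π) (κ : ℕ) (p : Params)

/-- The private qubits of the server. -/
abbrev ServerReg (π : ServerProtocol Com) (κ : ℕ) (p : Params) : Type :=
  PubReg Com κ p ⊕ (ServerOut p ⊕ (π κ p).Work)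

/-- The place of the simulated server among the qubits of the simulator; qubit `0` is left for the
bit that goes to the ideal functionality. -/
noncomputable def simulatedServer (π : ServerProtocol Com) (κ : ℕ) (p : Params) :
    ServerReg π κ p ↪ Fin (Fintype.card (ServerReg π κ p) + 1) :=
  (Fintype.equivFin _).toEmbedding.trans (Fin.succEmb _)

theorem simulatedServer_ne_zero (i : ServerReg π κ p) : simulatedServer π κ p i ≠ 0 :=
  Fin.succ_ne_zero _

/-- The client's side during the simulation. -/
abbrev SimReg : Type :=
  ((ClientReg Com κ p ⊕ Fin (A.c κ p)) ⊕ (π κ p).Msg) ⊕ Fin (Fintype.card (ServerReg π κ p) + 1)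

/-- Where the client's public inputs are copied to. -/
noncomputable def copyPlace : PubReg Com κ p ⊕ PubReg Com κ p ↪ SimReg A κ p where
  toFun := Sum.elim (fun i => .inl (.inl (.inl (.inr i)))) fun i => .inr (simulatedServer π κ p (.inl i))
  inj' := by
    rintro (i | i) (j | j) h
    · exact congr_arg _ (Sum.inr_injective (Sum.inl_injective (Sum.inl_injective
        (Sum.inl_injective h))))
    · exact absurd h Sum.inl_ne_inr
    · exact absurd h.symm Sum.inl_ne_inr
    · exact congr_arg _ (Sum.inl_injective ((simulatedServer π κ p).injective (Sum.inr_injective h)))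

/-- The simulated server's flag, and the bit for the ideal functionality. -/
noncomputable def flagPlace : Unit ⊕ Unit ↪ SimReg A κ p where
  toFun := Sum.elim (fun _ => .inr (simulatedServer π κ p (.inr (.inl (.inl ()))))) fun _ => .inr 0
  inj' := by
    rintro (i | i) (j | j) h
    · rfl
    · exact absurd (Sum.inr_injective h) (simulatedServer_ne_zero κ p _)
    · exact absurd (Sum.inr_injective h).symm (simulatedServer_ne_zero κ p _)
    · rfl

/-- The simulated execution among the qubits of the simulator. -/
noncomputable def simulatedExecution :
    (π κ p).Joint (ClientReg Com κ p ⊕ Fin (A.c κ p)) ↪ SimReg A κ p :=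
  Function.Embedding.sumMap (Function.Embedding.refl _) (simulatedServer π κ p)

/-- The simulator runs the protocol with an honest server of its own, which knows the public inputs,
and tells the ideal functionality whether this server accepts. All of this happens before the ideal
functionality is called; nothing is done afterwards. -/
noncomputable def simulator : ClientSimulator A where
  k κ p := Fintype.card (ServerReg π κ p)
  sim₀ κ p := Gate.classical (BCirc.wire id) (copyPlace A κ p) ::
    (((π κ p).interact (A.act κ p)).on (simulatedExecution A κ p) ++
      [Gate.classical BCirc.not (flagPlace A κ p)])
  sim₁ _ _ := []

variable (e : ℕ) (x : Fin p.n → Bool) (r : Fin (p.n * κ) → Bool) (pp : Fin (3 * p.n * κ) → Bool)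
  (ρ₀ : DM (Fin (A.c κ p) ⊕ Fin e))

/-- The initial state of a real execution. -/
noncomputable def initialState : DM (OutsideReg A κ p e ⊕ ServerReg π κ p) :=
  place ((initPart A κ p e).trans Function.Embedding.inl) ρ₀
    (Sum.elim (outsideInput A κ p e x r pp) (Sum.elim (pubInput Com κ p x r pp) fun _ => false))

/-- The state of all qubits at the end of a real execution. -/
noncomputable def finalState : DM (OutsideReg A κ p e ⊕ ServerReg π κ p) :=
  ((π κ p).interact fun i => (A.act κ p i).on (clientPart A κ p e)).run
    (initialState A κ p e x r pp ρ₀)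

theorem finalState_posSemidef {ρ₀ : DM (Fin (A.c κ p) ⊕ Fin e)} (h : IsDensity ρ₀) :
    (finalState A κ p e x r pp ρ₀).PosSemidef :=
  Circuit.run_posSemidef _ (place_posSemidef _ h.1 _)

theorem trace_initialState {_i : Fintype (OutsideReg A κ p e ⊕ ServerReg π κ p → Bool)}
    {ρ₀ : DM (Fin (A.c κ p) ⊕ Fin e)} (h : IsDensity ρ₀) :
    (initialState A κ p e x r pp ρ₀).trace = 1 :=
  (Matrix.trace_eq_trace_of_fintype _ _ _).trans (h.place
    ((initPart A κ p e).trans (Function.Embedding.inl : _ ↪ _ ⊕ ServerReg π κ p)) _).2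

/-- The result of the ideal world is a function of the simulated server's final state. -/
theorem idealState_simulator : idealState (simulator A) κ p e x r pp ρ₀ =
    label (fun t => Sum.elim (fun _ => t (.inr (.inl (.inl ()))))
        fun j => t (.inr (.inl (.inl ()))) && p.f.eval x j)
      (finalState A κ p e x r pp ρ₀) := by
  set s := simulatedServer π κ p with hs
  let side : SimReg A κ p ↪
      (OutsideReg A κ p e ⊕ Fin (Fintype.card (ServerReg π κ p) + 1)) ⊕ ServerOut p :=
    (Function.Embedding.sumMap (clientPart A κ p e) (Function.Embedding.refl _)).trans
      Function.Embedding.inl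
  let η : OutsideReg A κ p e ⊕ ServerReg π κ p ↪
      (OutsideReg A κ p e ⊕ Fin (Fintype.card (ServerReg π κ p) + 1)) ⊕ ServerOut p :=
    (Function.Embedding.sumMap (Function.Embedding.refl _) s).trans Function.Embedding.inl
  let z₀ : (OutsideReg A κ p e ⊕ Fin (Fintype.card (ServerReg π κ p) + 1)) ⊕ ServerOut p → Bool :=
    Sum.elim (Sum.elim (outsideInput A κ p e x r pp) fun _ => false) fun _ => false
  let init : (Fin (A.c κ p) ⊕ Fin e) ↪
      (OutsideReg A κ p e ⊕ Fin (Fintype.card (ServerReg π κ p) + 1)) ⊕ ServerOut p :=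
    (initPart A κ p e).trans (Function.Embedding.inl.trans Function.Embedding.inl)
  let ec := (copyPlace A κ p).trans side
  let z₁ := xorEval (BCirc.wire id) ec z₀
  have hec : ∀ i, ec (.inr i) = .inl (.inr (s (.inl i))) := fun i => rfl
  have hz₁ : ∀ w, (∀ i, w ≠ .inl (.inr (s (.inl i)))) → z₁ w = z₀ w := by
    intro w hw
    exact xorEval_of_notMem _ _ _ _ fun i => by rw [hec]; exact (hw i).symm
  -- copying the public inputs
  have hcopy : (Gate.classical (BCirc.wire id) ec).apply (place init ρ₀ z₀) = place init ρ₀ z₁ := by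
    refine classical_apply_place init ρ₀ z₀ _ ec ?_
    rintro (i | i) ⟨j | j, hj⟩
    · exact Sum.inl_ne_inr (Sum.inl_injective (Sum.inl_injective (Sum.inl_injective
        (Sum.inl_injective hj)))).symm
    · exact Sum.inl_ne_inr (Sum.inl_injective (Sum.inl_injective (Sum.inl_injective hj))).symm
    · exact Sum.inl_ne_inr (Sum.inl_injective hj)
    · exact Sum.inl_ne_inr (Sum.inl_injective hj)
  have hplace : place init ρ₀ z₁ = place η (initialState A κ p e x r pp ρ₀) z₁ := by
    have h1 : init = ((initPart A κ p e).trans Function.Embedding.inl).trans η := by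
      ext w; rfl
    rw [h1, place_trans, initialState]
    congr 1
    refine congr_arg (place _ ρ₀) (funext fun v => ?_)
    rcases v with v | v | v
    · exact hz₁ _ fun i h => Sum.inl_ne_inr (Sum.inl_injective h)
    · have h2 : z₁ (ec (.inr v)) = _ := xorEval_inr (BCirc.wire id) ec z₀ v
      refine Eq.trans h2 ?_
      exact Bool.false_xor _
    · refine hz₁ _ fun i h => ?_
      exact Sum.inr_ne_inl (s.injective (Sum.inr_injective (Sum.inl_injective h)))
  have hrun : ((((π κ p).interact (A.act κ p)).on (simulatedExecution A κ p)).on side) =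
      Circuit.on η ((π κ p).interact fun i => (A.act κ p i).on (clientPart A κ p e)) := by
    have h1 := (π κ p).segment_on (Function.Embedding.inl : _ ↪ _ ⊕ Fin e) (A.act κ p) (π κ p).steps 0
    rw [← Machine.interact_eq_segment] at h1
    have h2 : (π κ p).interact (fun i => (A.act κ p i).on (clientPart A κ p e)) = _ := h1.symm
    rw [h2, Circuit.on_on, Circuit.on_on]
    congr 1
    ext (w | w) <;> rfl
  have hmain : Circuit.run (((simulator A).sim₀ κ p).on side) (place init ρ₀ z₀) =
      (Gate.classical BCirc.not ((flagPlace A κ p).trans side)).apply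
        (place η (finalState A κ p e x r pp ρ₀) z₁) := by
    have h1 : ((simulator A).sim₀ κ p).on side = Gate.classical (BCirc.wire id) ec ::
        (Circuit.on η ((π κ p).interact fun i => (A.act κ p i).on (clientPart A κ p e)) ++
          [Gate.classical BCirc.not ((flagPlace A κ p).trans side)]) := by
      rw [← hrun]
      exact congr_arg (List.cons _) (Circuit.on_append _ _ _)
    rw [h1, Circuit.run_cons, hcopy, hplace, Circuit.run_append, run_on_place, Circuit.run_cons,
      Circuit.run_nil]
    rfl
  change reduce (Function.Embedding.sumMap Function.Embedding.inl (Function.Embedding.refl _))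
    (idealFunctionality (.inr 0) (p.f.eval x)
      (Circuit.run (((simulator A).sim₀ κ p).on side) (place init ρ₀ z₀))) = _
  rw [hmain]
  refine reduce_idealFunctionality s (simulatedServer_ne_zero κ p) (.inr (.inl (.inl ())))
    (p.f.eval x) _ ?_ ?_ _ rfl fun _ => rfl
  · refine hz₁ _ fun i h => ?_
    exact simulatedServer_ne_zero κ p _ (Sum.inr_injective (Sum.inl_injective h)).symm
  · intro i
    exact hz₁ _ fun j h => Sum.inr_ne_inl h

end simulation

namespace Ingredients

variable {G : Ingredients} (A : MaliciousClient (SFVP2 G)) (κ : ℕ) (p : Params)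
  (e : ℕ) (x : Fin p.n → Bool) (r : Fin (p.n * κ) → Bool) (pp : Fin (3 * p.n * κ) → Bool)
  (ρ₀ : DM (Fin (A.c κ p) ⊕ Fin e))

theorem supported_initialState : Supported (fun a =>
    Initial G κ p (pubInput G.Com κ p x r pp) fun w => a (serverPart G κ p _ w))
    (initialState A κ p e x r pp ρ₀) := by
  refine (supported_place _ _ _).mono fun a ha => ?_
  have h : ∀ w, a (.inr w) = Sum.elim (pubInput G.Com κ p x r pp) (fun _ => false) w := fun w =>
    ha (.inr w) (by rintro ⟨v, hv⟩; exact Sum.inl_ne_inr hv)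
  exact ⟨fun i => h (.inl i), ⟨h (.inr _), fun i => h (.inr _)⟩, fun i => h (.inr _),
    fun i => h (.inr _), fun i => h (.inr _)⟩

theorem supported_finalState : Supported (fun a =>
    OutputCorrect G κ p fun w => a (serverPart G κ p _ w))
    (finalState A κ p e x r pp ρ₀) :=
  supported_final (withEnv G κ p (Fin e) (A.act κ p))
    (supported_initialState A κ p e x r pp ρ₀)

/-- The result of the real world is a function of the server's final state: nothing is lost by
measuring the output, which the server could compute again from what it has recorded. -/
theorem realState_eq_label : realState (SFVP2 G) A κ p e x r pp ρ₀ =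
    label (fun t i => t (.inr (.inl i))) (finalState A κ p e x r pp ρ₀) := by
  let acc : ServerReg (SFVP2 G) κ p := .inr (.inr (.inr (.inr (.inr (Fin.last (rounds G p))))))
  let y : Fin p.m → ServerReg (SFVP2 G) κ p := fun i => .inr (.inr (.inl (.inr i)))
  refine reduce_sumMap_refl_middle (G := fun s => Sum.elim (fun _ => s acc)
    fun i => s acc && s (y i)) _ ?_ ?_
  · intro s s' _ h
    have h1 : s acc = s' acc := h _
    have h2 : ∀ i, s (y i) = s' (y i) := fun i => h _
    simp only [h1, h2]
  · refine (supported_finalState A κ p e x r pp ρ₀).mono ?_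
    rintro a ⟨h1, h2⟩
    funext i
    rcases i with i | i
    · exact h1
    · exact h2 i

/-- The real and the ideal world differ only if all rounds pass although the server's outcome is
not `f(x)`. -/
theorem abs_outputProb_sub_le {ρ₀ : DM (Fin (A.c κ p) ⊕ Fin e)} (hρ₀ : IsDensity ρ₀) {k : ℕ}
    (D : Circuit (FinalReg A κ p e ⊕ Fin (k + 1))) {adv : DM (Fin (k + 1))} (hadv : IsDensity adv) :
    |outputProb D adv (realState (SFVP2 G) A κ p e x r pp ρ₀) -
      outputProb D adv (idealState (simulator A) κ p e x r pp ρ₀)| ≤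
      prob (fun a => a (serverPart G κ p _ (qAcc G κ p (Fin.last _))) = true ∧
          (fun i => a (serverPart G κ p _ (qY G κ p i))) ≠ p.f.eval x)
        ((execution G κ p (withEnv G κ p (Fin e) (A.act κ p))).run
          (initialState A κ p e x r pp ρ₀)) := by
  rw [realState_eq_label, idealState_simulator]
  have hpos := finalState_posSemidef A κ p e x r pp hρ₀
  refine (abs_outputProb_label_sub_le D hadv _ _ hpos).trans ?_
  refine prob_mono_of_supported hpos (supported_finalState A κ p e x r pp ρ₀) ?_
  rintro a ⟨h1, h2⟩ h3
  by_contra hcon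
  refine h3 (funext fun i => ?_)
  rcases i with i | i
  · rfl
  · refine (h2 i).trans ?_
    have h1' : a (.inr (.inr (.inl (.inl ())))) =
      a (serverPart G κ p _ (qAcc G κ p (Fin.last _))) := h1
    change (a (serverPart G κ p _ (qAcc G κ p (Fin.last _))) &&
      a (serverPart G κ p _ (qY G κ p i))) = (a (.inr (.inr (.inl (.inl ())))) && p.f.eval x i)
    rw [h1']
    by_cases hacc : a (serverPart G κ p _ (qAcc G κ p (Fin.last _))) = true
    · have h4 : (fun i => a (serverPart G κ p _ (qY G κ p i))) = p.f.eval x := by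
        by_contra hne
        exact hcon ⟨hacc, hne⟩
      rw [show a (serverPart G κ p _ (qY G κ p i)) = p.f.eval x i from congr_fun h4 i]
    · rw [Bool.eq_false_iff.2 hacc, Bool.false_and, Bool.false_and]

end Ingredients

/-! ### Sizes -/

theorem Polynomial.eval_nat_mono (q : Polynomial ℕ) : Monotone fun k => q.eval k := by
  intro a b hab
  simp only [Polynomial.eval_eq_sum]
  exact Finset.sum_le_sum fun i _ => Nat.mul_le_mul_left _ (Nat.pow_le_pow_left hab i)

/-- Polynomially bounded in the security parameter and the size of the public parameters. -/
def PolySize (F : ℕ → Params → ℕ) : Prop :=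
  ∃ q : Polynomial ℕ, ∀ κ p, F κ p ≤ q.eval (κ + p.size)

namespace PolySize

variable {F F' : ℕ → Params → ℕ}

theorem mono (h : PolySize F') (hle : ∀ κ p, F κ p ≤ F' κ p) : PolySize F := by
  obtain ⟨q, hq⟩ := h
  exact ⟨q, fun κ p => (hle κ p).trans (hq κ p)⟩

theorem add (h : PolySize F) (h' : PolySize F') : PolySize fun κ p => F κ p + F' κ p := by
  obtain ⟨q, hq⟩ := h
  obtain ⟨q', hq'⟩ := h'
  exact ⟨q + q', fun κ p => by rw [Polynomial.eval_add]; exact Nat.add_le_add (hq κ p) (hq' κ p)⟩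

theorem mul (h : PolySize F) (h' : PolySize F') : PolySize fun κ p => F κ p * F' κ p := by
  obtain ⟨q, hq⟩ := h
  obtain ⟨q', hq'⟩ := h'
  exact ⟨q * q', fun κ p => by rw [Polynomial.eval_mul]; exact Nat.mul_le_mul (hq κ p) (hq' κ p)⟩

theorem const (c : ℕ) : PolySize fun _ _ => c := ⟨Polynomial.C c, fun κ p => by simp⟩

theorem comp (h : PolySize F') (q : Polynomial ℕ) (hle : ∀ κ p, F κ p ≤ q.eval (F' κ p)) :
    PolySize F := by
  obtain ⟨q', hq'⟩ := h
  refine ⟨q.comp q', fun κ p => (hle κ p).trans ?_⟩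
  rw [Polynomial.eval_comp]
  exact q.eval_nat_mono (hq' κ p)

theorem secParam : PolySize fun κ _ => κ := ⟨Polynomial.X, fun κ p => by simp⟩

theorem paramSize : PolySize fun _ p => p.size := ⟨Polynomial.X, fun κ p => by simp⟩

theorem n : PolySize fun _ p => p.n := paramSize.mono fun κ p => by unfold Params.size; omega

theorem m : PolySize fun _ p => p.m := paramSize.mono fun κ p => by unfold Params.size; omega

theorem invε : PolySize fun _ p => p.invε := paramSize.mono fun κ p => by unfold Params.size; omega

theorem fSize : PolySize fun _ p => p.f.size := paramSize.mono fun κ p => by unfold Params.size; omega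

theorem polyBounded (h : PolySize F) {p : ℕ → Params} (hp : PolyBounded fun κ => (p κ).size) :
    PolyBounded fun κ => F κ (p κ) := by
  obtain ⟨q, hq⟩ := h
  obtain ⟨q', hq'⟩ := hp
  refine ⟨q.comp (Polynomial.X + q'), fun κ => (hq κ _).trans ?_⟩
  rw [Polynomial.eval_comp, Polynomial.eval_add, Polynomial.eval_X]
  exact q.eval_nat_mono (Nat.add_le_add_left (hq' κ) _)

end PolySize

theorem BCirc.size_eqTest (k : ℕ) : (eqTest k).size = k ^ 2 + 3 * k + 1 := by
  induction k with
  | zero => rfl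
  | succ k ih =>
    simp only [eqTest, size, ih, Fintype.card_sum, Fintype.card_unit, Fintype.card_fin]
    ring

theorem Machine.size_eq {I O : Type} (V : Machine I O) : V.size = Fintype.card V.Msg +
    Fintype.card V.Work + V.steps.length + (V.steps.map Circuit.size).sum := rfl

theorem Machine.size_segment {I O K : Type} (V : Machine I O) (A : ℕ → Circuit (K ⊕ V.Msg))
    (l : List (Circuit (V.Msg ⊕ (I ⊕ (O ⊕ V.Work))))) (j : ℕ) :
    (V.segment A l j).size =
      ∑ i ∈ Finset.range l.length, (A (j + i)).size + (l.map Circuit.size).sum := by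
  induction l generalizing j with
  | nil => rfl
  | cons s l ih =>
    rw [segment_cons, Circuit.size_append, Circuit.size_append, Circuit.size_on, Circuit.size_on,
      ih, List.length_cons, Finset.sum_range_succ', List.map_cons, List.sum_cons]
    simp only [add_zero, add_assoc, add_comm 1, add_left_comm]

namespace Ingredients

variable (G : Ingredients)

theorem polySize_hash (hHash : G.Hash.Efficient) : PolySize fun κ p =>
    G.Hash.coins p.m κ + (G.Hash.gen p.m κ).size + (G.Hash.ev p.m κ).size := by
  obtain ⟨q, hq⟩ := hHash.1
  exact (PolySize.m.add .secParam).comp q fun κ p => hq _ _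

theorem polySize_desc (hHash : G.Hash.Efficient) : PolySize fun κ p => G.Hash.desc p.m κ := by
  obtain ⟨q, hq⟩ := hHash.2
  exact PolySize.secParam.comp q fun κ p => hq _ _

theorem polySize_commit (hCom : G.Com.Efficient) : PolySize fun κ p =>
    G.Com.len p.n κ + (G.Com.circ p.n κ).size := by
  obtain ⟨q, hq⟩ := hCom
  exact (PolySize.n.add .secParam).comp q fun κ p => hq _ _

theorem polySize_rounds : PolySize fun _ p => rounds G p := by
  refine ((PolySize.const ⌈64 * |G.c|⌉₊).mul (PolySize.invε.mul (PolySize.invε.mul .invε))).mono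
    fun κ p => ?_
  rw [rounds, Nat.ceil_le]
  have h0 : (0 : ℝ) < p.invε := Nat.cast_pos.2 p.invε_pos
  have h1 : 16 / (p.ε ^ 2 * (p.ε / 4 / G.c)) =
      64 * G.c * ((p.invε : ℝ) * ((p.invε : ℝ) * (p.invε : ℝ))) := by
    rw [Params.ε]
    by_cases hc : G.c = 0
    · simp [hc]
    · field_simp
      norm_num
  rw [h1]
  push_cast
  refine mul_le_mul_of_nonneg_right (le_trans ?_ (Nat.le_ceil _)) (by positivity)
  have := le_abs_self G.c
  linarith

theorem polySize_stmtLen (hCom : G.Com.Efficient) (hHash : G.Hash.Efficient) :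
    PolySize (stmtLen G) :=
  (((G.polySize_desc hHash).add .secParam).add ((((PolySize.const 3).mul .n).mul .secParam).add
    (G.polySize_commit hCom))).mono fun κ p => by unfold stmtLen; omega

theorem polySize_witLen : PolySize witLen := PolySize.n.add (PolySize.n.mul .secParam)

theorem polySize_relation (hCom : G.Com.Efficient) (hHash : G.Hash.Efficient) :
    PolySize fun κ p => (relation G κ p).size := by
  have hd := G.polySize_desc hHash
  have hh := G.polySize_hash hHash
  have hc := G.polySize_commit hCom
  have hs := G.polySize_stmtLen hCom hHash
  have heq : ∀ {F : ℕ → Params → ℕ}, PolySize F →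
      PolySize fun κ p => F κ p * F κ p + 3 * F κ p + 1 := fun h =>
    ((h.mul h).add ((PolySize.const 3).mul h)).add (.const 1)
  refine (((hs.add hd).add ((hs.add polySize_witLen).add (polySize_witLen.add (hd.add .secParam)))).add
    (((PolySize.fSize.add hh).add ((heq .secParam).add (hc.add (heq hc)))).add
      ((hc.add .secParam).add (.const 1)))).mono fun κ p => ?_
  simp only [relation, BCirc.size, BCirc.size_eqTest, Fintype.card_sum, Fintype.card_fin, stmtLen,
    witLen]
  have h1 : G.Com.len p.n κ ^ 2 ≤ (G.Com.len p.n κ + (G.Com.circ p.n κ).size) *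
      (G.Com.len p.n κ + (G.Com.circ p.n κ).size) := by
    rw [← pow_two]
    exact Nat.pow_le_pow_left (Nat.le_add_right _ _) 2
  have h2 : κ ^ 2 = κ * κ := pow_two κ
  have h3 : p.n + p.n * κ = witLen κ p := rfl
  omega

theorem polySize_verifier (hCom : G.Com.Efficient) (hHash : G.Hash.Efficient)
    (hAoK : G.AoK.Efficient) : PolySize fun κ p => (verifier G κ p).size := by
  obtain ⟨q, hq⟩ := hAoK
  exact (((PolySize.secParam.add (G.polySize_stmtLen hCom hHash)).add polySize_witLen).add
    (G.polySize_relation hCom hHash)).comp q fun κ p => hq _ _ _ _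

theorem size_hashStep (κ : ℕ) (p : Params) : (hashStep G κ p).size =
    p.m + 2 * G.Hash.coins p.m κ + ((G.Hash.gen p.m κ).size + (G.Hash.ev p.m κ).size) +
      2 * (G.Hash.desc p.m κ + κ) + 5 := by
  obtain ⟨e₁, e₂, e₃, e₄, -, -, -, -, h⟩ := hashStep_eq G κ p
  rw [h]
  simp only [Circuit.size_append, size_measureAll, size_flipAll, size_resetAll]
  simp only [Circuit.size, List.map_cons, List.map_nil, List.sum_cons, List.sum_nil, Gate.cost,
    BCirc.size, Fintype.card_sum, Fintype.card_fin]
  ring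

theorem size_setupStep (κ : ℕ) (p : Params) : (setupStep G κ p).size =
    2 * stmtLen G κ p + Fintype.card (verifier G κ p).Work + 2 := by
  obtain ⟨e, -, -, -, h⟩ := setupStep_eq G κ p
  rw [h]
  simp only [Circuit.size_append, size_resetAll]
  simp only [Circuit.size, List.map_cons, List.map_nil, List.sum_cons, List.sum_nil, Gate.cost,
    BCirc.size, Fintype.card_sum, Fintype.card_fin, Fintype.card_unit]
  ring

theorem size_recordStep (κ : ℕ) (p : Params) (i : Fin (rounds G p)) :
    (recordStep G κ p i).size = 3 := rfl

theorem size_outputStep (κ : ℕ) (p : Params) : (outputStep G κ p).size = 2 + 2 * p.m := by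
  obtain ⟨e₀, e, -, -, h⟩ := outputStep_eq G κ p
  rw [h]
  simp [Circuit.size, Gate.cost, BCirc.size, Function.comp_def]
  ring

theorem sum_size_rounds (κ : ℕ) (p : Params) (l : List (Fin (rounds G p))) :
    ((l.flatMap (roundSteps G κ p)).map Circuit.size).sum = l.length *
      ((setupStep G κ p).size + ((verifier G κ p).steps.map Circuit.size).sum + 3) := by
  induction l with
  | nil => simp
  | cons i l ih =>
    rw [List.flatMap_cons, List.map_append, List.sum_append, ih, List.length_cons, add_mul, one_mul,
      add_comm]
    congr 1
    simp only [roundSteps, List.map_append, List.map_map, List.sum_append, List.map_cons,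
      List.map_nil, List.sum_cons, List.sum_nil, size_recordStep, Function.comp_def, Circuit.size_on]
    rfl

theorem card_msgReg (κ : ℕ) (p : Params) : Fintype.card (SFVP2 G κ p).Msg =
    Fintype.card (G.SFVP κ p).Msg +
      ((G.Hash.desc p.m κ + κ) + Fintype.card (verifier G κ p).Msg) := by
  change Fintype.card (MsgReg G κ p) = _
  simp only [Fintype.card_sum, Fintype.card_fin]

theorem card_workReg (κ : ℕ) (p : Params) : Fintype.card (SFVP2 G κ p).Work =
    (Fintype.card (G.SFVP κ p).Work + p.m) +
      ((G.Hash.coins p.m κ + (G.Hash.desc p.m κ + κ)) +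
        ((stmtLen G κ p + (1 + Fintype.card (verifier G κ p).Work)) + (rounds G p + 1))) := by
  change Fintype.card (WorkReg G κ p) = _
  simp only [Fintype.card_sum, Fintype.card_fin, Fintype.card_unit]

theorem sum_size_steps (κ : ℕ) (p : Params) : ((SFVP2 G κ p).steps.map Circuit.size).sum =
    ((G.SFVP κ p).steps.map Circuit.size).sum + (hashStep G κ p).size + rounds G p *
      ((setupStep G κ p).size + ((verifier G κ p).steps.map Circuit.size).sum + 3) +
      (outputStep G κ p).size := by
  change ((sfvpSteps G κ p ++ [hashStep G κ p] ++ allRounds G κ p ++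
    [outputStep G κ p]).map Circuit.size).sum = _
  rw [List.map_append, List.map_append, List.map_append, List.sum_append, List.sum_append,
    List.sum_append, allRounds, sum_size_rounds, List.length_finRange]
  simp only [sfvpSteps, List.map_map, Function.comp_def, Circuit.size_on, List.map_cons,
    List.map_nil, List.sum_cons, List.sum_nil, add_zero]

/-- Every register and every step outside the rounds is of polynomial size, and so is a round. -/
theorem polySize_SFVP2 (hCom : G.Com.Efficient) (hHash : G.Hash.Efficient)
    (hAoK : G.AoK.Efficient) (hSFVP : G.SFVP.Efficient) :
    PolySize fun κ p => (SFVP2 G κ p).size := by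
  have hd := G.polySize_desc hHash
  have hh := G.polySize_hash hHash
  have hs := G.polySize_stmtLen hCom hHash
  have hv := G.polySize_verifier hCom hHash hAoK
  have hF : PolySize fun κ p => (G.SFVP κ p).size := hSFVP
  have hr := G.polySize_rounds
  have hround : PolySize fun κ p => rounds G p *
      (2 * stmtLen G κ p + 2 * (verifier G κ p).size + 7) :=
    hr.mul ((((PolySize.const 2).mul hs).add ((PolySize.const 2).mul hv)).add (.const 7))
  -- the constants `10` and `30` are generous
  refine (((((hF.add hv).add (hh.add (hd.add .secParam))).add ((hs.add hr).add PolySize.m)).mul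
    (.const 10)).add (hround.add (.const 30))).mono fun κ p => ?_
  have h1 : rounds G p * ((verifier G κ p).steps.length + 2) +
      rounds G p * ((setupStep G κ p).size + ((verifier G κ p).steps.map Circuit.size).sum + 3) ≤
      rounds G p * (2 * stmtLen G κ p + 2 * (verifier G κ p).size + 7) := by
    rw [← Nat.mul_add, size_setupStep]
    refine Nat.mul_le_mul_left _ ?_
    unfold Machine.size
    omega
  rw [Machine.size, card_msgReg, card_workReg, length_steps, sum_size_steps, size_hashStep,
    size_outputStep]
  have h2 : (sfvpSteps G κ p ++ [hashStep G κ p]).length = (G.SFVP κ p).steps.length + 1 := by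
    simp [sfvpSteps]
  rw [h2]
  have h3 := (G.SFVP κ p).size_eq
  have h4 := (verifier G κ p).size_eq
  omega

/-- The prover's operations are among those of the client. -/
theorem advSize_proverFrom_le {κ : ℕ} {p : Params} {K : Type} {k : ℕ}
    (ψ : (K ⊕ OtherMsg G κ p) ≃ Fin k) (act : ℕ → Circuit (K ⊕ MsgReg G κ p)) {j : ℕ}
    (hj : j + (verifier G κ p).steps.length + 2 ≤ (SFVP2 G κ p).steps.length) :
    (verifier G κ p).advSize (proverFrom G κ p ψ act (j + 1)) ≤ (SFVP2 G κ p).advSize act := by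
  unfold Machine.advSize
  simp only [proverFrom, Circuit.size_on]
  have h := Finset.sum_map (Finset.range (verifier G κ p).steps.length)
    (addLeftEmbedding (j + 1)) fun i => (act i).size
  simp only [addLeftEmbedding_apply] at h
  rw [← h]
  refine Finset.sum_le_sum_of_subset fun i hi => ?_
  simp only [Finset.mem_map, Finset.mem_range, addLeftEmbedding_apply] at hi ⊢
  omega

theorem efficient_simulator (hCom : G.Com.Efficient) (hHash : G.Hash.Efficient)
    (hAoK : G.AoK.Efficient) (hSFVP : G.SFVP.Efficient) {A : MaliciousClient (SFVP2 G)}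
    (hA : A.Efficient) : (simulator A).Efficient := by
  have hA' : PolySize fun κ p => A.c κ p + (SFVP2 G κ p).advSize (A.act κ p) := hA
  have hS := G.polySize_SFVP2 hCom hHash hAoK hSFVP
  have hc := G.polySize_commit hCom
  change PolySize _
  refine (((hA'.add hS).add (((PolySize.const 3).mul .n).mul .secParam)).add
    ((((PolySize.const 3).mul .n).mul .secParam).add
      (((hc.add hc).add hS).add (PolySize.m.add (.const 20))))).mono fun κ p => ?_
  have h1 : ((simulator A).sim₀ κ p).size = (3 * p.n * κ + G.Com.len p.n κ + 1) +
      (((SFVP2 G κ p).advSize (A.act κ p) + ((SFVP2 G κ p).steps.map Circuit.size).sum) + 4) := by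
    have e1 : ((simulator A).sim₀ κ p).size =
        (Gate.classical (BCirc.wire id) (copyPlace A κ p)).cost +
        Circuit.size (((SFVP2 G κ p).interact (A.act κ p)).on (simulatedExecution A κ p) ++
          [Gate.classical BCirc.not (flagPlace A κ p)]) := by
      simp [simulator, Circuit.size]
    rw [e1, Circuit.size_append, Circuit.size_on, Machine.interact_eq_segment,
      Machine.size_segment]
    simp only [Gate.cost, BCirc.size, Fintype.card_sum, Fintype.card_fin, zero_add]
    rfl
  have h2 : (simulator A).k κ p = (3 * p.n * κ + G.Com.len p.n κ) +
      ((1 + p.m) + Fintype.card (SFVP2 G κ p).Work) := by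
    simp [simulator, ServerReg]
  have h3 : ((simulator A).sim₁ κ p).size = 0 := rfl
  rw [h1, h3, h2]
  have h4 := (SFVP2 G κ p).size_eq
  omega

end Ingredients

/-! ### The soundness error -/

/-- The bound on the probability of collisions holds for all first arguments at once. -/
theorem HashFamily.Collapsing.exists_forall_collisionProb_le {H : HashFamily} (hH : H.Collapsing)
    {n : ℕ → ℕ} (hn : PolyBounded n) (y₁ : ∀ κ, Fin (n κ) → Bool) :
    ∃ M : ℕ → ℝ, Negligible M ∧ (∀ κ, 0 ≤ M κ) ∧
      ∀ κ y, y ≠ y₁ κ → H.collisionProb (n κ) κ y (y₁ κ) ≤ M κ := by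
  -- the string that collides with `y₁ κ` most often, if there is another string at all
  have hworst : ∀ κ, ∃ y₀, ∀ y, y ≠ y₁ κ → y₀ ≠ y₁ κ ∧
      H.collisionProb (n κ) κ y (y₁ κ) ≤ H.collisionProb (n κ) κ y₀ (y₁ κ) := by
    intro κ
    by_cases hex : ∃ y, y ≠ y₁ κ
    · obtain ⟨y, hy⟩ := hex
      obtain ⟨y₀, h0, hmax⟩ := Finset.exists_max_image
        (Finset.univ.filter fun y => y ≠ y₁ κ) (fun y => H.collisionProb (n κ) κ y (y₁ κ))
        ⟨y, by simpa using hy⟩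
      exact ⟨y₀, fun y hy => ⟨(Finset.mem_filter.1 h0).2, hmax y (by simpa using hy)⟩⟩
    · exact ⟨y₁ κ, fun y hy => absurd ⟨y, hy⟩ hex⟩
  choose y₀ hy₀ using hworst
  obtain ⟨ν, hν, hle⟩ := hH.exists_collisionProb_le hn y₀ y₁
  refine ⟨fun κ => |ν κ|, Asymptotics.SuperpolynomialDecay.trans_abs_le hν fun κ => ?_,
    fun κ => abs_nonneg _, fun κ y hy => ?_⟩
  · exact (abs_abs _).le
  · obtain ⟨h1, h2⟩ := hy₀ κ y hy
    exact h2.trans ((hle κ h1).trans (le_abs_self _))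

namespace CommitFamily

/-- Commitments under `pp` to different values can be equal. -/
def Ambiguous (Com : CommitFamily) (n κ : ℕ) (pp : Fin (3 * n * κ) → Bool) : Prop :=
  ∃ x₀ r₀ x₁ r₁, Com.commit n κ x₀ r₀ pp = Com.commit n κ x₁ r₁ pp ∧ x₀ ≠ x₁

end CommitFamily

namespace Ingredients

variable (G : Ingredients)

/-- If the commitment determines `x`, then a statement with a wrong hash value has no witness. -/
theorem relation_ne_true {κ : ℕ} {p : Params} {x : Fin p.n → Bool} {r : Fin (p.n * κ) → Bool}
    {pp : Fin (3 * p.n * κ) → Bool} (hpp : ¬ G.Com.Ambiguous p.n κ pp)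
    {v : Fin (G.Hash.desc p.m κ) ⊕ Fin κ → Bool}
    (hv : (G.Hash.ev p.m κ).eval (Sum.elim (fun i => v (.inl i)) (p.f.eval x)) ≠
      fun i => v (.inr i)) (w : Fin (witLen κ p) → Bool) :
    (relation G κ p).eval
      (Sum.elim (stmtString G κ p v (pubInput G.Com κ p x r pp)) w) () ≠ true := by
  intro h
  have h1 : Sum.elim (stmtString G κ p v (pubInput G.Com κ p x r pp)) w =
      Sum.elim (fun i => Sum.elim (Sum.elim (fun i => v (.inl i)) fun i => v (.inr i))
          (Sum.elim pp (G.Com.commit p.n κ x r pp)) ((stmtEquiv G κ p).symm i))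
        (fun i => Sum.elim (fun j => w (witEquiv κ p (.inl j))) (fun j => w (witEquiv κ p (.inr j)))
          ((witEquiv κ p).symm i)) := by
    congr 1
    · funext i
      have h2 : v = Sum.elim (fun i => v (.inl i)) fun i => v (.inr i) := by
        funext j
        rcases j with j | j <;> rfl
      rw [← h2]
      rfl
    · funext i
      obtain ⟨j | j, rfl⟩ := (witEquiv κ p).surjective i
      · rw [Equiv.symm_apply_apply, Sum.elim_inl]
      · rw [Equiv.symm_apply_apply, Sum.elim_inr]
  rw [h1, relation_iff] at h
  have hx : (fun j => w (witEquiv κ p (.inl j))) = x := by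
    by_contra hne
    exact hpp ⟨_, _, _, _, h.2, hne⟩
  rw [hx] at h
  exact hv h.1

/-- The number of rounds is large enough for the total soundness error to be at most `ε`. -/
theorem exp_pow_rounds_le (hc : 0 < G.c) (p : Params) :
    Real.exp (-(1 / (2 * G.c))) ^ rounds G p ≤ p.ε := by
  have h0 : (1 : ℝ) ≤ p.invε := Nat.one_le_cast.2 p.invε_pos
  have hL : 64 * G.c * (p.invε : ℝ) ^ 3 ≤ rounds G p := by
    refine le_trans (le_of_eq ?_) (Nat.le_ceil _)
    rw [Params.ε]
    field_simp
    norm_num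
  have h2 : (p.invε : ℝ) ≤ rounds G p * (1 / (2 * G.c)) := by
    rw [mul_one_div, le_div_iff₀ (by positivity)]
    refine le_trans ?_ hL
    have h3 : (p.invε : ℝ) ≤ (p.invε : ℝ) ^ 3 := le_self_pow₀ h0 (by norm_num)
    have h4 : (p.invε : ℝ) * G.c ≤ (p.invε : ℝ) ^ 3 * G.c := mul_le_mul_of_nonneg_right h3 hc.le
    have h5 : 0 ≤ (p.invε : ℝ) ^ 3 * G.c := by positivity
    linarith
  rw [← Real.exp_nat_mul, mul_neg, Real.exp_neg, Params.ε, one_div (p.invε : ℝ)]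
  refine inv_anti₀ (one_pos.trans_le h0) ?_
  have := Real.add_one_le_exp ((rounds G p : ℝ) * (1 / (2 * G.c)))
  linarith

variable {G}

/-- The size of the prover's private register, when the client is seen as a prover. -/
noncomputable def proverSize (A : MaliciousClient (SFVP2 G)) (κ : ℕ) (p : Params) : ℕ :=
  Fintype.card ((ClientReg G.Com κ p ⊕ Fin (A.c κ p)) ⊕ OtherMsg G κ p)

theorem polySize_proverSize (hCom : G.Com.Efficient) (hHash : G.Hash.Efficient)
    (hSFVP : G.SFVP.Efficient) {A : MaliciousClient (SFVP2 G)} (hA : A.Efficient) :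
    PolySize (proverSize A) := by
  have hA' : PolySize fun κ p => A.c κ p + (SFVP2 G κ p).advSize (A.act κ p) := hA
  have hF : PolySize fun κ p => (G.SFVP κ p).size := hSFVP
  have hw : PolySize witLen := polySize_witLen
  refine ((hw.add (((((PolySize.const 3).mul .n).mul .secParam).add (G.polySize_commit hCom)))).add
    (hA'.add (hF.add ((G.polySize_desc hHash).add .secParam)))).mono fun κ p => ?_
  simp only [proverSize, Fintype.card_sum, Fintype.card_fin]
  have h1 : p.n + p.n * κ = witLen κ p := rfl
  have h2 := (G.SFVP κ p).size_eq
  omega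

section

variable (A : MaliciousClient (SFVP2 G)) (κ : ℕ) (p : Params) (e : ℕ) (x : Fin p.n → Bool)
  (r : Fin (p.n * κ) → Bool) (pp : Fin (3 * p.n * κ) → Bool)

/-- The distance between the real and the ideal world for given coins: collisions, the soundness
error of the rounds, and ambiguous public parameters, for which the trivial bound is used. -/
theorem abs_outputProb_sub_le_add {M : ℝ}
    (hM : ∀ y, y ≠ p.f.eval x → G.Hash.collisionProb p.m κ y (p.f.eval x) ≤ M) (hM0 : 0 ≤ M)
    (hc : 0 < G.c)
    (hacc : ∀ (B : ℕ → Circuit (Fin (proverSize A κ p) ⊕ (verifier G κ p).Msg)) s σ,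
      (verifier G κ p).advSize B ≤ (SFVP2 G κ p).advSize (A.act κ p) → IsDensity σ →
      (∀ w, (relation G κ p).eval (Sum.elim s w) () ≠ true) →
      G.AoK.acceptProb κ _ _ (relation G κ p) B σ s < 1 - 1 / (2 * G.c))
    {ρ₀ : DM (Fin (A.c κ p) ⊕ Fin e)} (hρ₀ : IsDensity ρ₀) {k : ℕ}
    (D : Circuit (FinalReg A κ p e ⊕ Fin (k + 1))) {adv : DM (Fin (k + 1))} (hadv : IsDensity adv) :
    |outputProb D adv (realState (SFVP2 G) A κ p e x r pp ρ₀) -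
      outputProb D adv (idealState (simulator A) κ p e x r pp ρ₀)| ≤
      M + p.ε + if G.Com.Ambiguous p.n κ pp then 1 else 0 := by
  refine (abs_outputProb_sub_le A κ p e x r pp hρ₀ D hadv).trans ?_
  have hpos : (initialState A κ p e x r pp ρ₀).PosSemidef := place_posSemidef _ hρ₀.1 _
  have hε : 0 ≤ p.ε := by unfold Params.ε; positivity
  split_ifs with hpp
  · refine (prob_le_trace _ (Circuit.run_posSemidef _ hpos)).trans ?_
    refine (congr_arg Complex.re ((Circuit.trace_run _ _).trans
      (trace_initialState A κ p e x r pp hρ₀))).trans_le ?_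
    rw [Complex.one_re]
    linarith
  · -- a round is passed with probability at most `1 - 1 / (2 * c) ≤ exp (-1 / (2 * c))`
    have h1 := prob_passed_and_ne_le (E := Fin e) (Fintype.equivFin _) (p.f.eval x) hM hM0
      (Real.exp_nonneg (-(1 / (2 * G.c)))) (act := A.act κ p)
      (pub := pubInput G.Com κ p x r pp) (fun v hv j hj σ hσ => by
        refine ((hacc _ _ σ (advSize_proverFrom_le G _ _ hj) hσ
          (G.relation_ne_true hpp hv)).le.trans ?_)
        have := Real.add_one_le_exp (-(1 / (2 * G.c)))
        linarith) hpos (trace_initialState A κ p e x r pp hρ₀)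
      (supported_initialState A κ p e x r pp ρ₀)
    refine h1.trans ?_
    have h3 := G.exp_pow_rounds_le hc p
    linarith

end

end Ingredients

/-- The output probability of a distinguisher is an average over the coins. -/
theorem outputProb_averageState {W : Type} [Fintype W] {a b k : ℕ}
    (D : Circuit (W ⊕ Fin (k + 1))) {adv : DM (Fin (k + 1))}
    (ρ : (Fin a → Bool) → (Fin b → Bool) → DM W) :
    outputProb D adv (averageState ρ) =
      (2 ^ (a + b))⁻¹ * ∑ r, ∑ pp, outputProb D adv (ρ r pp) := by
  have h : ((2 : ℂ) ^ (a + b))⁻¹ = (((2 : ℝ) ^ (a + b))⁻¹ : ℝ) := by push_cast; rfl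
  rw [averageState, h, outputProb_smul, outputProb_sum]
  congr 1
  exact Finset.sum_congr rfl fun r _ => outputProb_sum D _ _

/-- A bound on the distance of average states from bounds for each choice of the coins, with an
exceptional set of public parameters. -/
theorem abs_outputProb_averageState_sub_le {W : Type} [Fintype W] {a b k : ℕ}
    (D : Circuit (W ⊕ Fin (k + 1))) {adv : DM (Fin (k + 1))}
    {ρ σ : (Fin a → Bool) → (Fin b → Bool) → DM W} {δ : ℝ} {Bad : (Fin b → Bool) → Prop}
    (h : ∀ r pp, |outputProb D adv (ρ r pp) - outputProb D adv (σ r pp)| ≤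
      δ + if Bad pp then 1 else 0) :
    |outputProb D adv (averageState ρ) - outputProb D adv (averageState σ)| ≤
      δ + (Nat.card {pp // Bad pp} : ℝ) / 2 ^ b := by
  rw [outputProb_averageState, outputProb_averageState, ← mul_sub, ← Finset.sum_sub_distrib, abs_mul,
    abs_of_nonneg (by positivity : (0 : ℝ) ≤ (2 ^ (a + b))⁻¹)]
  have hsum : |∑ r, (∑ pp, outputProb D adv (ρ r pp) - ∑ pp, outputProb D adv (σ r pp))| ≤
      ∑ _r : Fin a → Bool, ∑ pp : Fin b → Bool, (δ + if Bad pp then 1 else 0) := by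
    refine (Finset.abs_sum_le_sum_abs _ _).trans (Finset.sum_le_sum fun r _ => ?_)
    rw [← Finset.sum_sub_distrib]
    exact (Finset.abs_sum_le_sum_abs _ _).trans (Finset.sum_le_sum fun pp _ => h r pp)
  have hcard : ∑ _r : Fin a → Bool, ∑ pp : Fin b → Bool, (δ + if Bad pp then 1 else 0) =
      2 ^ a * (2 ^ b * δ + Nat.card {pp // Bad pp}) := by
    simp [Finset.sum_add_distrib, Nat.card_eq_fintype_card, Fintype.card_subtype,
      mul_add]
  rw [hcard] at hsum
  refine (mul_le_mul_of_nonneg_left hsum (by positivity)).trans (le_of_eq ?_)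
  rw [pow_add]
  field_simp

theorem theorem7p5 (G : Ingredients)
    (hCom : G.Com.Efficient) (hBind : G.Com.StatisticallyBinding)
    (hHash : G.Hash.Collapsing)
    (hAoK : G.AoK.Efficient) (hc : 0 < G.c) (hSound : G.AoK.LinearlyKnowledgeSound G.c)
    (hSFVP : G.SFVP.Efficient) :
    SoundAgainstClients (SFVP2 G) := by
  intro A hA
  refine ⟨simulator A, G.efficient_simulator hCom hHash.1 hAoK hSFVP hA, ?_⟩
  intro p x e ρ₀ hp hρ₀ k D adv hk hD hadv
  obtain ⟨ν, hν, hbad⟩ := hBind (fun κ => (p κ).n) (PolySize.n.polyBounded hp)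
  obtain ⟨M, hM, hM0, hcoll⟩ := hHash.exists_forall_collisionProb_le (PolySize.m.polyBounded hp)
    fun κ => (p κ).f.eval (x κ)
  have hA' : PolySize fun κ p => A.c κ p + (SFVP2 G κ p).advSize (A.act κ p) := hA
  have hacc := hSound.eventually_acceptProb_lt hc (fun κ => G.relation κ (p κ))
    ((G.polySize_stmtLen hCom hHash.1).polyBounded hp)
    (Ingredients.polySize_witLen.polyBounded hp)
    ((G.polySize_relation hCom hHash.1).polyBounded hp)
    ((Ingredients.polySize_proverSize hCom hHash.1 hSFVP hA).polyBounded hp)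
    ((hA'.mono fun κ p => Nat.le_add_left _ _).polyBounded hp)
  set d : ℕ → ℝ := fun κ =>
    |outputProb (D κ) (adv κ) (averageState fun r pp =>
        realState (SFVP2 G) A κ (p κ) (e κ) (x κ) r pp (ρ₀ κ r pp)) -
      outputProb (D κ) (adv κ) (averageState fun r pp =>
        idealState (simulator A) κ (p κ) (e κ) (x κ) r pp (ρ₀ κ r pp))| with hd
  -- the distinguishing advantage beyond `ε`; the soundness of a round holds only from some `κ`
  -- on, which is enough for this function to be negligible
  refine ⟨fun κ => max 0 (d κ - (p κ).ε), Negligible.of_eventually_le (hM.add hν)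
    (fun κ => le_max_left _ _) ?_, fun κ => ?_⟩
  · filter_upwards [hacc] with κ hκ
    refine max_le (add_nonneg (hM0 κ) (le_trans (by positivity) (hbad κ))) ?_
    have h1 : d κ ≤ _ := abs_outputProb_averageState_sub_le (D κ) fun r pp =>
      Ingredients.abs_outputProb_sub_le_add A κ (p κ) (e κ) (x κ) r pp (hcoll κ) (hM0 κ) hc
        (fun B s σ h => hκ B s σ h) (hρ₀ κ r pp) (D κ) (hadv κ)
    have h2 := hbad κ
    unfold CommitFamily.Ambiguous at h1
    simp only [Pi.add_apply]
    linarith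
  · have : d κ ≤ (p κ).ε + max 0 (d κ - (p κ).ε) := by
      have := le_max_right 0 (d κ - (p κ).ε)
      linarith
    exact this
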